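/- Let $G$ be a compact connected Lie group whose Lie algebra $\mathfrak g$ is semisimple, let $K\subset G$ be a closed connected subgroup with Lie algebra $\mathfrak k$, and let $\pi:G\to G/K$ be the projection. Let $\mathfrak g=\mathfrak k\oplus\mathfrak p$ be any reductive decomposition, i.e. $\mathfrak p$ is an $\mathrm{Ad}(K)$-invariant complement of $\mathfrak k$; write $X=X_{\mathfrak k}+X_{\mathfrak p}$ accordingly, and identify the $G$-invariant $m$-forms on $G/K$ with the space $(\Lambda^m\mathfrak p^*)^K$ of $\mathrm{Ad}(K)$-invariant $m$-forms on $\mathfrak p$. A symmetric bilinear form $Q$ on $\mathfrak g$ is called bi-invariant if $Q([X,Y],Z)=-Q(Y,[X,Z])$ for all $X,Y,Z\in\mathfrak g$. (i) Let $Q$ be a bi-invariant symmetric bilinear form on $\mathfrak g$ with $Q|_{\mathfrak k\times\mathfrak k}=0$. Then $$H_Q(X,Y,Z):=4Q([X,Y],Z)-Q([X,Y]_{\mathfrak p},Z)+Q([X,Z]_{\mathfrak p},Y)-Q([Y,Z]_{\mathfrak p},X),\qquad X,Y,Z\in\mathfrak p,$$ is an element of $(\Lambda^3\mathfrak p^*)^K$,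 it defines a closed $G$-invariant $3$-form on $G/K$, and $$H_Q(X,Y,Z)=Q([X,Y],Z)+Q([X,Y]_{\mathfrak k},Z)-Q([X,Z]_{\mathfrak k},Y)+Q([Y,Z]_{\mathfrak k},X).$$ Moreover, as left-invariant forms on $G$, $\pi^*H_Q=Q([\cdot,\cdot],\cdot)+d\alpha_Q$, where $\alpha_Q\in\Lambda^2\mathfrak g^*$ is given by $\alpha_Q|_{\mathfrak k\times\mathfrak k}=0$, $\alpha_Q|_{\mathfrak p\times\mathfrak p}=0$ and $\alpha_Q(X,Z)=Q(X,Z)$ for $X\in\mathfrak p$, $Z\in\mathfrak k$. (ii) Every class in the real de Rham cohomology $H^3(G/K)$ has a unique representative of the form $H_Q$ as in (i): the map $Q\mapsto[H_Q]$ is a linear isomorphism $$\{Q \text{ bi-invariant symmetric bilinear form on }\mathfrak g:\ Q|_{\mathfrak k\times\mathfrak k}=0\}\;\simeq\;H^3(G/K).$$ The same holds within $G$-invariant forms: for every closed $H\in(\Lambda^3\mathfrak p^*)^K$ there is exactly one such $Q$ with $H=H_Q+d\beta$ for some $\beta\in(\Lambda^2\mathfrak p^*)^K$. Consequently $H^3(G/K)$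 is finite-dimensional and $$b_3(G/K):=\dim H^3(G/K)=s-d_{G/K},$$ where $s$ is the number of simple ideals of $\mathfrak g$ and $d_{G/K}:=\dim\{Q|_{\mathfrak k\times\mathfrak k}: Q\text{ a bi-invariant symmetric bilinear form on }\mathfrak g\}$. -/

import Mathlib

open scoped Manifold ContDiff

noncomputable section

namespace HomogeneousSpace

/-! ### Algebra: bi-invariant forms and the `3`-form attached to one of them -/

section Algebra

variable (L : Type*) [LieRing L] [LieAlgebra ℝ L]

/-- The space `Sym²(𝔤)^G` of bi-invariant symmetric bilinear forms on the Lie algebra: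
`Q(X, Y) = Q(Y, X)` and `Q([X, Y], Z) = -Q(Y, [X, Z])`. -/
def biInvariantForms : Submodule ℝ (LinearMap.BilinForm ℝ L) where
  carrier := {Q | Q.IsSymm ∧ Q.lieInvariant L}
  add_mem' := by
    rintro P Q ⟨hP, hP'⟩ ⟨hQ, hQ'⟩
    refine ⟨hP.add hQ, fun x y z => ?_⟩
    simp only [LinearMap.add_apply, hP' x y z, hQ' x y z]
    ring
  zero_mem' := ⟨⟨fun _ _ => rfl⟩, fun _ _ _ => by simp⟩
  smul_mem' := by
    rintro c Q ⟨hQ, hQ'⟩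
    refine ⟨⟨fun x y => ?_⟩, fun x y z => ?_⟩
    · simp only [LinearMap.smul_apply, hQ.eq x y]
    · simp only [LinearMap.smul_apply, hQ' x y z, smul_neg]

/-- The number `s` of simple ideals of the Lie algebra. For a semisimple Lie algebra these are
exactly the summands of its decomposition `𝔤₁ ⊕ ⋯ ⊕ 𝔤ₛ` into simple ideals. -/
def numSimpleIdeals : ℕ :=
  {I : LieIdeal ℝ L | LieAlgebra.IsSimple ℝ I}.ncard

variable {L}

/-- Restriction of bilinear forms to `𝔨 × 𝔨`. -/
def restrictForm (𝔨 : Submodule ℝ L) :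
    LinearMap.BilinForm ℝ L →ₗ[ℝ] LinearMap.BilinForm ℝ 𝔨 where
  toFun Q := Q.restrict 𝔨
  map_add' _ _ := rfl
  map_smul' _ _ := rfl

/-- The bi-invariant symmetric bilinear forms `Q` with `Q|_{𝔨 × 𝔨} = 0`. -/
def vanishingForms (𝔨 : Submodule ℝ L) : Submodule ℝ (biInvariantForms L) :=
  LinearMap.ker ((restrictForm 𝔨).comp (biInvariantForms L).subtype)

/-- `d_{G/K} = dim {Q|_{𝔨 × 𝔨} : Q bi-invariant symmetric bilinear form on 𝔤}`. -/
def restrictionDim (𝔨 : Submodule ℝ L) : ℕ :=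
  Module.finrank ℝ ((biInvariantForms L).map (restrictForm 𝔨))

variable {𝔨 𝔭 : Submodule ℝ L}

/-- The component `X_𝔭` of `X` in `𝔤 = 𝔨 ⊕ 𝔭`, as an element of the Lie algebra. -/
def pComp (h : IsCompl 𝔨 𝔭) : L →ₗ[ℝ] L :=
  𝔭.subtype.comp (Submodule.projectionOnto 𝔭 𝔨 h.symm)

/-- The component `X_𝔨` of `X` in `𝔤 = 𝔨 ⊕ 𝔭`, as an element of the Lie algebra. -/
def kComp (h : IsCompl 𝔨 𝔭) : L →ₗ[ℝ] L :=
  𝔨.subtype.comp (Submodule.projectionOnto 𝔨 𝔭 h)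

/-- The `3`-form `H_Q` on `𝔭`:
`H_Q(X,Y,Z) = 4 Q([X,Y],Z) - Q([X,Y]_𝔭,Z) + Q([X,Z]_𝔭,Y) - Q([Y,Z]_𝔭,X)`. -/
def threeForm (h : IsCompl 𝔨 𝔭) (Q : biInvariantForms L) : 𝔭 [⋀^Fin 3]→ₗ[ℝ] ℝ where
  toFun v :=
    4 * Q.1 ⁅(v 0 : L), (v 1 : L)⁆ (v 2) - Q.1 (pComp h ⁅(v 0 : L), (v 1 : L)⁆) (v 2)
      + Q.1 (pComp h ⁅(v 0 : L), (v 2 : L)⁆) (v 1) - Q.1 (pComp h ⁅(v 1 : L), (v 2 : L)⁆) (v 0)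
  map_update_add' := by
    intro hdec v i x y
    obtain rfl : hdec = instDecidableEqFin 3 := Subsingleton.elim _ _
    fin_cases i <;> simp <;> ring
  map_update_smul' := by
    intro hdec v i c x
    obtain rfl : hdec = instDecidableEqFin 3 := Subsingleton.elim _ _
    fin_cases i <;> simp <;> ring
  map_eq_zero_of_eq' := by
    have key : ∀ x y : L, Q.1 ⁅x, y⁆ y = 0 := by
      intro x y
      have h1 := Q.2.2 x y y
      have h2 := Q.2.1.eq y ⁅x, y⁆
      linarith
    have key' : ∀ x y : L, Q.1 ⁅x, y⁆ x = 0 := by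
      intro x y
      rw [← lie_skew, map_neg, LinearMap.neg_apply, key, neg_zero]
    intro v i j hv hij
    have aux : ∀ x y : L, Q.1 (pComp h ⁅y, x⁆) = - Q.1 (pComp h ⁅x, y⁆) := by
      intro x y
      rw [← lie_skew, map_neg, map_neg]
    fin_cases i <;> fin_cases j <;> simp at hij hv
    all_goals simp [hv, key, key']
    all_goals (rw [aux]; simp)

/-- The horizontal extension `π^*α` to `𝔤 = 𝔨 ⊕ 𝔭` of a `k`-form `α` on `𝔭`:
it vanishes as soon as one argument is in `𝔨`, and it agrees with `α` on `𝔭`. -/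
def hat (h : IsCompl 𝔨 𝔭) {m : ℕ} (α : 𝔭 [⋀^Fin m]→ₗ[ℝ] ℝ) : L [⋀^Fin m]→ₗ[ℝ] ℝ :=
  α.compLinearMap (Submodule.projectionOnto 𝔭 𝔨 h.symm)

end Algebra

/-! ### Geometry: the de Rham cohomology of `G/K` -/

section Geometry

variable {n : ℕ} {G : Type*} [TopologicalSpace G] [ChartedSpace (EuclideanSpace ℝ (Fin n)) G]
  [Group G]

/-- A smooth Lie group has the regularity under which its tangent space at `1` is given a
Lie algebra structure. -/
instance instLieGroupMinSmoothness [LieGroup (𝓡 n) ∞ G] :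
    LieGroup (𝓡 n) (minSmoothness ℝ 3) G :=
  LieGroup.of_le (n := ∞) (by
    rw [minSmoothness_of_isRCLikeNormedField]
    exact ENat.LEInfty.out)

variable (n) in
/-- The adjoint representation: `Ad h` is the derivative at `1` of `y ↦ h y h⁻¹`. -/
def Ad (h : G) : GroupLieAlgebra (𝓡 n) G →ₗ[ℝ] GroupLieAlgebra (𝓡 n) G :=
  (mfderiv (𝓡 n) (𝓡 n) (fun y : G => h * y * h⁻¹) 1).toLinearMap

variable (n) in
/-- The Lie algebra of a closed subgroup `K` of `G`, inside the Lie algebra of `G`: the velocities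
at time `0` of the smooth curves through `1` that stay in `K`. (These velocities already form
a linear subspace; the span only bundles it.) -/
def subgroupLieAlgebra (K : Subgroup G) : Submodule ℝ (GroupLieAlgebra (𝓡 n) G) :=
  Submodule.span ℝ {X | ∃ γ : ℝ → G, ContMDiff 𝓘(ℝ, ℝ) (𝓡 n) ∞ γ ∧ (∀ t, γ t ∈ K) ∧ γ 0 = 1 ∧
    X = mfderiv 𝓘(ℝ, ℝ) (𝓡 n) γ 0 (1 : ℝ)}

variable (n G) in
/-- Differential `m`-forms on the Lie group `G`, in the global frame of left-invariant vector
fields: `β` stands for the form whose value at `x` on the values `(v₁)_x, …, (v_m)_x` of the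
left-invariant vector fields generated by `v₁, …, v_m ∈ 𝔤` is `β x v`.
In particular the left-invariant forms are the constant functions. -/
def Form (m : ℕ) : Type _ := G → (GroupLieAlgebra (𝓡 n) G) [⋀^Fin m]→ₗ[ℝ] ℝ

instance instAddCommGroupForm (m : ℕ) : AddCommGroup (Form n G m) :=
  inferInstanceAs (AddCommGroup (G → (GroupLieAlgebra (𝓡 n) G) [⋀^Fin m]→ₗ[ℝ] ℝ))

instance instModuleForm (m : ℕ) : Module ℝ (Form n G m) :=
  inferInstanceAs (Module ℝ (G → (GroupLieAlgebra (𝓡 n) G) [⋀^Fin m]→ₗ[ℝ] ℝ))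

lemma Form.zero_apply {m : ℕ} (x : G) (v : Fin m → GroupLieAlgebra (𝓡 n) G) :
    (0 : Form n G m) x v = 0 := rfl

lemma Form.add_apply {m : ℕ} (β η : Form n G m) (x : G)
    (v : Fin m → GroupLieAlgebra (𝓡 n) G) : (β + η) x v = β x v + η x v := rfl

lemma Form.smul_apply {m : ℕ} (c : ℝ) (β : Form n G m) (x : G)
    (v : Fin m → GroupLieAlgebra (𝓡 n) G) : (c • β) x v = c * β x v := rfl

/-- The left-invariant form on `G` whose value at `1` is `β`. -/
def leftInvariantForm {m : ℕ} (β : GroupLieAlgebra (𝓡 n) G [⋀^Fin m]→ₗ[ℝ] ℝ) : Form n G m :=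
  fun _ => β

/-- Smoothness of a differential form. -/
def IsSmoothForm {m : ℕ} (β : Form n G m) : Prop :=
  ∀ v, ContMDiff (𝓡 n) 𝓘(ℝ, ℝ) ∞ fun x => β x v

/-- The derivative at `x` of a function along the left-invariant vector field generated
by `X`. -/
def derivAlong (X : GroupLieAlgebra (𝓡 n) G) (f : G → ℝ) (x : G) : ℝ :=
  mfderiv (𝓡 n) 𝓘(ℝ, ℝ) f x (mulInvariantVectorField X x)

/-- The exterior derivative of a form of degree `m + 1 ≥ 1`, evaluated on left-invariant vector
fields `v₀, …, v_{m+1}`: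
`dβ(v₀,…,v_{m+1}) = ∑ᵢ (-1)ⁱ vᵢ(β(…,v̂ᵢ,…)) + ∑_{i<j} (-1)^{i+j} β([vᵢ,vⱼ],…,v̂ᵢ,…,v̂ⱼ,…)`.
The pair `i < j` is `(i.castSucc, j.succ)` with `i ≤ j` in `Fin (m + 1)`. -/
def extDer {m : ℕ} (β : Form n G (m + 1)) (x : G)
    (v : Fin (m + 2) → GroupLieAlgebra (𝓡 n) G) : ℝ :=
  (∑ i : Fin (m + 2), (-1 : ℝ) ^ (i : ℕ) * derivAlong (v i) (fun y => β y (i.removeNth v)) x)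
    + ∑ i : Fin (m + 1), ∑ j ∈ Finset.univ.filter (fun j : Fin (m + 1) => i ≤ j),
        (-1 : ℝ) ^ ((i.castSucc : ℕ) + (j.succ : ℕ)) *
          β x (Matrix.vecCons ⁅v i.castSucc, v j.succ⁆ (j.removeNth (i.castSucc.removeNth v)))

/-- The smooth forms on `G` that are pullbacks `π^*b` of a (unique) smooth form `b` on the
manifold `G/K` under `π : G → G/K`: those which are horizontal, i.e. vanish if one argument is
tangent to the fibres, and invariant under the right translations by elements of `K`. In the
left-invariant frame, right translation by `h` acts on the arguments by `Ad h`. -/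
structure IsQuotientForm (K : Subgroup G) {m : ℕ} (β : Form n G m) : Prop where
  smooth : IsSmoothForm β
  horizontal : ∀ (x : G) (v : Fin m → GroupLieAlgebra (𝓡 n) G),
    (∃ i, v i ∈ subgroupLieAlgebra n K) → β x v = 0
  equivariant : ∀ h ∈ K, ∀ (x : G) (v : Fin m → GroupLieAlgebra (𝓡 n) G),
    β (x * h) v = β x (fun i => Ad n h (v i))

lemma IsSmoothForm.mdifferentiableAt {m : ℕ} {β : Form n G m} (h : IsSmoothForm β)
    (v : Fin m → GroupLieAlgebra (𝓡 n) G) (x : G) :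
    MDifferentiableAt (𝓡 n) 𝓘(ℝ, ℝ) (fun y => β y v) x :=
  ((h v).contMDiffAt).mdifferentiableAt (by simp)

lemma derivAlong_add (X : GroupLieAlgebra (𝓡 n) G) {f g : G → ℝ} {x : G}
    (hf : MDifferentiableAt (𝓡 n) 𝓘(ℝ, ℝ) f x) (hg : MDifferentiableAt (𝓡 n) 𝓘(ℝ, ℝ) g x) :
    derivAlong X (fun y => f y + g y) x = derivAlong X f x + derivAlong X g x := by
  unfold derivAlong
  have := mfderiv_add hf hg
  exact congrArg (fun T => T (mulInvariantVectorField X x)) this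

lemma derivAlong_const_mul (X : GroupLieAlgebra (𝓡 n) G) (c : ℝ) {f : G → ℝ} {x : G}
    (hf : MDifferentiableAt (𝓡 n) 𝓘(ℝ, ℝ) f x) :
    derivAlong X (fun y => c * f y) x = c * derivAlong X f x := by
  unfold derivAlong
  have := const_smul_mfderiv hf c
  exact congrArg (fun T => T (mulInvariantVectorField X x)) this

lemma extDer_add {m : ℕ} {β η : Form n G (m + 1)} (hβ : IsSmoothForm β) (hη : IsSmoothForm η)
    (x : G) (v : Fin (m + 2) → GroupLieAlgebra (𝓡 n) G) :
    extDer (β + η) x v = extDer β x v + extDer η x v := by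
  have h : ∀ i : Fin (m + 2), derivAlong (v i) (fun y => (β + η) y (i.removeNth v)) x =
      derivAlong (v i) (fun y => β y (i.removeNth v)) x +
        derivAlong (v i) (fun y => η y (i.removeNth v)) x := fun i =>
    derivAlong_add (v i) (hβ.mdifferentiableAt _ x) (hη.mdifferentiableAt _ x)
  simp only [extDer, h]
  simp only [Form.add_apply, mul_add, Finset.sum_add_distrib]
  ring

lemma extDer_smul {m : ℕ} (c : ℝ) {β : Form n G (m + 1)} (hβ : IsSmoothForm β)
    (x : G) (v : Fin (m + 2) → GroupLieAlgebra (𝓡 n) G) :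
    extDer (c • β) x v = c * extDer β x v := by
  have h : ∀ i : Fin (m + 2), derivAlong (v i) (fun y => (c • β) y (i.removeNth v)) x =
      c * derivAlong (v i) (fun y => β y (i.removeNth v)) x := fun i =>
    derivAlong_const_mul (v i) c (hβ.mdifferentiableAt _ x)
  simp only [extDer, h]
  simp only [Form.smul_apply, mul_add,
    Finset.mul_sum, mul_left_comm c]

lemma extDer_zero {m : ℕ} (x : G) (v : Fin (m + 2) → GroupLieAlgebra (𝓡 n) G) :
    extDer (0 : Form n G (m + 1)) x v = 0 := by
  have h0 : IsSmoothForm (0 : Form n G (m + 1)) := fun _ => contMDiff_const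
  have := extDer_smul (0 : ℝ) h0 x v
  rwa [zero_smul, zero_mul] at this

lemma IsQuotientForm.zero (K : Subgroup G) {m : ℕ} :
    IsQuotientForm K (0 : Form n G m) :=
  ⟨fun _ => contMDiff_const, fun _ _ _ => rfl, fun _ _ _ _ => rfl⟩

lemma IsQuotientForm.add {K : Subgroup G} {m : ℕ} {β η : Form n G m}
    (hβ : IsQuotientForm K β) (hη : IsQuotientForm K η) : IsQuotientForm K (β + η) where
  smooth v := (hβ.smooth v).add (hη.smooth v)
  horizontal x v hv := by
    rw [Form.add_apply, hβ.horizontal x v hv, hη.horizontal x v hv, add_zero]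
  equivariant h hh x v := by
    rw [Form.add_apply, Form.add_apply, hβ.equivariant h hh x v, hη.equivariant h hh x v]

lemma IsQuotientForm.smul {K : Subgroup G} {m : ℕ} (c : ℝ) {β : Form n G m}
    (hβ : IsQuotientForm K β) : IsQuotientForm K (c • β) where
  smooth v := (contMDiff_const (I := 𝓡 n) (I' := 𝓘(ℝ, ℝ)) (c := c)).smul (hβ.smooth v)
  horizontal x v hv := by
    rw [Form.smul_apply, hβ.horizontal x v hv, mul_zero]
  equivariant h hh x v := by
    rw [Form.smul_apply, Form.smul_apply, hβ.equivariant h hh x v]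

/-- The closed smooth forms of degree `m + 1` on `G/K`. -/
def closedForms (K : Subgroup G) (m : ℕ) : Submodule ℝ (Form n G (m + 1)) where
  carrier := {β | IsQuotientForm K β ∧ ∀ x v, extDer β x v = 0}
  add_mem' := by
    rintro β η ⟨hβ, hβ'⟩ ⟨hη, hη'⟩
    exact ⟨hβ.add hη, fun x v => by rw [extDer_add hβ.smooth hη.smooth, hβ', hη', add_zero]⟩
  zero_mem' := ⟨IsQuotientForm.zero K, extDer_zero⟩
  smul_mem' := by
    rintro c β ⟨hβ, hβ'⟩
    exact ⟨hβ.smul c, fun x v => by rw [extDer_smul c hβ.smooth, hβ', mul_zero]⟩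

/-- The exact forms of degree `m + 2` on `G/K`: the exterior derivatives of the smooth forms of
degree `m + 1` on `G/K`. -/
def exactForms (K : Subgroup G) (m : ℕ) : Submodule ℝ (Form n G (m + 2)) where
  carrier := {β | ∃ η : Form n G (m + 1), IsQuotientForm K η ∧ ∀ x v, β x v = extDer η x v}
  add_mem' := by
    rintro _ _ ⟨η, hη, e⟩ ⟨θ, hθ, e'⟩
    refine ⟨η + θ, hη.add hθ, fun x v => ?_⟩
    rw [extDer_add hη.smooth hθ.smooth, Form.add_apply, e, e']
  zero_mem' := ⟨0, IsQuotientForm.zero K, fun x v => (extDer_zero x v).symm⟩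
  smul_mem' := by
    rintro c _ ⟨η, hη, e⟩
    refine ⟨c • η, hη.smul c, fun x v => ?_⟩
    rw [extDer_smul c hη.smooth, Form.smul_apply, e]

variable (n) in
/-- The third real de Rham cohomology `H³(G/K)` of the manifold `G/K`:
closed smooth `3`-forms modulo exact ones. -/
abbrev deRhamH3 (K : Subgroup G) : Type _ :=
  closedForms (n := n) K 2 ⧸ (exactForms (n := n) K 1).submoduleOf (closedForms (n := n) K 2)

/-- `Ad(K)`-invariance of an `m`-form on an `Ad(K)`-invariant subspace `𝔭`. -/
def IsAdInvariant (K : Subgroup G) {𝔭 : Submodule ℝ (GroupLieAlgebra (𝓡 n) G)} {m : ℕ}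
    (α : 𝔭 [⋀^Fin m]→ₗ[ℝ] ℝ) : Prop :=
  ∀ h ∈ K, ∀ v w : Fin m → 𝔭, (∀ i, (w i : GroupLieAlgebra (𝓡 n) G) = Ad n h (v i)) → α w = α v

end Geometry

end HomogeneousSpace

end

/-! Forms on `G/K` are treated as forms on `G`, written in the left-invariant frame, that are
horizontal and equivariant under `Ad(K)`. The `G`-invariant forms are then the constant functions.
The identity behind (i) is `hat_threeForm_apply`: on all of `𝔤` the pullback of `H_Q` equals
`Q([·,·],·) + dα_Q`. Closedness is therefore the Jacobi identity (`cartan_add_exact_closed`).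

The passage from arbitrary to invariant forms rests on one functional. On a compact connected `G`
the sup norm of the derivative of `f` along right-invariant fields bounds `|f x - f 1|`, hence also
`|∫ f - f 1|`. By Hahn–Banach there is a continuous functional `T` (`transfer`) with `∫ f - f 1 =
T(∇f)` for every smooth `f`. Right-invariant fields generate left translations, so applying `T` to
the contraction of `β` with these fields gives a homotopy operator. For a closed 3-form, Cartan's
formula turns it into `d(Tιβ) = average β - β` (`extDer_primitiveForm`). The contraction keeps forms
horizontal and equivariant, so every class on `G/K` has an invariant representative.

The same `T`, applied to the functions `g ↦ c(Ad g X, Ad g Y, ...)`, does the analogous work on the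
Lie algebra. It gives `H²(𝔤) = 0` (`exists_primitive_two`), because an invariant 2-form on a perfect
Lie algebra vanishes. It also shows that a closed 3-form is `Ad(G)`-invariant up to an exact one
(`average₁_sub_of_closed`). By Koszul's argument the invariant 3-forms are exactly the `q([·,·],·)`
with `q` bi-invariant, so a closed left-invariant 3-form is `q([·,·],·) + dα`.

For surjectivity, let this 3-form be the pullback of an invariant form on `G/K`, and average `α`
over the compact group `K`. For `Z ∈ 𝔨`, horizontality and `K`-invariance give `(α + q)(Z, [X, Y]) =
0`, so `α(Z, ·) = -q(Z, ·)` by perfectness. Since `α` is skew and `q` symmetric, `q` must vanish on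
`𝔨 × 𝔨`. Moreover `α - α_q` descends to `𝔭`, so the class is that of `H_q`.

For injectivity, a primitive of `H_Q` may be averaged to a left-invariant one, so `Q([·,·],·)` is
exact on `𝔤`. Averaging over `Ad(G)` kills the primitive and fixes `Q([·,·],·)`. Hence this form is
zero, and `Q = 0` by perfectness.

For the dimension, averaging an inner product gives a positive definite bi-invariant `B`. Distinct
simple ideals are orthogonal for every bi-invariant `Q`, and on each of them `Q` is a multiple of
`B` by the spectral theorem, so the bi-invariant forms have dimension `s`. Rank-nullity for the
restriction to `𝔨` finishes the count. -/

noncomputable section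

set_option linter.unusedSectionVars false
set_option maxSynthPendingDepth 3

namespace HomogeneousSpace

open Filter Topology

/-! ### Calculus at the identity of a Lie group -/

section Calculus

variable {n : ℕ} {G : Type*} [TopologicalSpace G] [ChartedSpace (EuclideanSpace ℝ (Fin n)) G]
  [Group G]
  {V : Type*} [NormedAddCommGroup V] [NormedSpace ℝ V]

variable (n G) in
/-- The inverse of the preferred chart at the identity. -/
def par : EuclideanSpace ℝ (Fin n) → G := (extChartAt (𝓡 n) (1 : G)).symm

variable (n) in
/-- The preferred chart at the identity. -/
def crd : G → EuclideanSpace ℝ (Fin n) := extChartAt (𝓡 n) (1 : G)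

variable (n) in
/-- The derivative of a function at the identity. -/
def dOne (F : G → V) : EuclideanSpace ℝ (Fin n) →L[ℝ] V :=
  fderiv ℝ (fun u => F (par n G u)) (crd n (1 : G))

lemma par_crd_one : par n G (crd n (1 : G)) = 1 := extChartAt_to_inv (I := 𝓡 n) (1 : G)

lemma eventually_par_crd : ∀ᶠ x in 𝓝 (1 : G), par n G (crd n x) = x := by
  filter_upwards [extChartAt_source_mem_nhds (I := 𝓡 n) (1 : G)] with x hx
  exact (extChartAt (𝓡 n) (1 : G)).left_inv hx

lemma target_mem_nhds : (extChartAt (𝓡 n) (1 : G)).target ∈ 𝓝 (crd n (1 : G)) :=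
  extChartAt_target_mem_nhds (I := 𝓡 n) (1 : G)

lemma crd_par {u : EuclideanSpace ℝ (Fin n)} (hu : u ∈ (extChartAt (𝓡 n) (1 : G)).target) :
    crd n (par n G u) = u :=
  (extChartAt (𝓡 n) (1 : G)).right_inv hu

lemma eventually_crd_par : ∀ᶠ u in 𝓝 (crd n (1 : G)), crd n (par n G u) = u := by
  filter_upwards [target_mem_nhds] with u hu
  exact crd_par hu

variable [LieGroup (𝓡 n) ∞ G]

lemma contMDiffOn_par :
    ContMDiffOn 𝓘(ℝ, EuclideanSpace ℝ (Fin n)) (𝓡 n) ∞ (par n G)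
      (extChartAt (𝓡 n) (1 : G)).target :=
  contMDiffOn_extChartAt_symm (1 : G)

lemma contMDiffAt_par {u : EuclideanSpace ℝ (Fin n)}
    (hu : u ∈ (extChartAt (𝓡 n) (1 : G)).target) :
    ContMDiffAt 𝓘(ℝ, EuclideanSpace ℝ (Fin n)) (𝓡 n) ∞ (par n G) u :=
  contMDiffOn_par.contMDiffAt ((isOpen_extChartAt_target (I := 𝓡 n) (1 : G)).mem_nhds hu)

lemma one_mem_target : crd n (1 : G) ∈ (extChartAt (𝓡 n) (1 : G)).target :=
  mem_extChartAt_target (I := 𝓡 n) (1 : G)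

lemma contMDiffAt_crd : ContMDiffAt (𝓡 n) 𝓘(ℝ, EuclideanSpace ℝ (Fin n)) ∞ (crd n) (1 : G) :=
  contMDiffAt_extChartAt

lemma continuousAt_par : ContinuousAt (par n G) (crd n (1 : G)) :=
  (contMDiffAt_par one_mem_target).continuousAt

lemma contDiffAt_comp_par {F : G → V} {u : EuclideanSpace ℝ (Fin n)}
    (hu : u ∈ (extChartAt (𝓡 n) (1 : G)).target) {k : ℕ∞}
    (hF : ContMDiffAt (𝓡 n) 𝓘(ℝ, V) k F (par n G u)) :
    ContDiffAt ℝ k (fun u => F (par n G u)) u := by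
  rw [← contMDiffAt_iff_contDiffAt]
  exact hF.comp u ((contMDiffAt_par hu).of_le (by exact_mod_cast le_top))

lemma hasFDerivAt_dOne {F : G → V} (hF : ContMDiffAt (𝓡 n) 𝓘(ℝ, V) ∞ F 1) :
    HasFDerivAt (fun u => F (par n G u)) (dOne n F) (crd n (1 : G)) := by
  have : ContDiffAt ℝ ∞ (fun u => F (par n G u)) (crd n (1 : G)) :=
    contDiffAt_comp_par one_mem_target (by rwa [par_crd_one])
  exact (this.differentiableAt (by simp)).hasFDerivAt

lemma mfderiv_one_eq_dOne {F : G → V} (hF : ContMDiffAt (𝓡 n) 𝓘(ℝ, V) ∞ F 1)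
    (v : EuclideanSpace ℝ (Fin n)) :
    mfderiv (𝓡 n) 𝓘(ℝ, V) F 1 v = dOne n F v := by
  rw [(hF.mdifferentiableAt (by simp)).mfderiv]
  simp [dOne, writtenInExtChartAt, Function.comp_def, fderivWithin_univ]
  rfl

/-- The derivative of a jointly smooth map in one variable is smooth in the other. The base point in
the chart is fixed and both spaces are model spaces, so tangent coordinates change nothing. -/
lemma contMDiffAt_dOne {F : G → G → V} {x : G}
    (hF : ContMDiffAt ((𝓡 n).prod (𝓡 n)) 𝓘(ℝ, V) ∞ (Function.uncurry F) (x, 1)) :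
    ContMDiffAt (𝓡 n) 𝓘(ℝ, EuclideanSpace ℝ (Fin n) →L[ℝ] V) ∞ (fun x => dOne n (F x)) x := by
  have h1 : ContMDiffAt ((𝓡 n).prod 𝓘(ℝ, EuclideanSpace ℝ (Fin n))) 𝓘(ℝ, V) ∞
      (Function.uncurry fun (y : G) (u : EuclideanSpace ℝ (Fin n)) => F y (par n G u))
      (x, crd n (1 : G)) := by
    have h2 : ContMDiffAt ((𝓡 n).prod 𝓘(ℝ, EuclideanSpace ℝ (Fin n))) ((𝓡 n).prod (𝓡 n)) ∞
        (fun q : G × EuclideanSpace ℝ (Fin n) => (q.1, par n G q.2)) (x, crd n (1 : G)) :=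
      contMDiffAt_fst.prodMk
        (ContMDiffAt.comp (x, crd n (1 : G)) (contMDiffAt_par one_mem_target) contMDiffAt_snd)
    exact ContMDiffAt.comp_of_eq hF h2 (by simp [par_crd_one])
  have := ContMDiffAt.mfderiv (m := ∞) (n := ∞) _ (fun _ : G => crd n (1 : G)) h1
    contMDiffAt_const (by simp)
  have e := inTangentCoordinates_model_space (I := 𝓘(ℝ, EuclideanSpace ℝ (Fin n)))
    (I' := 𝓘(ℝ, V)) (fun _ : G => crd n (1 : G)) (fun y : G => F y (par n G (crd n (1 : G))))
    (fun y => dOne n (F y)) x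
  rw [← e]
  simp only [mfderiv_eq_fderiv] at this
  exact this

end Calculus

/-! ### Left and right translations and the adjoint representation in a chart -/

section Translations

variable {n : ℕ} {G : Type*} [TopologicalSpace G] [ChartedSpace (EuclideanSpace ℝ (Fin n)) G]
  [Group G]
  {V : Type*} [NormedAddCommGroup V] [NormedSpace ℝ V]

variable (n) in
/-- The derivative of `Ψ` along left-invariant vector fields. -/
def lgrad (Ψ : G → V) (x : G) : EuclideanSpace ℝ (Fin n) →L[ℝ] V := dOne n fun z => Ψ (x * z)

variable (n) in
/-- The derivative of `Ψ` along right-invariant vector fields. -/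
def rgrad (Ψ : G → V) (x : G) : EuclideanSpace ℝ (Fin n) →L[ℝ] V := dOne n fun z => Ψ (z * x)

variable (n) in
/-- The adjoint representation by continuous linear maps, computed in a chart. -/
def AdL (g : G) : EuclideanSpace ℝ (Fin n) →L[ℝ] EuclideanSpace ℝ (Fin n) :=
  dOne n fun y => crd n (g * y * g⁻¹)

variable [LieGroup (𝓡 n) ∞ G]

lemma contMDiff_lgrad {Ψ : G → V} (hΨ : ContMDiff (𝓡 n) 𝓘(ℝ, V) ∞ Ψ) :
    ContMDiff (𝓡 n) 𝓘(ℝ, EuclideanSpace ℝ (Fin n) →L[ℝ] V) ∞ (lgrad n Ψ) := fun _ =>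
  contMDiffAt_dOne ((hΨ.comp (contMDiff_fst.mul contMDiff_snd)).contMDiffAt)

lemma contMDiff_rgrad {Ψ : G → V} (hΨ : ContMDiff (𝓡 n) 𝓘(ℝ, V) ∞ Ψ) :
    ContMDiff (𝓡 n) 𝓘(ℝ, EuclideanSpace ℝ (Fin n) →L[ℝ] V) ∞ (rgrad n Ψ) := fun _ =>
  contMDiffAt_dOne ((hΨ.comp (contMDiff_snd.mul contMDiff_fst)).contMDiffAt)

lemma contMDiff_AdL :
    ContMDiff (𝓡 n) 𝓘(ℝ, EuclideanSpace ℝ (Fin n) →L[ℝ] EuclideanSpace ℝ (Fin n)) ∞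
      (AdL n : G → _) := fun x => by
  refine contMDiffAt_dOne (F := fun g y => crd n (g * y * g⁻¹)) ?_
  have h : ContMDiff ((𝓡 n).prod (𝓡 n)) (𝓡 n) ∞ fun q : G × G => q.1 * q.2 * q.1⁻¹ :=
    (contMDiff_fst.mul contMDiff_snd).mul contMDiff_fst.inv
  exact ContMDiffAt.comp_of_eq contMDiffAt_crd h.contMDiffAt (by simp)

lemma contMDiff_mul_left_right (a b : G) :
    ContMDiff (𝓡 n) (𝓡 n) ∞ fun z : G => a * z * b :=
  (contMDiff_const.mul contMDiff_id).mul contMDiff_const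

lemma hasFDerivAt_lgrad {Ψ : G → V} (hΨ : ContMDiff (𝓡 n) 𝓘(ℝ, V) ∞ Ψ) (x : G) :
    HasFDerivAt (fun u => Ψ (x * par n G u)) (lgrad n Ψ x) (crd n (1 : G)) :=
  hasFDerivAt_dOne (hΨ.comp (contMDiff_const.mul contMDiff_id)).contMDiffAt

lemma hasFDerivAt_rgrad {Ψ : G → V} (hΨ : ContMDiff (𝓡 n) 𝓘(ℝ, V) ∞ Ψ) (x : G) :
    HasFDerivAt (fun u => Ψ (par n G u * x)) (rgrad n Ψ x) (crd n (1 : G)) :=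
  hasFDerivAt_dOne (F := fun z => Ψ (z * x))
    (hΨ.comp (contMDiff_id.mul contMDiff_const)).contMDiffAt

/-- The chain rule. Because `φ` fixes `1`, both factors can be read in the single chart at `1`. -/
lemma dOne_comp {F : G → V} {φ : G → G} (hF : ContMDiffAt (𝓡 n) 𝓘(ℝ, V) ∞ F 1)
    (hφ : ContMDiffAt (𝓡 n) (𝓡 n) ∞ φ 1) (h1 : φ 1 = 1) :
    dOne n (fun z => F (φ z)) = dOne n F ∘L dOne n fun z => crd n (φ z) := by
  have e1 : (fun u => F (φ (par n G u))) =ᶠ[𝓝 (crd n (1 : G))]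
      fun u => F (par n G (crd n (φ (par n G u)))) := by
    have : Tendsto (fun u => φ (par n G u)) (𝓝 (crd n (1 : G))) (𝓝 1) := by
      have hc : ContinuousAt (fun u => φ (par n G u)) (crd n (1 : G)) :=
        ContinuousAt.comp (by rw [par_crd_one]; exact hφ.continuousAt) continuousAt_par
      simpa [ContinuousAt, par_crd_one, h1] using hc
    filter_upwards [this.eventually (eventually_par_crd (n := n))] with u hu
    rw [hu]
  have h2 : HasFDerivAt (fun u => crd n (φ (par n G u))) (dOne n fun z => crd n (φ z))
      (crd n (1 : G)) :=
    hasFDerivAt_dOne (contMDiffAt_crd.comp_of_eq hφ h1)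
  have h3 : HasFDerivAt (fun u => F (par n G u)) (dOne n F)
      (crd n (φ (par n G (crd n (1 : G))))) := by
    rw [par_crd_one, h1]
    exact hasFDerivAt_dOne hF
  exact ((h3.comp (crd n (1 : G)) h2).congr_of_eventuallyEq e1).fderiv

lemma dOne_crd : dOne n (crd n : G → _) = ContinuousLinearMap.id ℝ _ := by
  have : (fun u => crd n (par n G u)) =ᶠ[𝓝 (crd n (1 : G))] id := eventually_crd_par
  exact ((hasFDerivAt_id _).congr_of_eventuallyEq this).fderiv

lemma dOne_const (c : V) : dOne n (fun _ : G => c) = 0 := by simp [dOne]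

lemma AdL_one : AdL n (1 : G) = ContinuousLinearMap.id ℝ _ := by
  simpa [AdL] using dOne_crd (n := n) (G := G)

lemma dOne_conj {F : G → V} (hF : ContMDiffAt (𝓡 n) 𝓘(ℝ, V) ∞ F 1) (g : G) :
    dOne n (fun z => F (g * z * g⁻¹)) = dOne n F ∘L AdL n g :=
  dOne_comp hF (contMDiff_mul_left_right g g⁻¹).contMDiffAt (by simp)

lemma AdL_mul (g h : G) : AdL n (g * h) = AdL n g ∘L AdL n h := by
  have := dOne_conj (n := n) (F := fun z => crd n (g * z * g⁻¹))
    (contMDiffAt_crd.comp_of_eq (contMDiff_mul_left_right g g⁻¹).contMDiffAt (by simp)) h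
  refine Eq.trans ?_ this
  unfold AdL
  congr 1
  ext1 z
  simp [mul_assoc]

lemma AdL_mul_apply (g h : G) (X : EuclideanSpace ℝ (Fin n)) :
    AdL n (g * h) X = AdL n g (AdL n h X) := by rw [AdL_mul]; rfl

lemma AdL_inv_apply_self (g : G) (X : EuclideanSpace ℝ (Fin n)) :
    AdL n g⁻¹ (AdL n g X) = X := by
  rw [← AdL_mul_apply, inv_mul_cancel, AdL_one]; rfl

lemma AdL_apply_inv_self (g : G) (X : EuclideanSpace ℝ (Fin n)) :
    AdL n g (AdL n g⁻¹ X) = X := by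
  rw [← AdL_mul_apply, mul_inv_cancel, AdL_one]; rfl

/-- Write `z * x = x * (x⁻¹ * z * x)`: a right-invariant field at `x` is a left-invariant one
twisted by `Ad x⁻¹`. -/
lemma rgrad_eq_lgrad {Ψ : G → V} (hΨ : ContMDiff (𝓡 n) 𝓘(ℝ, V) ∞ Ψ) (x : G) :
    rgrad n Ψ x = lgrad n Ψ x ∘L AdL n x⁻¹ := by
  have := dOne_conj (F := fun z => Ψ (x * z))
    (hΨ.comp (contMDiff_const.mul contMDiff_id)).contMDiffAt x⁻¹
  refine Eq.trans ?_ this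
  unfold rgrad
  congr 1
  ext1 z
  simp [mul_assoc]

/-- The tangent space at `1` is the model space and the chart at `1` has derivative the identity
there, so the intrinsic and the chart versions of `Ad` agree. -/
lemma Ad_apply (g : G) (X : EuclideanSpace ℝ (Fin n)) :
    Ad n g X = AdL n g X := by
  have hφ := (contMDiff_mul_left_right (n := n) g g⁻¹).contMDiffAt (x := (1 : G))
  have e : AdL n g X = mfderiv (𝓡 n) 𝓘(ℝ, EuclideanSpace ℝ (Fin n))
      (fun y => crd n (g * y * g⁻¹)) (1 : G) X :=
    (mfderiv_one_eq_dOne (contMDiffAt_crd.comp_of_eq hφ (by simp)) X).symm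
  rw [e]
  have h1 : MDifferentiableAt (𝓡 n) 𝓘(ℝ, EuclideanSpace ℝ (Fin n)) (crd n)
      (g * (1 : G) * g⁻¹) := by
    simpa using contMDiffAt_crd.mdifferentiableAt (by simp)
  have := mfderiv_comp_apply (1 : G) h1 (hφ.mdifferentiableAt (by simp)) X
  rw [Function.comp_def] at this
  rw [this]
  have h2 : ∀ (x : G) (_ : x = 1) (Y : EuclideanSpace ℝ (Fin n)),
      mfderiv (𝓡 n) 𝓘(ℝ, EuclideanSpace ℝ (Fin n)) (crd n) x Y = Y := by
    rintro x rfl Y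
    rw [mfderiv_one_eq_dOne contMDiffAt_crd, dOne_crd]
    rfl
  exact (h2 _ (by simp) _).symm

lemma derivAlong_eq_lgrad (X : EuclideanSpace ℝ (Fin n)) {f : G → ℝ}
    (hf : ContMDiff (𝓡 n) 𝓘(ℝ, ℝ) ∞ f) (x : G) : derivAlong X f x = lgrad n f x X := by
  have h1 : ContMDiff (𝓡 n) (𝓡 n) ∞ fun z : G => x * z := contMDiff_const.mul contMDiff_id
  refine Eq.trans ?_ (mfderiv_one_eq_dOne (F := fun z => f (x * z)) (hf.comp h1).contMDiffAt X)
  have := mfderiv_comp_apply (1 : G) (g := f) (f := fun z => x * z)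
    (hf.contMDiffAt.mdifferentiableAt (by simp)) (h1.contMDiffAt.mdifferentiableAt (by simp)) X
  refine Eq.trans ?_ this.symm
  unfold derivAlong mulInvariantVectorField
  rw [mul_one]

/-! ### The Maurer–Cartan form in a chart -/

variable (n G) in
/-- The left Maurer–Cartan form in the chart at the identity. -/
def maurerCartan (u : EuclideanSpace ℝ (Fin n)) :
    EuclideanSpace ℝ (Fin n) →L[ℝ] EuclideanSpace ℝ (Fin n) :=
  fderiv ℝ (fun w => crd n ((par n G u)⁻¹ * par n G w)) u

lemma contDiffAt_maurerCartan : ContDiffAt ℝ ∞ (maurerCartan n G) (crd n (1 : G)) := by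
  refine ContDiffAt.fderiv (f := fun u w => crd n ((par n G u)⁻¹ * par n G w)) (g := id)
    (n := ∞) ?_ contDiffAt_id (by simp)
  rw [← contMDiffAt_iff_contDiffAt]
  have h := contMDiffAt_par (n := n) (G := G) one_mem_target
  have h2 : ContMDiffAt 𝓘(ℝ, EuclideanSpace ℝ (Fin n) × EuclideanSpace ℝ (Fin n)) (𝓡 n) ∞
      (fun q : EuclideanSpace ℝ (Fin n) × EuclideanSpace ℝ (Fin n) =>
        (par n G q.1)⁻¹ * par n G q.2) (crd n (1 : G), crd n (1 : G)) := by
    refine ContMDiffAt.mul (ContMDiffAt.inv ?_) ?_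
    · exact ContMDiffAt.comp (crd n (1 : G), crd n (1 : G)) h contDiffAt_fst.contMDiffAt
    · exact ContMDiffAt.comp (crd n (1 : G), crd n (1 : G)) h contDiffAt_snd.contMDiffAt
  exact ContMDiffAt.comp_of_eq contMDiffAt_crd h2 (by simp)

lemma maurerCartan_one : maurerCartan n G (crd n (1 : G)) = ContinuousLinearMap.id ℝ _ := by
  have := dOne_crd (n := n) (G := G)
  simpa [maurerCartan, par_crd_one, dOne] using this

/-- Left translation carries differentiability at the centre of the chart to any point `u` of it.
The Maurer–Cartan form is the Jacobian of this change of centre. -/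
lemma hasFDerivAt_mul_par {φ : G → V} {x : G} {u : EuclideanSpace ℝ (Fin n)}
    {A : EuclideanSpace ℝ (Fin n) →L[ℝ] V} (hu : u ∈ (extChartAt (𝓡 n) (1 : G)).target)
    (h : HasFDerivAt (fun w => φ (x * par n G u * par n G w)) A (crd n (1 : G))) :
    HasFDerivAt (fun w => φ (x * par n G w)) (A ∘L maurerCartan n G u) u := by
  have hs : ContMDiffAt 𝓘(ℝ, EuclideanSpace ℝ (Fin n)) (𝓡 n) ∞
      (fun w => (par n G u)⁻¹ * par n G w) u :=
    contMDiffAt_const.mul (contMDiffAt_par hu)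
  have e1 : (fun w => φ (x * par n G w)) =ᶠ[𝓝 u]
      fun w => φ (x * par n G u * par n G (crd n ((par n G u)⁻¹ * par n G w))) := by
    have : Tendsto (fun w => (par n G u)⁻¹ * par n G w) (𝓝 u) (𝓝 1) := by
      simpa [ContinuousAt] using hs.continuousAt
    filter_upwards [this.eventually (eventually_par_crd (n := n))] with w hw
    rw [hw]
    simp [mul_assoc]
  have h2 : HasFDerivAt (fun w => crd n ((par n G u)⁻¹ * par n G w)) (maurerCartan n G u) u := by
    have : ContMDiffAt 𝓘(ℝ, EuclideanSpace ℝ (Fin n)) 𝓘(ℝ, EuclideanSpace ℝ (Fin n)) ∞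
        (fun w => crd n ((par n G u)⁻¹ * par n G w)) u :=
      ContMDiffAt.comp_of_eq contMDiffAt_crd hs (by simp)
    exact (this.contDiffAt.differentiableAt (by simp)).hasFDerivAt
  have h3 : HasFDerivAt (fun w => φ (x * par n G u * par n G w)) A
      (crd n ((par n G u)⁻¹ * par n G u)) := by
    rwa [inv_mul_cancel]
  exact (HasFDerivAt.comp (g := fun w => φ (x * par n G u * par n G w)) u h3
    h2).congr_of_eventuallyEq e1

/-- A bootstrap: regularity of the derivative along left-invariant fields raises the regularity of
`φ` by one. It serves to prove smoothness of maps into the Banach space `C(G, V)`. -/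
lemma contMDiff_succ_of_hasFDerivAt {φ : G → V} {Φ : G → EuclideanSpace ℝ (Fin n) →L[ℝ] V} {k : ℕ}
    (hφ : ∀ x, HasFDerivAt (fun u => φ (x * par n G u)) (Φ x) (crd n (1 : G)))
    (hΦ : ContMDiff (𝓡 n) 𝓘(ℝ, EuclideanSpace ℝ (Fin n) →L[ℝ] V) k Φ) :
    ContMDiff (𝓡 n) 𝓘(ℝ, V) (k + 1 : ℕ) φ := fun x => by
  have h1 : ContDiffAt ℝ (k + 1 : ℕ) (fun u => φ (x * par n G u)) (crd n (1 : G)) := by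
    have := contDiffAt_succ_iff_hasFDerivAt (𝕜 := ℝ) (n := k)
      (f := fun u => φ (x * par n G u)) (x := crd n (1 : G))
    rw [Nat.cast_add, Nat.cast_one]
    rw [this]
    refine ⟨fun u => Φ (x * par n G u) ∘L maurerCartan n G u, ⟨_, target_mem_nhds,
      fun u hu => hasFDerivAt_mul_par hu (hφ _)⟩, ?_⟩
    refine ContDiffAt.clm_comp ?_ (contDiffAt_maurerCartan.of_le (by exact_mod_cast le_top))
    have h2 : ContMDiff (𝓡 n) (𝓡 n) k fun z : G => x * z := contMDiff_const.mul contMDiff_id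
    exact contDiffAt_comp_par (F := fun z => Φ (x * z)) (k := k) one_mem_target
      (hΦ.comp h2).contMDiffAt
  have h4 : ContMDiffAt (𝓡 n) (𝓡 n) (k + 1 : ℕ) (fun z : G => x⁻¹ * z) x :=
    contMDiffAt_const.mul contMDiffAt_id
  have h3 : ContMDiffAt (𝓡 n) 𝓘(ℝ, EuclideanSpace ℝ (Fin n)) (k + 1 : ℕ)
      (fun z => crd n (x⁻¹ * z)) x :=
    ContMDiffAt.comp_of_eq (contMDiffAt_crd.of_le (by exact_mod_cast le_top)) h4 (by simp)
  have h5 := ContMDiffAt.comp_of_eq (x := x) h1.contMDiffAt h3 (by simp)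
  refine h5.congr_of_eventuallyEq ?_
  have : Tendsto (fun z => x⁻¹ * z) (𝓝 x) (𝓝 1) := by
    simpa [ContinuousAt] using h4.continuousAt
  filter_upwards [this.eventually (eventually_par_crd (n := n))] with z hz
  simp [hz]

end Translations

open VectorField

/-! ### The Lie bracket as the derivative of the adjoint representation -/

section Bracket

variable {n : ℕ} {G : Type*} [TopologicalSpace G] [ChartedSpace (EuclideanSpace ℝ (Fin n)) G]
  [Group G]

variable (n G) in
/-- The multiplication in the chart at the identity. -/
def chartMul (q : EuclideanSpace ℝ (Fin n) × EuclideanSpace ℝ (Fin n)) :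
    EuclideanSpace ℝ (Fin n) := crd n (par n G q.1 * par n G q.2)

variable (n G) in
/-- The left-invariant vector fields in the chart at the identity. -/
def leftFrame (u : EuclideanSpace ℝ (Fin n)) :
    EuclideanSpace ℝ (Fin n) →L[ℝ] EuclideanSpace ℝ (Fin n) :=
  dOne n fun z : G => crd n (par n G u * z)

variable (n G) in
/-- The right-invariant vector fields in the chart at the identity. -/
def rightFrame (u : EuclideanSpace ℝ (Fin n)) :
    EuclideanSpace ℝ (Fin n) →L[ℝ] EuclideanSpace ℝ (Fin n) :=
  dOne n fun z : G => crd n (z * par n G u)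

variable [LieGroup (𝓡 n) ∞ G]

lemma contDiffAt_chartMul :
    ContDiffAt ℝ ∞ (chartMul n G) (crd n (1 : G), crd n (1 : G)) := by
  rw [← contMDiffAt_iff_contDiffAt]
  have h := contMDiffAt_par (n := n) (G := G) one_mem_target
  have h2 : ContMDiffAt 𝓘(ℝ, EuclideanSpace ℝ (Fin n) × EuclideanSpace ℝ (Fin n)) (𝓡 n) ∞
      (fun q : EuclideanSpace ℝ (Fin n) × EuclideanSpace ℝ (Fin n) =>
        par n G q.1 * par n G q.2) (crd n (1 : G), crd n (1 : G)) := by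
    refine ContMDiffAt.mul ?_ ?_
    · exact ContMDiffAt.comp (crd n (1 : G), crd n (1 : G)) h contDiffAt_fst.contMDiffAt
    · exact ContMDiffAt.comp (crd n (1 : G), crd n (1 : G)) h contDiffAt_snd.contMDiffAt
  exact ContMDiffAt.comp_of_eq contMDiffAt_crd h2 (by simp [par_crd_one])

lemma contDiffAt_leftFrame : ContDiffAt ℝ ∞ (leftFrame n G) (crd n (1 : G)) :=
  ContDiffAt.fderiv (f := fun u w => chartMul n G (u, w)) (g := fun _ => crd n (1 : G))
    (n := ∞) contDiffAt_chartMul contDiffAt_const (by simp)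

lemma contDiffAt_rightFrame : ContDiffAt ℝ ∞ (rightFrame n G) (crd n (1 : G)) := by
  refine ContDiffAt.fderiv (f := fun u w => chartMul n G (w, u)) (g := fun _ => crd n (1 : G))
    (n := ∞) ?_ contDiffAt_const (by simp)
  exact ContDiffAt.comp (crd n (1 : G), crd n (1 : G)) (g := chartMul n G) (f := Prod.swap)
    contDiffAt_chartMul (contDiffAt_snd.prodMk contDiffAt_fst)

lemma leftFrame_one : leftFrame n G (crd n (1 : G)) = ContinuousLinearMap.id ℝ _ := by
  simpa [leftFrame, par_crd_one] using dOne_crd (n := n) (G := G)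

lemma rightFrame_one : rightFrame n G (crd n (1 : G)) = ContinuousLinearMap.id ℝ _ := by
  simpa [rightFrame, par_crd_one] using dOne_crd (n := n) (G := G)

/-- Both sides are the mixed second derivative of the multiplication at `(1, 1)`, so this is the
symmetry of second derivatives. -/
lemma fderiv_leftFrame_apply (v w : EuclideanSpace ℝ (Fin n)) :
    fderiv ℝ (leftFrame n G) (crd n (1 : G)) v w =
      fderiv ℝ (rightFrame n G) (crd n (1 : G)) w v := by
  set e := crd n (1 : G)
  have hm : ContDiffAt ℝ ∞ (chartMul n G) (e, e) := contDiffAt_chartMul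
  have hd : HasFDerivAt (fderiv ℝ (chartMul n G)) (fderiv ℝ (fderiv ℝ (chartMul n G)) (e, e))
      (e, e) :=
    ((hm.fderiv_right (m := 1) (by
      rw [one_add_one_eq_two]
      exact ENat.LEInfty.out)).differentiableAt (by simp)).hasFDerivAt
  have hev : ∀ᶠ q in 𝓝 (e, e), DifferentiableAt ℝ (chartMul n G) q := by
    have := (hm.of_le (m := 1) (by exact_mod_cast le_top)).eventually (by simp)
    filter_upwards [this] with q hq using hq.differentiableAt (by simp)
  have hi1 : HasFDerivAt (fun u : EuclideanSpace ℝ (Fin n) => (u, e))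
      (ContinuousLinearMap.inl ℝ _ _) e := hasFDerivAt_prodMk_left e e
  have hi2 : HasFDerivAt (fun u : EuclideanSpace ℝ (Fin n) => (e, u))
      (ContinuousLinearMap.inr ℝ _ _) e := hasFDerivAt_prodMk_right e e
  have h1 : leftFrame n G =ᶠ[𝓝 e]
      fun u => fderiv ℝ (chartMul n G) (u, e) ∘L ContinuousLinearMap.inr ℝ _ _ := by
    have : Tendsto (fun u : EuclideanSpace ℝ (Fin n) => (u, e)) (𝓝 e) (𝓝 (e, e)) :=
      hi1.continuousAt
    filter_upwards [this.eventually hev] with u hu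
    exact (HasFDerivAt.comp (g := chartMul n G) e hu.hasFDerivAt
      (hasFDerivAt_prodMk_right u e)).fderiv
  have h2 : rightFrame n G =ᶠ[𝓝 e]
      fun u => fderiv ℝ (chartMul n G) (e, u) ∘L ContinuousLinearMap.inl ℝ _ _ := by
    have : Tendsto (fun u : EuclideanSpace ℝ (Fin n) => (e, u)) (𝓝 e) (𝓝 (e, e)) :=
      hi2.continuousAt
    filter_upwards [this.eventually hev] with u hu
    exact (HasFDerivAt.comp (g := chartMul n G) (f := fun w => (w, u)) e hu.hasFDerivAt
      (hasFDerivAt_prodMk_left e u)).fderiv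
  have h3 : HasFDerivAt (fun u => fderiv ℝ (chartMul n G) (u, e)) _ e :=
    HasFDerivAt.comp (g := fderiv ℝ (chartMul n G)) e hd hi1
  have h4 : HasFDerivAt (fun u => fderiv ℝ (chartMul n G) (e, u)) _ e :=
    HasFDerivAt.comp (g := fderiv ℝ (chartMul n G)) e hd hi2
  rw [h1.fderiv_eq, h2.fderiv_eq,
    (h3.clm_comp (hasFDerivAt_const (ContinuousLinearMap.inr ℝ _ _) e)).fderiv,
    (h4.clm_comp (hasFDerivAt_const (ContinuousLinearMap.inl ℝ _ _) e)).fderiv]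
  have hs : IsSymmSndFDerivAt ℝ (chartMul n G) (e, e) :=
    hm.isSymmSndFDerivAt (by simpa using (ENat.LEInfty.out : (2 : WithTop ℕ∞) ≤ ∞))
  simpa using hs.eq (v, 0) (0, w)

/-- The derivatives of the chart and of its inverse are mutually inverse, so this pullback applies
the derivative of the chart to the field; the chain rule does the rest. -/
lemma mpullbackWithin_mulInvariantVectorField (w : EuclideanSpace ℝ (Fin n))
    {u : EuclideanSpace ℝ (Fin n)} (hu : u ∈ (extChartAt (𝓡 n) (1 : G)).target) :
    mpullbackWithin 𝓘(ℝ, EuclideanSpace ℝ (Fin n)) (𝓡 n) (extChartAt (𝓡 n) (1 : G)).symm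
      (mulInvariantVectorField (I := 𝓡 n) (G := G) w) (Set.range (𝓡 n)) u = leftFrame n G u w := by
  have hinv := ContinuousLinearMap.inverse_eq
    (mfderivWithin_extChartAt_symm_comp_mfderiv_extChartAt hu)
    (mfderiv_extChartAt_comp_mfderivWithin_extChartAt_symm hu)
  rw [mpullbackWithin_apply, hinv]
  have h1 : ContMDiff (𝓡 n) (𝓡 n) ∞ fun z : G => par n G u * z :=
    contMDiff_const.mul contMDiff_id
  have hsrc : par n G u ∈ (chartAt (EuclideanSpace ℝ (Fin n)) (1 : G)).source := by
    rw [← extChartAt_source (𝓡 n)]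
    exact (extChartAt (𝓡 n) (1 : G)).map_target hu
  have h2 : ContMDiffAt (𝓡 n) 𝓘(ℝ, EuclideanSpace ℝ (Fin n)) ∞ (crd n) (par n G u * 1) := by
    rw [mul_one]
    exact contMDiffAt_extChartAt' hsrc
  have h3 : ContMDiffAt (𝓡 n) 𝓘(ℝ, EuclideanSpace ℝ (Fin n)) ∞
      (fun z => crd n (par n G u * z)) (1 : G) :=
    ContMDiffAt.comp (1 : G) h2 h1.contMDiffAt
  refine Eq.trans ?_ (mfderiv_one_eq_dOne h3 w)
  have := mfderiv_comp_apply (1 : G) (h2.mdifferentiableAt (by simp))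
    (h1.contMDiffAt.mdifferentiableAt (by simp)) w
  refine Eq.trans ?_ this.symm
  unfold mulInvariantVectorField
  change mfderiv (𝓡 n) 𝓘(ℝ, EuclideanSpace ℝ (Fin n)) (crd n) (par n G u)
    (mfderiv (𝓡 n) (𝓡 n) (fun z => par n G u * z) (1 : G) w) = _
  rw [mul_one]

lemma lie_eq_fderiv_frame (v w : GroupLieAlgebra (𝓡 n) G) :
    ⁅v, w⁆ = fderiv ℝ (leftFrame n G) (crd n (1 : G)) v w -
      fderiv ℝ (leftFrame n G) (crd n (1 : G)) w v := by
  have hev : ∀ w : EuclideanSpace ℝ (Fin n),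
      mpullbackWithin 𝓘(ℝ, EuclideanSpace ℝ (Fin n)) (𝓡 n) (extChartAt (𝓡 n) (1 : G)).symm
      (mulInvariantVectorField (I := 𝓡 n) (G := G) w) (Set.range (𝓡 n))
        =ᶠ[𝓝 (crd n (1 : G))] fun u => leftFrame n G u w := by
    intro w
    filter_upwards [target_mem_nhds] with u hu
    exact mpullbackWithin_mulInvariantVectorField w hu
  have hd : HasFDerivAt (leftFrame n G) (fderiv ℝ (leftFrame n G) (crd n (1 : G)))
      (crd n (1 : G)) := (contDiffAt_leftFrame.differentiableAt (by simp)).hasFDerivAt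
  have hfd : ∀ w x : EuclideanSpace ℝ (Fin n), fderiv ℝ (fun u => leftFrame n G u w)
      (crd n (1 : G)) x = fderiv ℝ (leftFrame n G) (crd n (1 : G)) x w := by
    intro w x
    rw [(hd.clm_apply (hasFDerivAt_const w _)).fderiv]
    simp
  rw [GroupLieAlgebra.bracket_def, ← mlieBracketWithin_univ, mlieBracketWithin_apply]
  have h0 : ∀ Y : EuclideanSpace ℝ (Fin n), ContinuousLinearMap.inverse
      (mfderiv (𝓡 n) 𝓘(ℝ, EuclideanSpace ℝ (Fin n)) (extChartAt (𝓡 n) (1 : G)) 1 :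
        EuclideanSpace ℝ (Fin n) →L[ℝ] EuclideanSpace ℝ (Fin n)) Y = Y := fun Y => by
    have := congrArg (fun T : EuclideanSpace ℝ (Fin n) →L[ℝ] EuclideanSpace ℝ (Fin n) =>
      T.inverse Y) (mfderiv_extChartAt_self (I := 𝓡 n) (x := (1 : G)))
    exact this.trans (DFunLike.congr_fun (ContinuousLinearMap.inverse_id
      (R := ℝ) (M := EuclideanSpace ℝ (Fin n))) Y)
  refine (h0 _).trans ?_
  simp only [Set.preimage_univ, Set.univ_inter]
  have hr : Set.range (𝓡 n) = Set.univ := by simp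
  change lieBracketWithin ℝ _ _ (Set.range (𝓡 n)) (crd n (1 : G)) = _
  have hu : ∀ (A B : EuclideanSpace ℝ (Fin n) → EuclideanSpace ℝ (Fin n))
      (s : Set (EuclideanSpace ℝ (Fin n))) (x : EuclideanSpace ℝ (Fin n)), s = Set.univ →
      lieBracketWithin ℝ A B s x = lieBracket ℝ A B x := by
    rintro A B _ x rfl
    rw [lieBracketWithin_univ]
  refine (hu _ _ _ _ hr).trans
    ((Filter.EventuallyEq.lieBracket_vectorField_eq (𝕜 := ℝ) (hev v) (hev w)).trans ?_)
  rw [lieBracket_eq]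
  simp only [leftFrame_one]
  exact congrArg₂ (· - ·) (hfd w v) (hfd v w)

/-- From `u * z = (u * z * u⁻¹) * u` the left frame is the right frame composed with `Ad u`.
Differentiating at `1` and exchanging the frames by `fderiv_leftFrame_apply` isolates the derivative
of `Ad`. -/
lemma dOne_AdL_apply_eq_fderiv_frame (X v : EuclideanSpace ℝ (Fin n)) :
    dOne n (fun g : G => AdL n g X) v = fderiv ℝ (leftFrame n G) (crd n (1 : G)) v X -
      fderiv ℝ (leftFrame n G) (crd n (1 : G)) X v := by
  set e := crd n (1 : G)
  have h1 : ∀ᶠ u in 𝓝 e, leftFrame n G u = rightFrame n G u ∘L AdL n (par n G u) := by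
    filter_upwards [target_mem_nhds] with u hu
    have hsrc : par n G u ∈ (chartAt (EuclideanSpace ℝ (Fin n)) (1 : G)).source := by
      rw [← extChartAt_source (𝓡 n)]
      exact (extChartAt (𝓡 n) (1 : G)).map_target hu
    have h2 : ContMDiffAt (𝓡 n) 𝓘(ℝ, EuclideanSpace ℝ (Fin n)) ∞
        (fun z => crd n (z * par n G u)) (1 : G) :=
      ContMDiffAt.comp_of_eq (contMDiffAt_extChartAt' hsrc)
        (contMDiffAt_id.mul contMDiffAt_const) (by simp)
    have := dOne_conj h2 (par n G u)
    refine Eq.trans ?_ this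
    unfold leftFrame
    congr 1
    ext1 z
    simp
  have hA : HasFDerivAt (fun u => AdL n (par n G u)) (dOne n (AdL n : G → _)) e :=
    hasFDerivAt_dOne contMDiff_AdL.contMDiffAt
  have hR : HasFDerivAt (rightFrame n G) (fderiv ℝ (rightFrame n G) e) e :=
    (contDiffAt_rightFrame.differentiableAt (by simp)).hasFDerivAt
  have h2 : fderiv ℝ (leftFrame n G) e = _ :=
    ((hR.clm_comp hA).congr_of_eventuallyEq h1).fderiv
  have h3 : dOne n (fun g : G => AdL n g X) = _ :=
    (hA.clm_apply (hasFDerivAt_const X e)).fderiv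
  rw [fderiv_leftFrame_apply X v, h2, h3]
  simp only [e, rightFrame_one, par_crd_one, AdL_one, add_apply,
    ContinuousLinearMap.comp_apply, zero_apply, map_zero, zero_add,
    ContinuousLinearMap.flip_apply, ContinuousLinearMap.compL_apply,
    ContinuousLinearMap.id_apply, add_sub_cancel_right]

lemma dOne_AdL_apply (X v : GroupLieAlgebra (𝓡 n) G) :
    dOne n (fun g : G => AdL n g X) v = ⁅v, X⁆ :=
  (dOne_AdL_apply_eq_fderiv_frame X v).trans (lie_eq_fderiv_frame v X).symm

end Bracket

/-! ### Derivatives of `Ad` and its compatibility with the bracket -/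

section Adjoint

variable {n : ℕ} {G : Type*} [TopologicalSpace G] [ChartedSpace (EuclideanSpace ℝ (Fin n)) G]
  [Group G]

variable (n G) in
/-- The adjoint representation of the Lie algebra, as the derivative of `Ad`. -/
def adL : EuclideanSpace ℝ (Fin n) →L[ℝ] EuclideanSpace ℝ (Fin n) →L[ℝ] EuclideanSpace ℝ (Fin n) :=
  dOne n (AdL n : G → _)

variable [LieGroup (𝓡 n) ∞ G]

lemma hasFDerivAt_AdL_par :
    HasFDerivAt (fun u => AdL n (par n G u)) (adL n G) (crd n (1 : G)) :=
  hasFDerivAt_dOne contMDiff_AdL.contMDiffAt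

lemma lie_eq_adL (v w : GroupLieAlgebra (𝓡 n) G) : ⁅v, w⁆ = adL n G v w := by
  have h3 : dOne n (fun g : G => AdL n g w) = _ :=
    (hasFDerivAt_AdL_par.clm_apply
      (hasFDerivAt_const (w : EuclideanSpace ℝ (Fin n)) (crd n (1 : G)))).fderiv
  refine (dOne_AdL_apply w v).symm.trans ?_
  rw [h3]
  have : ∀ v w : EuclideanSpace ℝ (Fin n),
      (AdL n (par n G (crd n (1 : G))) ∘L
        (0 : EuclideanSpace ℝ (Fin n) →L[ℝ] EuclideanSpace ℝ (Fin n))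
        + (adL n G).flip w) v = adL n G v w := by simp
  exact this v w

/-- Differentiate `Ad u ∘ Ad u⁻¹ = id` at `1`. -/
lemma hasFDerivAt_AdL_par_inv :
    HasFDerivAt (fun u => AdL n (par n G u)⁻¹) (-adL n G) (crd n (1 : G)) := by
  have h1 : HasFDerivAt (fun u => AdL n (par n G u)⁻¹) (dOne n fun z : G => AdL n z⁻¹)
      (crd n (1 : G)) :=
    hasFDerivAt_dOne (F := fun z : G => AdL n z⁻¹)
      (contMDiff_AdL.comp (contMDiff_inv (𝓡 n) ∞)).contMDiffAt
  have h2 := (hasFDerivAt_AdL_par (n := n) (G := G)).clm_comp h1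
  have h3 : (fun u => AdL n (par n G u) ∘L AdL n (par n G u)⁻¹) =
      fun _ => ContinuousLinearMap.id ℝ _ := by
    ext u X
    exact congrArg (fun Y : EuclideanSpace ℝ (Fin n) => Y _) (AdL_apply_inv_self _ X)
  rw [h3] at h2
  have h4 := h2.unique (hasFDerivAt_const _ _)
  have h5 : (dOne n fun z : G => AdL n z⁻¹) = -adL n G := by
    ext1 v
    have h6 := DFunLike.congr_fun h4 v
    simp only [par_crd_one, AdL_one, inv_one, add_apply,
      ContinuousLinearMap.comp_apply, ContinuousLinearMap.compL_apply,
      ContinuousLinearMap.flip_apply, ContinuousLinearMap.comp_id, ContinuousLinearMap.id_comp,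
      zero_apply] at h6
    rw [eq_neg_of_add_eq_zero_left h6]
    rfl
  rwa [h5] at h1

lemma hasFDerivAt_AdL_par_mul (x : G) (X : EuclideanSpace ℝ (Fin n)) :
    HasFDerivAt (fun u => AdL n (par n G u * x) X) ((adL n G).flip (AdL n x X))
      (crd n (1 : G)) := by
  have := (hasFDerivAt_AdL_par (n := n) (G := G)).clm_apply
    (hasFDerivAt_const (AdL n x X) (crd n (1 : G)))
  simp only [ContinuousLinearMap.comp_zero, zero_add] at this
  simpa only [AdL_mul_apply] using this

lemma hasFDerivAt_AdL_mul_par_inv (x : G) (X : EuclideanSpace ℝ (Fin n)) :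
    HasFDerivAt (fun u => AdL n (x * par n G u)⁻¹ X) (-(adL n G).flip (AdL n x⁻¹ X))
      (crd n (1 : G)) := by
  have := (hasFDerivAt_AdL_par_inv (n := n) (G := G)).clm_apply
    (hasFDerivAt_const (AdL n x⁻¹ X) (crd n (1 : G)))
  simp only [ContinuousLinearMap.comp_zero, zero_add] at this
  simp only [mul_inv_rev, AdL_mul_apply]
  exact this

/-- Differentiate `Ad (g z g⁻¹) (Ad g Y) = Ad g (Ad z Y)` in `z` at `1`. -/
lemma AdL_adL (g : G) (X Y : EuclideanSpace ℝ (Fin n)) :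
    AdL n g (adL n G X Y) = adL n G (AdL n g X) (AdL n g Y) := by
  have h1 : dOne n (fun z : G => AdL n (g * z * g⁻¹) (AdL n g Y)) = _ :=
    dOne_conj (n := n) (F := fun z : G => AdL n z (AdL n g Y))
      (contMDiff_AdL.clm_apply contMDiff_const).contMDiffAt g
  have h2 : HasFDerivAt (fun u => AdL n (par n G u) (AdL n g Y)) ((adL n G).flip (AdL n g Y))
      (crd n (1 : G)) := by
    simpa [AdL_one] using hasFDerivAt_AdL_par_mul (1 : G) (AdL n g Y)
  have h2' : dOne n (fun z : G => AdL n z (AdL n g Y)) = (adL n G).flip (AdL n g Y) := h2.fderiv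
  have h3 : HasFDerivAt (fun u => AdL n g (AdL n (par n G u) Y))
      (AdL n g ∘L (adL n G).flip Y) (crd n (1 : G)) := by
    have := hasFDerivAt_AdL_par_mul (1 : G) Y
    simp only [mul_one, AdL_one, ContinuousLinearMap.id_apply] at this
    exact (AdL n g).hasFDerivAt.comp _ this
  have h3' : dOne n (fun z : G => AdL n (g * z * g⁻¹) (AdL n g Y)) =
      AdL n g ∘L (adL n G).flip Y := by
    refine Eq.trans ?_ h3.fderiv
    unfold dOne
    congr 1
    ext1 u
    beta_reduce
    rw [← AdL_mul_apply, mul_assoc, inv_mul_cancel, mul_one, AdL_mul_apply]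
  rw [h2', h3'] at h1
  exact DFunLike.congr_fun h1 X

end Adjoint

/-! ### Right translation as a smooth map into `C(G, V)` -/

section RightTranslation

variable {n : ℕ} {G : Type*} [TopologicalSpace G] [ChartedSpace (EuclideanSpace ℝ (Fin n)) G]
  [Group G] [LieGroup (𝓡 n) ∞ G] [IsTopologicalGroup G] [CompactSpace G]
  {V : Type*} [NormedAddCommGroup V] [NormedSpace ℝ V]

/-- The right translate `y ↦ Ψ (y * x)` of a continuous function. -/
def rt (Ψ : C(G, V)) (x : G) : C(G, V) := Ψ.comp ⟨fun y => y * x, by fun_prop⟩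

@[simp] lemma rt_apply (Ψ : C(G, V)) (x y : G) : rt Ψ x y = Ψ (y * x) := rfl

variable (n G V) in
/-- Evaluation of a continuous function with values in linear maps. -/
def evalCLM : C(G, EuclideanSpace ℝ (Fin n) →L[ℝ] V) →L[ℝ]
    EuclideanSpace ℝ (Fin n) →L[ℝ] C(G, V) :=
  LinearMap.mkContinuous₂
    (LinearMap.mk₂ ℝ
      (fun (Φ : C(G, EuclideanSpace ℝ (Fin n) →L[ℝ] V)) (v : EuclideanSpace ℝ (Fin n)) =>
        (⟨fun y => Φ y v, by fun_prop⟩ : C(G, V)))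
      (fun _ _ _ => by ext; simp) (fun _ _ _ => by ext; simp) (fun _ _ _ => by ext; simp)
      (fun _ _ _ => by ext; simp)) 1 (by
    intro Φ v
    rw [one_mul, ContinuousMap.norm_le _ (by positivity)]
    intro y
    exact ((Φ y).le_opNorm v).trans (by gcongr; exact Φ.norm_coe_le_norm y))

@[simp] lemma evalCLM_apply (Φ : C(G, EuclideanSpace ℝ (Fin n) →L[ℝ] V))
    (v : EuclideanSpace ℝ (Fin n)) (y : G) : evalCLM n G V Φ v y = Φ y v := rfl

variable (n) in
/-- The derivative along left-invariant vector fields as a continuous function. -/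
def lgradC (Ψ : C(G, V)) (hΨ : ContMDiff (𝓡 n) 𝓘(ℝ, V) ∞ Ψ) :
    C(G, EuclideanSpace ℝ (Fin n) →L[ℝ] V) := ⟨lgrad n Ψ, (contMDiff_lgrad hΨ).continuous⟩

/-- Pointwise in `y` this is the definition of `lgrad`. Compactness of `G` makes the derivative
estimate uniform in `y`, and the mean value inequality turns it into a sup norm estimate. -/
lemma hasFDerivAt_rt_one (Ψ : C(G, V)) (hΨ : ContMDiff (𝓡 n) 𝓘(ℝ, V) ∞ Ψ) :
    HasFDerivAt (fun u => rt Ψ (par n G u)) (evalCLM n G V (lgradC n Ψ hΨ)) (crd n (1 : G)) := by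
  set e := crd n (1 : G) with he
  refine HasFDerivAt.of_isLittleO (Asymptotics.isLittleO_iff.2 fun ε hε => ?_)
  have hcont : ∀ y ∈ (Set.univ : Set G), ∀ᶠ q : EuclideanSpace ℝ (Fin n) × G in 𝓝 (e, y),
      ‖lgrad n Ψ (q.2 * par n G q.1) ∘L maurerCartan n G q.1 - lgrad n Ψ q.2‖ < ε := by
    intro y _
    have hl : Continuous (lgrad n Ψ) := (contMDiff_lgrad hΨ).continuous
    have hp : ContinuousAt (fun q : EuclideanSpace ℝ (Fin n) × G => par n G q.1) (e, y) :=
      ContinuousAt.comp (g := par n G) (f := Prod.fst) continuousAt_par continuousAt_fst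
    have hθ : ContinuousAt (fun q : EuclideanSpace ℝ (Fin n) × G => maurerCartan n G q.1) (e, y) :=
      ContinuousAt.comp (g := maurerCartan n G) (f := Prod.fst)
        contDiffAt_maurerCartan.continuousAt continuousAt_fst
    have h1 : ContinuousAt (fun q : EuclideanSpace ℝ (Fin n) × G =>
        lgrad n Ψ (q.2 * par n G q.1)) (e, y) :=
      hl.continuousAt.comp (continuousAt_snd.mul hp)
    have h2 : ContinuousAt (fun q : EuclideanSpace ℝ (Fin n) × G =>
        ‖lgrad n Ψ (q.2 * par n G q.1) ∘L maurerCartan n G q.1 - lgrad n Ψ q.2‖) (e, y) :=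
      ((h1.clm_comp hθ).sub (hl.continuousAt.comp continuousAt_snd)).norm
    refine h2.eventually_lt continuousAt_const ?_
    simpa [he, par_crd_one, maurerCartan_one] using hε
  have h3 := isCompact_univ.eventually_forall_of_forall_eventually (P := fun u y =>
    ‖lgrad n Ψ (y * par n G u) ∘L maurerCartan n G u - lgrad n Ψ y‖ < ε) hcont
  obtain ⟨δ, hδ, hball⟩ := Metric.eventually_nhds_iff_ball.1
    (h3.and (target_mem_nhds (n := n) (G := G)))
  filter_upwards [Metric.ball_mem_nhds e hδ] with u hu
  rw [ContinuousMap.norm_le _ (by positivity)]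
  intro y
  have := (convex_ball e δ).norm_image_sub_le_of_norm_hasFDerivWithin_le' (𝕜 := ℝ)
    (f := fun u => Ψ (y * par n G u))
    (f' := fun u => lgrad n Ψ (y * par n G u) ∘L maurerCartan n G u) (φ := lgrad n Ψ y) (C := ε)
    (fun w hw => (hasFDerivAt_mul_par (hball w hw).2
      (hasFDerivAt_lgrad hΨ (y * par n G w))).hasFDerivWithinAt)
    (fun w hw => ((hball w hw).1 y (Set.mem_univ y)).le) (Metric.mem_ball_self hδ) hu
  simpa [lgradC] using this

lemma rt_mul (Ψ : C(G, V)) (x z : G) : rt Ψ (x * z) = rt (rt Ψ z) x := by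
  ext y
  simp [mul_assoc]

/-- Right translation by `x` on continuous functions. -/
def rtCLM (V : Type*) [NormedAddCommGroup V] [NormedSpace ℝ V] (x : G) : C(G, V) →L[ℝ] C(G, V) where
  toFun Ψ := rt Ψ x
  map_add' _ _ := rfl
  map_smul' _ _ := rfl
  cont := ContinuousMap.continuous_precomp _

lemma hasFDerivAt_rt (Ψ : C(G, V)) (hΨ : ContMDiff (𝓡 n) 𝓘(ℝ, V) ∞ Ψ) (x : G) :
    HasFDerivAt (fun u => rt Ψ (x * par n G u)) (evalCLM n G V (rt (lgradC n Ψ hΨ) x))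
      (crd n (1 : G)) := by
  have h1 := (rtCLM V x).hasFDerivAt.comp (crd n (1 : G)) (hasFDerivAt_rt_one Ψ hΨ)
  have h2 : rtCLM V x ∘L evalCLM n G V (lgradC n Ψ hΨ) = evalCLM n G V (rt (lgradC n Ψ hΨ) x) := by
    ext v y
    rfl
  rw [h2] at h1
  refine h1.congr_of_eventuallyEq (Eventually.of_forall fun u => ?_)
  exact rt_mul Ψ x _

/-- The derivative of `x ↦ rt Ψ x` is again a right translate, of a function with values in a larger
space. The induction must therefore run over all `V` at once. -/
lemma contMDiff_rt_nat (k : ℕ) : ∀ {V : Type u} [NormedAddCommGroup V] [NormedSpace ℝ V]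
    (Ψ : C(G, V)), ContMDiff (𝓡 n) 𝓘(ℝ, V) ∞ Ψ → ContMDiff (𝓡 n) 𝓘(ℝ, C(G, V)) k (rt Ψ) := by
  induction k with
  | zero =>
    intro V _ _ Ψ hΨ
    rw [Nat.cast_zero, contMDiff_zero_iff]
    have hc : Continuous fun q : G × G => Ψ (q.2 * q.1) := by fun_prop
    exact (ContinuousMap.curry ⟨_, hc⟩).continuous
  | succ k ih =>
    intro V _ _ Ψ hΨ
    exact contMDiff_succ_of_hasFDerivAt (hasFDerivAt_rt Ψ hΨ)
      ((evalCLM n G V).contMDiff.comp (ih (lgradC n Ψ hΨ) (contMDiff_lgrad hΨ)))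

lemma contMDiff_rt (Ψ : C(G, V)) (hΨ : ContMDiff (𝓡 n) 𝓘(ℝ, V) ∞ Ψ) :
    ContMDiff (𝓡 n) 𝓘(ℝ, C(G, V)) ∞ (rt Ψ) :=
  contMDiff_infty.2 fun k => contMDiff_rt_nat k Ψ hΨ

lemma lgrad_clm_rt {W : Type*} [NormedAddCommGroup W] [NormedSpace ℝ W] (T : C(G, V) →L[ℝ] W)
    (Ψ : C(G, V)) (hΨ : ContMDiff (𝓡 n) 𝓘(ℝ, V) ∞ Ψ) (x : G) (v : EuclideanSpace ℝ (Fin n)) :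
    lgrad n (fun x => T (rt Ψ x)) x v = T (evalCLM n G V (rt (lgradC n Ψ hΨ) x) v) := by
  have := (T.hasFDerivAt.comp (crd n (1 : G)) (hasFDerivAt_rt Ψ hΨ x)).fderiv
  exact DFunLike.congr_fun this v

end RightTranslation

/-! ### The invariant mean on a compact group -/

section Mean

open MeasureTheory

variable (H : Type*) [TopologicalSpace H] [Group H] [IsTopologicalGroup H] [CompactSpace H]

/-- The right-invariant mean on continuous functions on a compact group. -/
def haarMean : C(H, ℝ) →L[ℝ] ℝ :=
  letI : MeasurableSpace H := borel H
  haveI : BorelSpace H := ⟨rfl⟩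
  LinearMap.mkContinuous
    -- The inversion turns left-invariance of Haar measure into right-invariance of the mean.
    { toFun := fun f => ∫ y, f y⁻¹ ∂(Measure.haarMeasure (⊤ : TopologicalSpace.PositiveCompacts H))
      map_add' := fun f g => by
        refine integral_add (f := fun y => f y⁻¹) (g := fun y => g y⁻¹) ?_ ?_ <;>
          exact Continuous.integrable_of_hasCompactSupport (by fun_prop)
            (HasCompactSupport.of_compactSpace _)
      map_smul' := fun c f => integral_smul c fun y => f y⁻¹ } 1 (by
    intro f
    have h1 : (Measure.haarMeasure (⊤ : TopologicalSpace.PositiveCompacts H)) Set.univ = 1 :=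
      Measure.haarMeasure_self
    have := norm_integral_le_of_norm_le_const (μ := Measure.haarMeasure
      (⊤ : TopologicalSpace.PositiveCompacts H)) (f := fun y => f y⁻¹) (C := ‖f‖)
      (Eventually.of_forall fun y => f.norm_coe_le_norm y⁻¹)
    rw [measureReal_def, h1] at this
    simpa using this)

variable {H}

lemma haarMean_const (c : ℝ) : haarMean H (ContinuousMap.const H c) = c := by
  let : MeasurableSpace H := borel H
  have : BorelSpace H := ⟨rfl⟩
  have h1 : (Measure.haarMeasure (⊤ : TopologicalSpace.PositiveCompacts H)) Set.univ = 1 :=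
    Measure.haarMeasure_self
  change ∫ _, c ∂(Measure.haarMeasure (⊤ : TopologicalSpace.PositiveCompacts H)) = c
  rw [integral_const, measureReal_def, h1]
  simp

lemma haarMean_nonneg {f : C(H, ℝ)} (hf : ∀ y, 0 ≤ f y) : 0 ≤ haarMean H f := by
  let : MeasurableSpace H := borel H
  exact integral_nonneg fun y => hf _

lemma haarMean_mul_right (f : C(H, ℝ)) (x : H) :
    haarMean H (f.comp ⟨fun y => y * x, by fun_prop⟩) = haarMean H f := by
  let : MeasurableSpace H := borel H
  have : BorelSpace H := ⟨rfl⟩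
  have := integral_mul_left_eq_self (μ := Measure.haarMeasure
    (⊤ : TopologicalSpace.PositiveCompacts H)) (fun y => f y⁻¹) x⁻¹
  refine Eq.trans ?_ this
  simp only [mul_inv_rev, inv_inv]
  rfl

lemma haarMean_le_of_le {f : C(H, ℝ)} {c : ℝ} (hf : ∀ y, c ≤ f y) : c ≤ haarMean H f := by
  have := haarMean_nonneg (f := f - ContinuousMap.const H c) fun y => by simpa using hf y
  rw [map_sub, haarMean_const] at this
  linarith

end Mean

/-- The bound makes `ℓ` factor through a bounded functional on the range of `D`, which Hahn–Banach
extends to `W`. -/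
lemma exists_clm_comp_eq_of_bound {S W : Type*} [AddCommGroup S] [Module ℝ S]
    [SeminormedAddCommGroup W] [NormedSpace ℝ W] (D : S →ₗ[ℝ] W) (ℓ : S →ₗ[ℝ] ℝ) (C : ℝ)
    (hℓ : ∀ s, |ℓ s| ≤ C * ‖D s‖) : ∃ T : W →L[ℝ] ℝ, ∀ s, T (D s) = ℓ s := by
  have hker : LinearMap.ker D ≤ LinearMap.ker ℓ := by
    intro s hs
    have := hℓ s
    rw [LinearMap.mem_ker.1 hs, norm_zero, mul_zero] at this
    exact abs_nonpos_iff.1 this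
  let φ : LinearMap.range D →ₗ[ℝ] ℝ := (LinearMap.ker D).liftQ ℓ hker ∘ₗ D.quotKerEquivRange.symm
  have hφ : ∀ s, φ ⟨D s, LinearMap.mem_range_self _ _⟩ = ℓ s := by
    intro s
    simp only [φ, LinearMap.comp_apply, LinearEquiv.coe_coe]
    rw [LinearMap.quotKerEquivRange_symm_apply_image]
    rfl
  let T₀ : LinearMap.range D →L[ℝ] ℝ := φ.mkContinuous C fun r => by
    obtain ⟨_, s, rfl⟩ := r
    rw [hφ]
    exact hℓ s
  obtain ⟨T, hT, -⟩ := exists_extension_norm_eq (LinearMap.range D) T₀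
  exact ⟨T, fun s => (hT ⟨D s, LinearMap.mem_range_self _ _⟩).trans (hφ s)⟩

/-! ### The functional that recovers `∫ f - f 1` from the gradient of `f` -/

section Transfer

variable {n : ℕ} {G : Type*} [TopologicalSpace G] [ChartedSpace (EuclideanSpace ℝ (Fin n)) G]
  [Group G] [LieGroup (𝓡 n) ∞ G] [IsTopologicalGroup G] [CompactSpace G]

variable (n) in
/-- The derivative along right-invariant vector fields as a continuous function. -/
def rgradC (f : C(G, ℝ)) (hf : ContMDiff (𝓡 n) 𝓘(ℝ, ℝ) ∞ f) :
    C(G, EuclideanSpace ℝ (Fin n) →L[ℝ] ℝ) := ⟨rgrad n f, (contMDiff_rgrad hf).continuous⟩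

lemma contMDiff_rt_fun {V : Type*} [NormedAddCommGroup V] [NormedSpace ℝ V] {f : C(G, V)}
    (hf : ContMDiff (𝓡 n) 𝓘(ℝ, V) ∞ f) (x : G) : ContMDiff (𝓡 n) 𝓘(ℝ, V) ∞ (rt f x) :=
  hf.comp (contMDiff_id.mul contMDiff_const)

lemma rgradC_rt (f : C(G, ℝ)) (hf : ContMDiff (𝓡 n) 𝓘(ℝ, ℝ) ∞ f) (x : G) :
    rgradC n (rt f x) (contMDiff_rt_fun hf x) = rt (rgradC n f hf) x := by
  ext1 y
  change rgrad n (rt f x) y = rgrad n f (y * x)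
  simp only [rgrad, rt_apply, mul_assoc]

lemma norm_rt_le {V : Type*} [NormedAddCommGroup V] [NormedSpace ℝ V] (f : C(G, V)) (x : G) :
    ‖rt f x‖ ≤ ‖f‖ :=
  (ContinuousMap.norm_le _ (norm_nonneg _)).2 fun _ => f.norm_coe_le_norm _

/-- Near `1` the right-invariant frame is close to the coordinate frame, so the gradient along it
controls the coordinate derivative; the mean value inequality on a ball follows. -/
lemma exists_local_bound : ∃ C : ℝ, 0 ≤ C ∧ ∀ᶠ x in 𝓝 (1 : G), ∀ (f : C(G, ℝ))
    (hf : ContMDiff (𝓡 n) 𝓘(ℝ, ℝ) ∞ f), |f x - f 1| ≤ C * ‖rgradC n f hf‖ := by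
  set e := crd n (1 : G) with he
  have hB : ∀ᶠ u in 𝓝 e, ‖rightFrame n G u - ContinuousLinearMap.id ℝ _‖ < 1 / 2 := by
    have : ContinuousAt (fun u => ‖rightFrame n G u - ContinuousLinearMap.id ℝ _‖) e :=
      (contDiffAt_rightFrame.continuousAt.sub continuousAt_const).norm
    refine this.eventually_lt continuousAt_const ?_
    simp [he, rightFrame_one]
  obtain ⟨δ, hδ, hball⟩ := Metric.eventually_nhds_iff_ball.1
    (hB.and (target_mem_nhds (n := n) (G := G)))
  have key : ∀ (f : C(G, ℝ)) (hf : ContMDiff (𝓡 n) 𝓘(ℝ, ℝ) ∞ f), ∀ u ∈ Metric.ball e δ,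
      |f (par n G u) - f 1| ≤ 2 * δ * ‖rgradC n f hf‖ := by
    intro f hf u hu
    have hd : ∀ w ∈ Metric.ball e δ, ∃ A : EuclideanSpace ℝ (Fin n) →L[ℝ] ℝ,
        HasFDerivAt (fun w => f (par n G w)) A w ∧ ‖A‖ ≤ 2 * ‖rgradC n f hf‖ := by
      intro w hw
      obtain ⟨hw1, hw2⟩ := hball w hw
      have h1 : HasFDerivAt (fun w => f (par n G w)) (fderiv ℝ (fun w => f (par n G w)) w) w :=
        ((contDiffAt_comp_par (k := ⊤) hw2 hf.contMDiffAt).differentiableAt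
          (by simp)).hasFDerivAt
      refine ⟨_, h1, ?_⟩
      set A := fderiv ℝ (fun w => f (par n G w)) w
      have hsrc : par n G w ∈ (chartAt (EuclideanSpace ℝ (Fin n)) (1 : G)).source := by
        rw [← extChartAt_source (𝓡 n)]
        exact (extChartAt (𝓡 n) (1 : G)).map_target hw2
      have h2 : ContMDiffAt (𝓡 n) 𝓘(ℝ, EuclideanSpace ℝ (Fin n)) ∞
          (fun z => crd n (z * par n G w)) (1 : G) :=
        ContMDiffAt.comp_of_eq (contMDiffAt_extChartAt' hsrc)
          (contMDiffAt_id.mul contMDiffAt_const) (by simp)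
      have h3 := hasFDerivAt_dOne h2
      have h4 : HasFDerivAt (fun w => f (par n G w)) A
          (crd n (par n G (crd n (1 : G)) * par n G w)) := by
        rw [par_crd_one, one_mul, crd_par hw2]
        exact h1
      have h5 := HasFDerivAt.comp (g := fun w => f (par n G w)) e h4 h3
      have h6 : (fun v => f (par n G v * par n G w)) =ᶠ[𝓝 e]
          (fun w => f (par n G w)) ∘ fun v => crd n (par n G v * par n G w) := by
        have : Tendsto (fun v => par n G v * par n G w) (𝓝 e) (𝓝 (par n G w)) := by
          have : ContinuousAt (fun v => par n G v * par n G w) e :=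
            (continuousAt_par (n := n) (G := G)).mul continuousAt_const
          simpa only [ContinuousAt, he, par_crd_one, one_mul] using this
        filter_upwards [this.eventually ((chartAt (EuclideanSpace ℝ (Fin n))
          (1 : G)).open_source.mem_nhds hsrc)] with v hv
        have : par n G (crd n (par n G v * par n G w)) = par n G v * par n G w :=
          (extChartAt (𝓡 n) (1 : G)).left_inv (by rw [extChartAt_source]; exact hv)
        simp only [Function.comp_apply, this]
      have h7 : rgrad n f (par n G w) = A ∘L rightFrame n G w :=
        (h5.congr_of_eventuallyEq h6).fderiv
      -- The second term has norm at most `‖A‖ / 2` and is absorbed on the left, which is the source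
      -- of the factor `2`.
      have h8 : A = rgrad n f (par n G w) -
          A ∘L (rightFrame n G w - ContinuousLinearMap.id ℝ _) := by
        rw [h7, ContinuousLinearMap.comp_sub, ContinuousLinearMap.comp_id, sub_sub_cancel]
      have h9 : ‖A‖ ≤ ‖rgradC n f hf‖ + ‖A‖ * (1 / 2) := by
        calc ‖A‖ = _ := congrArg norm h8
          _ ≤ ‖rgrad n f (par n G w)‖ +
              ‖A ∘L (rightFrame n G w - ContinuousLinearMap.id ℝ _)‖ := norm_sub_le _ _
          _ ≤ _ := add_le_add ((rgradC n f hf).norm_coe_le_norm _)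
            ((ContinuousLinearMap.opNorm_comp_le _ _).trans (by gcongr))
      linarith
    choose! A hA1 hA2 using hd
    have := (convex_ball e δ).norm_image_sub_le_of_norm_hasFDerivWithin_le (𝕜 := ℝ)
      (fun w hw => (hA1 w hw).hasFDerivWithinAt) hA2 (Metric.mem_ball_self hδ) hu
    simp only [he, par_crd_one, Real.norm_eq_abs] at this
    refine this.trans ?_
    have h3 : ‖u - crd n (1 : G)‖ ≤ δ := by
      rw [← dist_eq_norm]
      exact (Metric.mem_ball.1 hu).le
    nlinarith [norm_nonneg (rgradC n f hf)]
  refine ⟨2 * δ, by positivity, ?_⟩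
  have hc : Tendsto (crd n) (𝓝 (1 : G)) (𝓝 e) := contMDiffAt_crd.continuousAt
  filter_upwards [hc.eventually (Metric.ball_mem_nhds e hδ), eventually_par_crd (n := n)]
    with x hx hx' f hf
  rw [← hx']
  exact key f hf _ hx

/-- Right translation moves the local bound to every point. Connectedness gives a bound at each `x`,
and a finite subcover makes the constant independent of `x`. -/
lemma exists_bound [ConnectedSpace G] : ∃ C : ℝ, 0 ≤ C ∧ ∀ (x : G) (f : C(G, ℝ))
    (hf : ContMDiff (𝓡 n) 𝓘(ℝ, ℝ) ∞ f), |f x - f 1| ≤ C * ‖rgradC n f hf‖ := by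
  obtain ⟨C₀, hC₀, hloc⟩ := exists_local_bound (n := n) (G := G)
  have hloc' : ∀ g : G, ∀ᶠ x in 𝓝 g, ∀ (f : C(G, ℝ))
      (hf : ContMDiff (𝓡 n) 𝓘(ℝ, ℝ) ∞ f), |f x - f g| ≤ C₀ * ‖rgradC n f hf‖ := by
    intro g
    have ht : Tendsto (fun x => x * g⁻¹) (𝓝 g) (𝓝 1) := by
      have : ContinuousAt (fun x => x * g⁻¹) g := by fun_prop
      simpa [ContinuousAt] using this
    filter_upwards [ht.eventually hloc] with x hx f hf
    have := hx (rt f g) (contMDiff_rt_fun hf g)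
    rw [rgradC_rt] at this
    simp only [rt_apply, inv_mul_cancel_right, one_mul] at this
    exact this.trans (by gcongr; exact norm_rt_le _ _)
  -- The points that can be joined to `1` by finitely many local estimates form a clopen set.
  let S : Set G := {x | ∃ C : ℝ, ∀ (f : C(G, ℝ)) (hf : ContMDiff (𝓡 n) 𝓘(ℝ, ℝ) ∞ f),
    |f x - f 1| ≤ C * ‖rgradC n f hf‖}
  have hS : IsClopen S := by
    constructor
    · rw [← isOpen_compl_iff, isOpen_iff_eventually]
      intro g hg
      filter_upwards [hloc' g] with x hx hxS
      obtain ⟨C, hC⟩ := hxS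
      refine hg ⟨C + C₀, fun f hf => ?_⟩
      have h1 := hC f hf
      have h2 := hx f hf
      rw [abs_sub_comm] at h2
      have := abs_sub_le (f g) (f x) (f 1)
      linarith
    · rw [isOpen_iff_eventually]
      rintro g ⟨C, hC⟩
      filter_upwards [hloc' g] with x hx
      refine ⟨C + C₀, fun f hf => ?_⟩
      have h1 := hC f hf
      have h2 := hx f hf
      have := abs_sub_le (f x) (f g) (f 1)
      linarith
  have hSu : S = Set.univ := hS.eq_univ ⟨1, 0, fun f hf => by simp⟩
  have hS' : ∀ g, g ∈ S := fun g => hSu ▸ Set.mem_univ g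
  choose C hC using hS'
  obtain ⟨t, -, ht⟩ := isCompact_univ.elim_nhds_subcover _ (fun g _ => hloc' g)
  refine ⟨C₀ + ∑ g ∈ t, |C g|, by positivity, fun x f hf => ?_⟩
  obtain ⟨g, hg, hx⟩ := Set.mem_iUnion₂.1 (ht (Set.mem_univ x))
  have h1 := hC g f hf
  have h2 := hx f hf
  have h3 := abs_sub_le (f x) (f g) (f 1)
  have h4 : C g ≤ ∑ g ∈ t, |C g| :=
    (le_abs_self _).trans (Finset.single_le_sum (f := fun g => |C g|) (fun _ _ => abs_nonneg _) hg)
  nlinarith [norm_nonneg (rgradC n f hf)]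

variable (n G) in
/-- The smooth functions among the continuous ones. -/
def smoothSubmodule : Submodule ℝ C(G, ℝ) where
  carrier := {f | ContMDiff (𝓡 n) 𝓘(ℝ, ℝ) ∞ f}
  add_mem' hf hg := ContMDiff.add hf hg
  zero_mem' := contMDiff_const
  smul_mem' c _ hf := (contMDiff_const (I := 𝓡 n) (I' := 𝓘(ℝ, ℝ)) (c := c)).smul hf

variable (n G) in
/-- The derivative along right-invariant vector fields as a linear map. -/
def rgradLin : smoothSubmodule n G →ₗ[ℝ] C(G, EuclideanSpace ℝ (Fin n) →L[ℝ] ℝ) where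
  toFun f := rgradC n f.1 f.2
  map_add' f g := by
    ext1 y
    exact ((hasFDerivAt_rgrad f.2 y).add (hasFDerivAt_rgrad g.2 y)).fderiv
  map_smul' c f := by
    ext1 y
    exact ((hasFDerivAt_rgrad f.2 y).const_smul c).fderiv

/-- Averaging the bound of `exists_bound` over `x` gives `|∫ f - f 1| ≤ C ‖∇f‖`, which is what the
Hahn–Banach lemma needs. -/
lemma exists_transfer [ConnectedSpace G] :
    ∃ T : C(G, EuclideanSpace ℝ (Fin n) →L[ℝ] ℝ) →L[ℝ] ℝ, ∀ (f : C(G, ℝ))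
      (hf : ContMDiff (𝓡 n) 𝓘(ℝ, ℝ) ∞ f), haarMean G f - f 1 = T (rgradC n f hf) := by
  obtain ⟨C, hC, hbound⟩ := exists_bound (n := n) (G := G)
  let ℓ : smoothSubmodule n G →ₗ[ℝ] ℝ :=
    { toFun := fun f => haarMean G f.1 - f.1 1
      map_add' := fun f g => by simp; ring
      map_smul' := fun c f => by simp; ring }
  have hℓ : ∀ f, |ℓ f| ≤ C * ‖rgradLin n G f‖ := by
    intro f
    have h1 := fun x => abs_le.1 (hbound x f.1 f.2)
    have h2 : f.1 1 - C * ‖rgradLin n G f‖ ≤ haarMean G f.1 :=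
      haarMean_le_of_le fun y => by
        have := (h1 y).1
        change f.1 1 - C * ‖rgradC n f.1 f.2‖ ≤ _
        linarith
    have h3 : -(f.1 1) - C * ‖rgradLin n G f‖ ≤ haarMean G (-f.1) :=
      haarMean_le_of_le fun y => by
        have := (h1 y).2
        change -(f.1 1) - C * ‖rgradC n f.1 f.2‖ ≤ -(f.1 y)
        linarith
    rw [map_neg] at h3
    refine abs_le.2 ⟨?_, ?_⟩ <;> simp only [ℓ, LinearMap.coe_mk, AddHom.coe_mk] <;> linarith
  obtain ⟨T, hT⟩ := exists_clm_comp_eq_of_bound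
    (W := C(G, EuclideanSpace ℝ (Fin n) →L[ℝ] ℝ)) (rgradLin n G) ℓ C hℓ
  exact ⟨T, fun f hf => (hT ⟨f, hf⟩).symm⟩

variable (n G) in
/-- A continuous functional `T` with `∫ f - f 1 = T (∇ f)` for smooth functions `f`. -/
def transfer [ConnectedSpace G] : C(G, EuclideanSpace ℝ (Fin n) →L[ℝ] ℝ) →L[ℝ] ℝ :=
  (exists_transfer (n := n) (G := G)).choose

lemma transfer_rgradC [ConnectedSpace G] (f : C(G, ℝ)) (hf : ContMDiff (𝓡 n) 𝓘(ℝ, ℝ) ∞ f) :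
    transfer n G (rgradC n f hf) = haarMean G f - f 1 :=
  ((exists_transfer (n := n) (G := G)).choose_spec f hf).symm

end Transfer

/-! ### The exterior derivative in degrees two and three -/

section ExteriorDerivative

variable {n : ℕ} {G : Type*} [TopologicalSpace G] [ChartedSpace (EuclideanSpace ℝ (Fin n)) G]
  [Group G]

lemma vec_two_eta {α : Type*} (v : Fin 2 → α) : v = ![v 0, v 1] := by
  ext i; fin_cases i <;> rfl

lemma vec_three_eta {α : Type*} (v : Fin 3 → α) : v = ![v 0, v 1, v 2] := by
  ext i; fin_cases i <;> rfl

lemma vec_four_eta {α : Type*} (v : Fin 4 → α) : v = ![v 0, v 1, v 2, v 3] := by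
  ext i; fin_cases i <;> rfl

lemma extDer_two_form (β : Form n G 2) (x : G) (X Y Z : GroupLieAlgebra (𝓡 n) G) :
    extDer β x ![X, Y, Z] =
      derivAlong X (fun y => β y ![Y, Z]) x - derivAlong Y (fun y => β y ![X, Z]) x
        + derivAlong Z (fun y => β y ![X, Y]) x
        - β x ![⁅X, Y⁆, Z] + β x ![⁅X, Z⁆, Y] - β x ![⁅Y, Z⁆, X] := by
  have r0 : ∀ (A B C : GroupLieAlgebra (𝓡 n) G), Fin.removeNth 0 ![A, B, C] = ![B, C] := by
    intros; ext i; fin_cases i <;> rfl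
  have r1 : ∀ (A B C : GroupLieAlgebra (𝓡 n) G), Fin.removeNth 1 ![A, B, C] = ![A, C] := by
    intros; ext i; fin_cases i <;> rfl
  have r2 : ∀ (A B C : GroupLieAlgebra (𝓡 n) G), Fin.removeNth 2 ![A, B, C] = ![A, B] := by
    intros; ext i; fin_cases i <;> rfl
  have s0 : ∀ (A B : GroupLieAlgebra (𝓡 n) G), Fin.removeNth 0 ![A, B] = ![B] := by
    intros; ext i; fin_cases i <;> rfl
  have s1 : ∀ (A B : GroupLieAlgebra (𝓡 n) G), Fin.removeNth 1 ![A, B] = ![A] := by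
    intros; ext i; fin_cases i <;> rfl
  have f0 : (Finset.univ.filter fun j : Fin 2 => 0 ≤ j) = {0, 1} := by decide
  have f1 : (Finset.univ.filter fun j : Fin 2 => 1 ≤ j) = {1} := by decide
  unfold extDer
  rw [Fin.sum_univ_three, Fin.sum_univ_two, f0, f1, Finset.sum_pair (by decide),
    Finset.sum_singleton]
  have c0 : (0 : Fin 2).castSucc = (0 : Fin 3) := rfl
  have c1 : (1 : Fin 2).castSucc = (1 : Fin 3) := rfl
  have d0 : (0 : Fin 2).succ = (1 : Fin 3) := rfl
  have d1 : (1 : Fin 2).succ = (2 : Fin 3) := rfl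
  simp only [c0, c1, d0, d1, r0, r1, r2, s0, s1]
  simp
  ring

lemma extDer_three_form (β : Form n G 3) (x : G) (W X Y Z : GroupLieAlgebra (𝓡 n) G) :
    extDer β x ![W, X, Y, Z] =
      derivAlong W (fun y => β y ![X, Y, Z]) x - derivAlong X (fun y => β y ![W, Y, Z]) x
        + derivAlong Y (fun y => β y ![W, X, Z]) x - derivAlong Z (fun y => β y ![W, X, Y]) x
        - β x ![⁅W, X⁆, Y, Z] + β x ![⁅W, Y⁆, X, Z] - β x ![⁅W, Z⁆, X, Y]
        - β x ![⁅X, Y⁆, W, Z] + β x ![⁅X, Z⁆, W, Y] - β x ![⁅Y, Z⁆, W, X] := by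
  have q0 : ∀ (A B C D : GroupLieAlgebra (𝓡 n) G),
      Fin.removeNth 0 ![A, B, C, D] = ![B, C, D] := by
    intros; ext i; fin_cases i <;> rfl
  have q1 : ∀ (A B C D : GroupLieAlgebra (𝓡 n) G),
      Fin.removeNth 1 ![A, B, C, D] = ![A, C, D] := by
    intros; ext i; fin_cases i <;> rfl
  have q2 : ∀ (A B C D : GroupLieAlgebra (𝓡 n) G),
      Fin.removeNth 2 ![A, B, C, D] = ![A, B, D] := by
    intros; ext i; fin_cases i <;> rfl
  have q3 : ∀ (A B C D : GroupLieAlgebra (𝓡 n) G),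
      Fin.removeNth 3 ![A, B, C, D] = ![A, B, C] := by
    intros; ext i; fin_cases i <;> rfl
  have r0 : ∀ (A B C : GroupLieAlgebra (𝓡 n) G), Fin.removeNth 0 ![A, B, C] = ![B, C] := by
    intros; ext i; fin_cases i <;> rfl
  have r1 : ∀ (A B C : GroupLieAlgebra (𝓡 n) G), Fin.removeNth 1 ![A, B, C] = ![A, C] := by
    intros; ext i; fin_cases i <;> rfl
  have r2 : ∀ (A B C : GroupLieAlgebra (𝓡 n) G), Fin.removeNth 2 ![A, B, C] = ![A, B] := by
    intros; ext i; fin_cases i <;> rfl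
  have f0 : (Finset.univ.filter fun j : Fin 3 => 0 ≤ j) = {0, 1, 2} := by decide
  have f1 : (Finset.univ.filter fun j : Fin 3 => 1 ≤ j) = {1, 2} := by decide
  have f2 : (Finset.univ.filter fun j : Fin 3 => 2 ≤ j) = {2} := by decide
  unfold extDer
  rw [Fin.sum_univ_four, Fin.sum_univ_three, f0, f1, f2, Finset.sum_insert (by decide),
    Finset.sum_pair (by decide), Finset.sum_pair (by decide), Finset.sum_singleton]
  have c0 : (0 : Fin 3).castSucc = (0 : Fin 4) := rfl
  have c1 : (1 : Fin 3).castSucc = (1 : Fin 4) := rfl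
  have c2 : (2 : Fin 3).castSucc = (2 : Fin 4) := rfl
  have d0 : (0 : Fin 3).succ = (1 : Fin 4) := rfl
  have d1 : (1 : Fin 3).succ = (2 : Fin 4) := rfl
  have d2 : (2 : Fin 3).succ = (3 : Fin 4) := rfl
  have e3 : ![W, X, Y, Z] 3 = Z := rfl
  simp only [c0, c1, c2, d0, d1, d2, q0, q1, q2, q3, r0, r1, r2, e3]
  simp
  ring

lemma derivAlong_const (X : GroupLieAlgebra (𝓡 n) G) (c : ℝ) (x : G) :
    derivAlong X (fun _ => c) x = 0 := by
  unfold derivAlong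
  rw [mfderiv_const]
  rfl

lemma extDer_leftInvariantForm_two (α : GroupLieAlgebra (𝓡 n) G [⋀^Fin 2]→ₗ[ℝ] ℝ) (x : G)
    (X Y Z : GroupLieAlgebra (𝓡 n) G) :
    extDer (leftInvariantForm α) x ![X, Y, Z] =
      - α ![⁅X, Y⁆, Z] + α ![⁅X, Z⁆, Y] - α ![⁅Y, Z⁆, X] := by
  rw [extDer_two_form]
  simp only [leftInvariantForm, derivAlong_const]
  ring

lemma extDer_leftInvariantForm_three (α : GroupLieAlgebra (𝓡 n) G [⋀^Fin 3]→ₗ[ℝ] ℝ) (x : G)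
    (W X Y Z : GroupLieAlgebra (𝓡 n) G) :
    extDer (leftInvariantForm α) x ![W, X, Y, Z] =
      - α ![⁅W, X⁆, Y, Z] + α ![⁅W, Y⁆, X, Z] - α ![⁅W, Z⁆, X, Y]
        - α ![⁅X, Y⁆, W, Z] + α ![⁅X, Z⁆, W, Y] - α ![⁅Y, Z⁆, W, X] := by
  rw [extDer_three_form]
  simp only [leftInvariantForm, derivAlong_const]
  ring

end ExteriorDerivative

/-! ### Alternating forms as multilinear maps -/

section AlternatingForms

variable {L : Type*} [AddCommGroup L] [Module ℝ L]

/-- Alternating forms of degree one as linear forms. -/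
def altOne : (L [⋀^Fin 1]→ₗ[ℝ] ℝ) →ₗ[ℝ] L →ₗ[ℝ] ℝ where
  toFun f :=
    { toFun := fun x => f ![x]
      map_add' := fun x y => by
        exact congrArg (fun a : L [⋀^Fin 0]→ₗ[ℝ] ℝ => a ![]) (f.curryLeft.map_add x y)
      map_smul' := fun c x => by
        exact congrArg (fun a : L [⋀^Fin 0]→ₗ[ℝ] ℝ => a ![]) (f.curryLeft.map_smul c x) }
  map_add' _ _ := rfl
  map_smul' _ _ := rfl

/-- Alternating forms of degree two as bilinear forms. -/
def altTwo : (L [⋀^Fin 2]→ₗ[ℝ] ℝ) →ₗ[ℝ] L →ₗ[ℝ] L →ₗ[ℝ] ℝ where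
  toFun f := altOne ∘ₗ f.curryLeft
  map_add' _ _ := rfl
  map_smul' _ _ := rfl

/-- Alternating forms of degree three as trilinear forms. -/
def altThree (f : L [⋀^Fin 3]→ₗ[ℝ] ℝ) : L →ₗ[ℝ] L →ₗ[ℝ] L →ₗ[ℝ] ℝ := altTwo ∘ₗ f.curryLeft

lemma altTwo_apply (f : L [⋀^Fin 2]→ₗ[ℝ] ℝ) (x y : L) : altTwo f x y = f ![x, y] := rfl

lemma altThree_apply (f : L [⋀^Fin 3]→ₗ[ℝ] ℝ) (x y z : L) : altThree f x y z = f ![x, y, z] := rfl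

lemma altTwo_self (f : L [⋀^Fin 2]→ₗ[ℝ] ℝ) (x : L) : altTwo f x x = 0 :=
  f.map_eq_zero_of_eq ![x, x] (i := 0) (j := 1) rfl (by decide)

lemma altTwo_swap (f : L [⋀^Fin 2]→ₗ[ℝ] ℝ) (x y : L) : altTwo f x y = - altTwo f y x := by
  have := altTwo_self f (x + y)
  simp only [map_add, LinearMap.add_apply, altTwo_self] at this
  linarith

lemma altThree_swap_left (f : L [⋀^Fin 3]→ₗ[ℝ] ℝ) (x y z : L) :
    altThree f x y z = - altThree f y x z := by
  have h : ∀ x z, altThree f x x z = 0 := fun x z =>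
    f.map_eq_zero_of_eq ![x, x, z] (i := 0) (j := 1) rfl (by decide)
  have := h (x + y) z
  simp only [map_add, LinearMap.add_apply, h] at this
  linarith

lemma altThree_swap_right (f : L [⋀^Fin 3]→ₗ[ℝ] ℝ) (x y z : L) :
    altThree f x y z = - altThree f x z y := by
  have h : ∀ x z, altThree f x z z = 0 := fun x z =>
    f.map_eq_zero_of_eq ![x, z, z] (i := 1) (j := 2) rfl (by decide)
  have := h x (y + z)
  simp only [map_add, LinearMap.add_apply, h] at this
  linarith

/-- The alternating form of degree two given by an alternating bilinear form. -/
def mkAltTwo (b : L →ₗ[ℝ] L →ₗ[ℝ] ℝ) (hb : ∀ x, b x x = 0) : L [⋀^Fin 2]→ₗ[ℝ] ℝ where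
  toFun v := b (v 0) (v 1)
  map_update_add' := by
    intro hdec v i x y
    obtain rfl : hdec = instDecidableEqFin 2 := Subsingleton.elim _ _
    fin_cases i <;> simp
  map_update_smul' := by
    intro hdec v i c x
    obtain rfl : hdec = instDecidableEqFin 2 := Subsingleton.elim _ _
    fin_cases i <;> simp
  map_eq_zero_of_eq' := by
    intro v i j hv hij
    fin_cases i <;> fin_cases j <;> simp at hij hv
    all_goals simp [hv, hb]

end AlternatingForms

/-! ### The form `H_Q` and its pullback to `𝔤` -/

section LieAlgebra

variable {L : Type*} [LieRing L] [LieAlgebra ℝ L] {𝔨 𝔭 : Submodule ℝ L}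

lemma kComp_add_pComp (h : IsCompl 𝔨 𝔭) (x : L) : kComp h x + pComp h x = x := by
  exact Submodule.projection_add_projection_eq_self h x

lemma kComp_mem (h : IsCompl 𝔨 𝔭) (x : L) : kComp h x ∈ 𝔨 := Subtype.coe_prop _

lemma pComp_mem (h : IsCompl 𝔨 𝔭) (x : L) : pComp h x ∈ 𝔭 := Subtype.coe_prop _

lemma kComp_of_mem (h : IsCompl 𝔨 𝔭) {x : L} (hx : x ∈ 𝔨) : kComp h x = x := by
  simpa [kComp] using congrArg Subtype.val (Submodule.projectionOnto_apply_left h ⟨x, hx⟩)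

lemma kComp_of_mem' (h : IsCompl 𝔨 𝔭) {x : L} (hx : x ∈ 𝔭) : kComp h x = 0 := by
  simpa [kComp] using congrArg Subtype.val (Submodule.projectionOnto_apply_right h ⟨x, hx⟩)

lemma pComp_of_mem (h : IsCompl 𝔨 𝔭) {x : L} (hx : x ∈ 𝔭) : pComp h x = x := by
  have := kComp_add_pComp h x
  rwa [kComp_of_mem' h hx, zero_add] at this

lemma pComp_of_mem' (h : IsCompl 𝔨 𝔭) {x : L} (hx : x ∈ 𝔨) : pComp h x = 0 := by
  have := kComp_add_pComp h x
  rw [kComp_of_mem h hx] at this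
  simpa using this

lemma hat_apply (h : IsCompl 𝔨 𝔭) {m : ℕ} (α : 𝔭 [⋀^Fin m]→ₗ[ℝ] ℝ) (v : Fin m → L) :
    hat h α v = α fun i => ⟨pComp h (v i), pComp_mem h _⟩ := rfl

lemma biInv_symm {Q : LinearMap.BilinForm ℝ L} (hQ : Q ∈ biInvariantForms L) (x y : L) :
    Q x y = Q y x := hQ.1.eq x y |>.symm ▸ rfl

lemma biInv_lie {Q : LinearMap.BilinForm ℝ L} (hQ : Q ∈ biInvariantForms L) (x y z : L) :
    Q ⁅x, y⁆ z = Q x ⁅y, z⁆ := by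
  rw [← lie_skew, map_neg, LinearMap.neg_apply, hQ.2, neg_neg]

lemma vanishing_apply {Q : vanishingForms 𝔨} {x y : L} (hx : x ∈ 𝔨) (hy : y ∈ 𝔨) :
    Q.1.1 x y = 0 :=
  LinearMap.congr_fun₂ (LinearMap.mem_ker.1 Q.2) ⟨x, hx⟩ ⟨y, hy⟩

lemma mem_vanishingForms_iff {Q : biInvariantForms L} :
    Q ∈ vanishingForms 𝔨 ↔ ∀ x ∈ 𝔨, ∀ y ∈ 𝔨, Q.1 x y = 0 := by
  refine ⟨fun hQ x hx y hy => vanishing_apply (Q := ⟨Q, hQ⟩) hx hy, fun hQ => ?_⟩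
  refine LinearMap.mem_ker.2 (LinearMap.ext₂ fun x y => hQ x x.2 y y.2)

lemma threeForm_apply (h : IsCompl 𝔨 𝔭) (Q : biInvariantForms L) (X Y Z : 𝔭) :
    threeForm h Q ![X, Y, Z] =
      4 * Q.1 ⁅(X : L), (Y : L)⁆ Z - Q.1 (pComp h ⁅(X : L), (Y : L)⁆) Z
        + Q.1 (pComp h ⁅(X : L), (Z : L)⁆) Y - Q.1 (pComp h ⁅(Y : L), (Z : L)⁆) X := rfl

/-- Substitute `X_𝔭 = X - X_𝔨`. As `Q([X, Y], Z)` is totally skew, the three projected terms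
contribute `-3 Q([X, Y], Z)`, leaving the coefficient `4 - 3 = 1`. -/
lemma threeForm_eq_kComp (h : IsCompl 𝔨 𝔭) (Q : biInvariantForms L) (X Y Z : 𝔭) :
    threeForm h Q ![X, Y, Z] =
      Q.1 ⁅(X : L), (Y : L)⁆ Z + Q.1 (kComp h ⁅(X : L), (Y : L)⁆) Z
        - Q.1 (kComp h ⁅(X : L), (Z : L)⁆) Y + Q.1 (kComp h ⁅(Y : L), (Z : L)⁆) X := by
  have e : ∀ x y : L, Q.1 (pComp h x) y = Q.1 x y - Q.1 (kComp h x) y := fun x y => by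
    rw [eq_sub_iff_add_eq, ← LinearMap.add_apply, ← map_add, add_comm, kComp_add_pComp]
  have h1 : Q.1 ⁅(X : L), (Z : L)⁆ Y = - Q.1 ⁅(X : L), (Y : L)⁆ Z := by
    rw [Q.2.2 X Z Y, biInv_symm Q.2]
  have h2 : Q.1 ⁅(Y : L), (Z : L)⁆ X = Q.1 ⁅(X : L), (Y : L)⁆ Z := by
    rw [biInv_lie Q.2 X Y Z, biInv_symm Q.2]
  rw [threeForm_apply, e, e, e, h1, h2]
  ring

/-- The `2`-form `α_Q(X, Y) = Q(X_𝔭, Y_𝔨) - Q(Y_𝔭, X_𝔨)`. -/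
def mixedForm (h : IsCompl 𝔨 𝔭) (Q : LinearMap.BilinForm ℝ L) : L [⋀^Fin 2]→ₗ[ℝ] ℝ :=
  mkAltTwo ((Q.compl₁₂ (pComp h) (kComp h)) - (Q.compl₁₂ (pComp h) (kComp h)).flip)
    fun x => by simp

lemma mixedForm_apply (h : IsCompl 𝔨 𝔭) (Q : LinearMap.BilinForm ℝ L) (x y : L) :
    mixedForm h Q ![x, y] = Q (pComp h x) (kComp h y) - Q (pComp h y) (kComp h x) := rfl

/-- This is `π^*H_Q = Q([·,·],·) + dα_Q`, valid on arguments with `𝔨`-components precisely because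
`Q` vanishes on `𝔨 × 𝔨`. -/
lemma hat_threeForm_apply (h : IsCompl 𝔨 𝔭) (hkk : ∀ x ∈ 𝔨, ∀ y ∈ 𝔨, ⁅x, y⁆ ∈ 𝔨)
    (hkp : ∀ x ∈ 𝔨, ∀ y ∈ 𝔭, ⁅x, y⁆ ∈ 𝔭) (Q : vanishingForms 𝔨) (X Y Z : L) :
    hat h (threeForm h Q.1) ![X, Y, Z] = Q.1.1 ⁅X, Y⁆ Z - mixedForm h Q.1.1 ![⁅X, Y⁆, Z]
      + mixedForm h Q.1.1 ![⁅X, Z⁆, Y] - mixedForm h Q.1.1 ![⁅Y, Z⁆, X] := by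
  have hQ := Q.1.2
  have hk : ∀ {x y : L}, x ∈ 𝔨 → y ∈ 𝔨 → Q.1.1 x y = 0 := fun hx hy => vanishing_apply hx hy
  have hhat : hat h (threeForm h Q.1) ![X, Y, Z] = threeForm h Q.1
      ![⟨pComp h X, pComp_mem h _⟩, ⟨pComp h Y, pComp_mem h _⟩, ⟨pComp h Z, pComp_mem h _⟩] := by
    rw [hat_apply]
    congr 1
    ext i
    fin_cases i <;> rfl
  rw [hhat, threeForm_eq_kComp]
  simp only [mixedForm_apply]
  set q := Q.1.1
  have key : ∀ X Y : L, ∃ x x' y y' : L, x ∈ 𝔨 ∧ x' ∈ 𝔭 ∧ y ∈ 𝔨 ∧ y' ∈ 𝔭 ∧ X = x + x' ∧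
      Y = y + y' := fun X Y => ⟨kComp h X, pComp h X, kComp h Y, pComp h Y, kComp_mem _ _,
        pComp_mem _ _, kComp_mem _ _, pComp_mem _ _, (kComp_add_pComp _ _).symm,
        (kComp_add_pComp _ _).symm⟩
  obtain ⟨x, x', y, y', hx, hx', hy, hy', rfl, rfl⟩ := key X Y
  obtain ⟨z, z', -, -, hz, hz', -, -, rfl, -⟩ := key Z Z
  have hpk : ∀ x ∈ 𝔭, ∀ y ∈ 𝔨, ⁅x, y⁆ ∈ 𝔭 := fun x hx y hy => by
    rw [← lie_skew]
    exact 𝔭.neg_mem (hkp y hy x hx)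
  -- Brackets with an entry in `𝔨` lie in `𝔨` or in `𝔭`; only brackets of two elements of `𝔭` keep
  -- both components.
  simp only [map_add, LinearMap.add_apply, add_lie, lie_add, kComp_of_mem h hx,
    kComp_of_mem h hy, kComp_of_mem h hz, kComp_of_mem' h hx', kComp_of_mem' h hy',
    kComp_of_mem' h hz', pComp_of_mem' h hx, pComp_of_mem' h hy, pComp_of_mem' h hz,
    pComp_of_mem h hx', pComp_of_mem h hy', pComp_of_mem h hz', zero_add, add_zero,
    kComp_of_mem h (hkk _ hx _ hy), kComp_of_mem h (hkk _ hx _ hz), kComp_of_mem h (hkk _ hy _ hz),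
    pComp_of_mem' h (hkk _ hx _ hy), pComp_of_mem' h (hkk _ hx _ hz),
    pComp_of_mem' h (hkk _ hy _ hz),
    kComp_of_mem' h (hkp _ hx _ hy'), kComp_of_mem' h (hkp _ hx _ hz'),
    kComp_of_mem' h (hkp _ hy _ hz'), kComp_of_mem' h (hpk _ hx' _ hy),
    kComp_of_mem' h (hpk _ hx' _ hz), kComp_of_mem' h (hpk _ hy' _ hz),
    pComp_of_mem h (hkp _ hx _ hy'), pComp_of_mem h (hkp _ hx _ hz'),
    pComp_of_mem h (hkp _ hy _ hz'), pComp_of_mem h (hpk _ hx' _ hy),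
    pComp_of_mem h (hpk _ hx' _ hz), pComp_of_mem h (hpk _ hy' _ hz)]
  have e : ∀ x y : L, q (pComp h x) y = q x y - q (kComp h x) y := fun x y => by
    rw [eq_sub_iff_add_eq, ← LinearMap.add_apply, ← map_add, add_comm, kComp_add_pComp]
  have ek : ∀ x y : L, y ∈ 𝔨 → q (kComp h x) y = 0 := fun x y hy => hk (kComp_mem h x) hy
  simp only [e, ek _ _ hx, ek _ _ hy, ek _ _ hz]
  have s1 : ∀ a b c : L, q ⁅a, c⁆ b = - q ⁅a, b⁆ c := fun a b c => by
    rw [hQ.2 a c b, biInv_symm hQ]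
  have s2 : ∀ a b c : L, q ⁅b, c⁆ a = q ⁅a, b⁆ c := fun a b c => by
    rw [biInv_lie hQ a b c, biInv_symm hQ]
  have s3 : ∀ a b c : L, q c ⁅a, b⁆ = q ⁅a, b⁆ c := fun a b c => biInv_symm hQ _ _
  simp only [s3]
  have z1 := hk (hkk _ hx _ hy) hz
  have t1 := s1 x y z
  have t2 := s2 x y z
  have a1 := s1 x y z'
  have a2 := s2 x y z'
  have b1 := s1 x y' z
  have b2 := s2 x y' z
  have c1 := s1 x' y z
  have c2 := s2 x' y z
  have d1 := s1 x' y' z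
  have d2 := s2 x' y' z
  have e1 := s1 x' y z'
  have e2 := s2 x' y z'
  have f1 := s1 x y' z'
  have f2 := s2 x y' z'
  have g1 := s1 x' y' z'
  have g2 := s2 x' y' z'
  linarith [biInv_symm hQ z' (kComp h ⁅x', y'⁆), biInv_symm hQ y' (kComp h ⁅x', z'⁆),
    biInv_symm hQ x' (kComp h ⁅y', z'⁆)]

end LieAlgebra

/-! ### Lie algebra cohomology in low degree -/

section Cohomology

variable {L : Type*} [LieRing L] [LieAlgebra ℝ L] {𝔨 𝔭 : Submodule ℝ L}

lemma lie_self_of_isAtom [LieAlgebra.IsSemisimple ℝ L] {I : LieIdeal ℝ L} (hI : IsAtom I) : ⁅I, I⁆ = I := by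
  rcases hI.le_iff.1 (LieSubmodule.lie_le_right I I) with h | h
  · refine absurd ?_ (LieAlgebra.IsSemisimple.non_abelian_of_isAtom I hI)
    exact (LieSubmodule.lie_abelian_iff_lie_self_eq_bot I).2 h
  · exact h

/-- A semisimple algebra is perfect, being the supremum of its minimal ideals, each of which equals
its own bracket. -/
lemma eq_zero_of_forall_lie [LieAlgebra.IsSemisimple ℝ L] (θ : L →ₗ[ℝ] ℝ)
    (hθ : ∀ x y : L, θ ⁅x, y⁆ = 0) : θ = 0 := by
  have h1 : (⊤ : LieIdeal ℝ L) ≤ ⁅(⊤ : LieIdeal ℝ L), (⊤ : LieIdeal ℝ L)⁆ := by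
    rw [← LieAlgebra.IsSemisimple.sSup_atoms_eq_top]
    refine sSup_le fun I hI => ?_
    calc I = ⁅I, I⁆ := (lie_self_of_isAtom hI).symm
      _ ≤ ⁅sSup {I : LieIdeal ℝ L | IsAtom I}, sSup {I : LieIdeal ℝ L | IsAtom I}⁆ :=
        LieSubmodule.mono_lie (le_sSup hI) (le_sSup hI)
  ext x
  have hx : x ∈ ⁅(⊤ : LieIdeal ℝ L), (⊤ : LieIdeal ℝ L)⁆ := h1 (LieSubmodule.mem_top x)
  rw [← LieSubmodule.mem_toSubmodule, LieSubmodule.lieIdeal_oper_eq_linear_span'] at hx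
  have : Submodule.span ℝ {x | ∃ y ∈ (⊤ : LieIdeal ℝ L), ∃ z ∈ (⊤ : LieIdeal ℝ L), ⁅y, z⁆ = x}
      ≤ LinearMap.ker θ := by
    rw [Submodule.span_le]
    rintro _ ⟨y, -, z, -, rfl⟩
    exact hθ y z
  exact this hx

lemma lie_lie_cyclic (a b c : L) : ⁅⁅a, b⁆, c⁆ - ⁅⁅a, c⁆, b⁆ + ⁅⁅b, c⁆, a⁆ = 0 := by
  have := lie_jacobi a b c
  rw [← lie_skew ⁅a, b⁆ c, ← lie_skew ⁅a, c⁆ b, ← lie_skew ⁅b, c⁆ a, ← lie_skew a c, lie_neg,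
    ← neg_eq_zero, ← this]
  abel

/-- The closedness of the `3`-form `Q([x, y], z) + dα(x, y, z)` on a Lie algebra. -/
lemma cartan_add_exact_closed {q : LinearMap.BilinForm ℝ L} (hq : q ∈ biInvariantForms L)
    (α : L [⋀^Fin 2]→ₗ[ℝ] ℝ) (F : L → L → L → ℝ)
    (hF : ∀ x y z : L, F x y z = q ⁅x, y⁆ z - α ![⁅x, y⁆, z] + α ![⁅x, z⁆, y] - α ![⁅y, z⁆, x])
    (W X Y Z : L) :
    - F ⁅W, X⁆ Y Z + F ⁅W, Y⁆ X Z - F ⁅W, Z⁆ X Y - F ⁅X, Y⁆ W Z + F ⁅X, Z⁆ W Y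
      - F ⁅Y, Z⁆ W X = 0 := by
  simp only [hF, ← altTwo_apply]
  set a := altTwo α
  have ha : ∀ x y, a x y = - a y x := altTwo_swap α
  have J : ∀ x y z w : L, a ⁅⁅x, y⁆, z⁆ w - a ⁅⁅x, z⁆, y⁆ w + a ⁅⁅y, z⁆, x⁆ w = 0 := by
    intro x y z w
    have := congrArg (fun u => a u w) (lie_lie_cyclic x y z)
    simpa only [map_add, map_sub, LinearMap.add_apply, LinearMap.sub_apply, map_zero,
      LinearMap.zero_apply] using this
  have Jq : ∀ x y z w : L, q ⁅⁅x, y⁆, z⁆ w - q ⁅⁅x, z⁆, y⁆ w + q ⁅⁅y, z⁆, x⁆ w = 0 := by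
    intro x y z w
    have := congrArg (fun u => q u w) (lie_lie_cyclic x y z)
    -- The identity `J` gives `d(dα) = 0`. By invariance and symmetry of `q` the six terms in `q`
    -- are twice the sum in `Jq`.
    simpa only [map_add, map_sub, LinearMap.add_apply, LinearMap.sub_apply, map_zero,
      LinearMap.zero_apply] using this
  have e : ∀ x y z w : L, q ⁅⁅x, y⁆, z⁆ w = q ⁅x, y⁆ ⁅z, w⁆ := fun x y z w => biInv_lie hq _ _ _
  have e' : ∀ x y z w : L, q ⁅x, y⁆ ⁅z, w⁆ = q ⁅z, w⁆ ⁅x, y⁆ := fun x y z w => biInv_symm hq _ _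
  have := Jq W X Y Z
  simp only [e] at this ⊢
  have e1 := e' W X Y Z
  have e2 := e' W Y X Z
  have e3 := e' W Z X Y
  have e4 : q ⁅X, Y⁆ ⁅W, Z⁆ = q ⁅W, Z⁆ ⁅X, Y⁆ := e' _ _ _ _
  linarith [J W X Y Z, J W X Z Y, J W Y Z X, J X Y Z W, ha ⁅W, X⁆ ⁅Y, Z⁆, ha ⁅W, Y⁆ ⁅X, Z⁆,
    ha ⁅W, Z⁆ ⁅X, Y⁆]

/-- The expression `a([x, y], z)` is skew in `x, y` and, by invariance, symmetric in `y, z`. A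
trilinear map with both symmetries is zero. -/
lemma invariant_two_form_apply_lie {a : L →ₗ[ℝ] L →ₗ[ℝ] ℝ} (ha : ∀ x y, a x y = - a y x)
    (hinv : ∀ x y z : L, a ⁅x, y⁆ z + a y ⁅x, z⁆ = 0) (x y z : L) : a ⁅x, y⁆ z = 0 := by
  have h1 : ∀ x y z : L, a ⁅x, y⁆ z = - a ⁅y, x⁆ z := fun x y z => by
    rw [← lie_skew, map_neg, LinearMap.neg_apply]
  have h2 : ∀ x y z : L, a ⁅x, y⁆ z = a ⁅x, z⁆ y := fun x y z => by
    have := hinv x y z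
    rw [ha y] at this
    linarith
  linarith [h1 x y z, h2 y x z, h1 y z x, h2 z y x, h1 z x y, h2 x z y]

/-- An invariant form is closed, so by Cartan's formula its contraction with `x` is a closed 2-form.
Here this is a linear combination of four instances of invariance. -/
lemma invariant_three_form_closed {t : L →ₗ[ℝ] L →ₗ[ℝ] L →ₗ[ℝ] ℝ}
    (h12 : ∀ x y z, t x y z = - t y x z) (h23 : ∀ x y z, t x y z = - t x z y)
    (hinv : ∀ w x y z : L, t ⁅w, x⁆ y z + t x ⁅w, y⁆ z + t x y ⁅w, z⁆ = 0) (x y z w : L) :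
    t x ⁅y, z⁆ w + t x ⁅z, w⁆ y + t x ⁅w, y⁆ z = 0 := by
  have n1 : ∀ a b c d : L, t ⁅a, b⁆ c d = - t ⁅b, a⁆ c d := fun a b c d => by
    rw [← lie_skew, map_neg, LinearMap.neg_apply, LinearMap.neg_apply]
  have n2 : ∀ a b c d : L, t a ⁅b, c⁆ d = - t a ⁅c, b⁆ d := fun a b c d => by
    rw [← lie_skew, map_neg, LinearMap.neg_apply]
  have i1 := hinv y x z w
  have i2 := hinv z x y w
  have i3 := hinv w x y z
  have i4 := hinv x y z w
  have j1 := h23 x z ⁅y, w⁆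
  have j2 := h23 x y ⁅z, w⁆
  have j3 := h23 x y ⁅w, z⁆
  have j4 := h12 y ⁅x, z⁆ w
  have j5 := h23 y z ⁅x, w⁆
  have j6 := h12 y ⁅x, w⁆ z
  linarith [n2 x y w z, n2 x z y w, n2 x w z y, n1 y x z w, n1 z x y w, n1 w x y z]

/-- Koszul's description of the invariant `3`-forms on a Lie algebra with `H¹ = H² = 0`. -/
lemma exists_biInvariant_of_invariant_three_form
    (hperf : ∀ θ : L →ₗ[ℝ] ℝ, (∀ x y : L, θ ⁅x, y⁆ = 0) → θ = 0)
    (hH2 : ∀ s : L →ₗ[ℝ] L →ₗ[ℝ] ℝ, (∀ x, s x x = 0) →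
      (∀ x y z : L, s ⁅x, y⁆ z + s ⁅y, z⁆ x + s ⁅z, x⁆ y = 0) →
      ∃ θ : L →ₗ[ℝ] ℝ, ∀ x y : L, s x y = θ ⁅x, y⁆)
    {t : L →ₗ[ℝ] L →ₗ[ℝ] L →ₗ[ℝ] ℝ}
    (h12 : ∀ x y z, t x y z = - t y x z) (h23 : ∀ x y z, t x y z = - t x z y)
    (hinv : ∀ w x y z : L, t ⁅w, x⁆ y z + t x ⁅w, y⁆ z + t x y ⁅w, z⁆ = 0) :
    ∃ q ∈ biInvariantForms L, ∀ x y z : L, t x y z = q ⁅x, y⁆ z := by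
  -- The contraction `t x` is closed, hence exact. Its primitive `θ x` is unique by perfectness and
  -- becomes `q x`; uniqueness also yields linearity, invariance and symmetry of `q`.
  have hex : ∀ x, ∃ θ : L →ₗ[ℝ] ℝ, ∀ y z : L, t x y z = θ ⁅y, z⁆ := fun x =>
    hH2 (t x) (fun y => by linarith [h23 x y y])
      (fun y z w => invariant_three_form_closed h12 h23 hinv x y z w)
  choose θ hθ using hex
  have huniq : ∀ θ θ' : L →ₗ[ℝ] ℝ, (∀ y z : L, θ ⁅y, z⁆ = θ' ⁅y, z⁆) → θ = θ' := fun θ θ' h => by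
    rw [← sub_eq_zero]
    exact hperf _ fun x y => by rw [LinearMap.sub_apply, h, sub_self]
  let q : LinearMap.BilinForm ℝ L :=
    { toFun := θ
      map_add' := fun x x' => huniq _ _ fun y z => by
        rw [← hθ, map_add]
        simp only [LinearMap.add_apply, hθ]
      map_smul' := fun c x => huniq _ _ fun y z => by
        rw [← hθ, map_smul]
        simp only [LinearMap.smul_apply, hθ, RingHom.id_apply] }
  have hq : ∀ x y z : L, t x y z = q x ⁅y, z⁆ := hθ
  have hinv' : ∀ x y z : L, q ⁅x, y⁆ z = - q y ⁅x, z⁆ := by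
    intro x y z
    have : q ⁅x, y⁆ = - (q y ∘ₗ (LieAlgebra.ad ℝ L x : L →ₗ[ℝ] L)) := by
      refine huniq _ _ fun a b => ?_
      rw [← hq, LinearMap.neg_apply, LinearMap.comp_apply, LieAlgebra.ad_apply, leibniz_lie,
        map_add, ← hq, ← hq]
      linarith [hinv x y a b]
    rw [this]
    rfl
  have hsymm : ∀ x y, q x y = q y x := by
    intro x y
    have : q x = q.flip x := by
      refine huniq _ _ fun a b => ?_
      change q x ⁅a, b⁆ = q ⁅a, b⁆ x
      rw [hinv', ← hq, ← hq]
      linarith [h12 x a b, h23 a x b, h12 a b x]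
    rw [this]
    rfl
  refine ⟨q, ⟨⟨fun x y => hsymm x y⟩, fun x y z => hinv' x y z⟩, fun x y z => ?_⟩
  rw [hinv', ← hq]
  exact h12 x y z

/-- Insert `z ∈ 𝔨` in the formula for the pullback. The left side vanishes by horizontality, and
invariance of `α` under `z` cancels two terms. What remains is `(α + q)(z, [x, y]) = 0`, to which
perfectness applies. -/
lemma primitive_apply_of_mem (h : IsCompl 𝔨 𝔭)
    (hperf : ∀ θ : L →ₗ[ℝ] ℝ, (∀ x y : L, θ ⁅x, y⁆ = 0) → θ = 0)
    {H : 𝔭 [⋀^Fin 3]→ₗ[ℝ] ℝ} {q : LinearMap.BilinForm ℝ L} (hq : q ∈ biInvariantForms L)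
    {α : L [⋀^Fin 2]→ₗ[ℝ] ℝ}
    (hH : ∀ x y z : L, hat h H ![x, y, z] =
      q ⁅x, y⁆ z - α ![⁅x, y⁆, z] + α ![⁅x, z⁆, y] - α ![⁅y, z⁆, x])
    (hα : ∀ z ∈ 𝔨, ∀ x y : L, α ![⁅z, x⁆, y] + α ![x, ⁅z, y⁆] = 0) {z : L} (hz : z ∈ 𝔨) (w : L) :
    α ![z, w] = - q z w := by
  have h1 : altTwo α z + q z = 0 := by
    refine hperf _ fun x y => ?_
    have h0 : hat h H ![z, x, y] = 0 := by
      rw [hat_apply]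
      refine AlternatingMap.map_coord_zero _ 0 (Subtype.ext (pComp_of_mem' h hz))
    have h2 := hH z x y
    have h3 := hα z hz x y
    have h4 := altTwo_swap α x ⁅z, y⁆
    have h5 := altTwo_swap α ⁅x, y⁆ z
    have h6 := biInv_lie hq z x y
    simp only [altTwo_apply, LinearMap.add_apply] at *
    linarith
  have h2 := LinearMap.congr_fun h1 w
  simp only [altTwo_apply, LinearMap.add_apply, LinearMap.zero_apply] at h2
  linarith

/-- On `𝔨 × 𝔨` the skew form `α` equals minus the symmetric form `q`, so both vanish. This is where
the condition on `Q` in the theorem comes from. -/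
lemma vanishing_of_primitive {q : LinearMap.BilinForm ℝ L} (hq : q ∈ biInvariantForms L)
    {α : L [⋀^Fin 2]→ₗ[ℝ] ℝ} (hα : ∀ z ∈ 𝔨, ∀ w, α ![z, w] = - q z w) :
    ∀ x ∈ 𝔨, ∀ y ∈ 𝔨, q x y = 0 := by
  intro x hx y hy
  have h1 := altTwo_swap α x y
  rw [altTwo_apply, altTwo_apply, hα x hx, hα y hy, biInv_symm hq y x] at h1
  linarith

/-- The values of `α` with an argument in `𝔨` are those of `α_q`, so the difference is determined by
its restriction to `𝔭`. -/
lemma primitive_eq_mixedForm_add_hat (h : IsCompl 𝔨 𝔭) {q : LinearMap.BilinForm ℝ L}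
    (hq : q ∈ biInvariantForms L) {α : L [⋀^Fin 2]→ₗ[ℝ] ℝ}
    (hα : ∀ z ∈ 𝔨, ∀ w, α ![z, w] = - q z w) (x y : L) :
    α ![x, y] = mixedForm h q ![x, y] + hat h (α.compLinearMap 𝔭.subtype) ![x, y] := by
  have e : hat h (α.compLinearMap 𝔭.subtype) ![x, y] = altTwo α (pComp h x) (pComp h y) := by
    rw [hat_apply, AlternatingMap.compLinearMap_apply, altTwo_apply]
    refine congrArg α (funext fun i => ?_)
    fin_cases i <;> rfl
  rw [e, mixedForm_apply, ← altTwo_apply]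
  have h1 : altTwo α (kComp h x) y = - q (kComp h x) y := hα _ (kComp_mem h x) _
  have h2 : altTwo α (kComp h y) (pComp h x) = - q (kComp h y) (pComp h x) :=
    hα _ (kComp_mem h y) _
  have h3 := vanishing_of_primitive hq hα _ (kComp_mem h x) _ (kComp_mem h y)
  have h4 := altTwo_swap α (pComp h x) (kComp h y)
  have ex : altTwo α x y = altTwo α (kComp h x) y + altTwo α (pComp h x) y := by
    rw [← LinearMap.add_apply, ← map_add, kComp_add_pComp]
  have ey : altTwo α (pComp h x) y =
      altTwo α (pComp h x) (kComp h y) + altTwo α (pComp h x) (pComp h y) := by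
    rw [← map_add, kComp_add_pComp]
  have ey' : q (kComp h x) y = q (kComp h x) (kComp h y) + q (kComp h x) (pComp h y) := by
    rw [← map_add, kComp_add_pComp]
  rw [biInv_symm hq (pComp h x), biInv_symm hq (pComp h y)]
  linarith

end Cohomology

lemma hasFDerivAt_clm_three {W F : Type*} [NormedAddCommGroup W] [NormedSpace ℝ W]
    [NormedAddCommGroup F] [NormedSpace ℝ F] (a : F →L[ℝ] F →L[ℝ] F →L[ℝ] ℝ)
    {f g h : W → F} {f' g' h' : W →L[ℝ] F} {u : W} (hf : HasFDerivAt f f' u)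
    (hg : HasFDerivAt g g' u) (hh : HasFDerivAt h h' u) :
    HasFDerivAt (fun u => a (f u) (g u) (h u))
      (a (f u) (g u) ∘L h' + (a (f u) ∘L g' + (a ∘L f').flip (g u)).flip (h u)) u := by
  have h1 : HasFDerivAt (fun u => a (f u)) (a ∘L f') u :=
    a.hasFDerivAt.comp u hf
  have h2 : HasFDerivAt (fun u => a (f u) (g u)) (a (f u) ∘L g' + (a ∘L f').flip (g u)) u :=
    HasFDerivAt.clm_apply h1 hg
  exact HasFDerivAt.clm_apply h2 hh

/-! ### Infinitesimal and global invariance under `Ad` -/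

section AdjointInvariance

variable {n : ℕ} {G : Type*} [TopologicalSpace G] [ChartedSpace (EuclideanSpace ℝ (Fin n)) G]
  [Group G] [LieGroup (𝓡 n) ∞ G]

instance instFiniteDimensionalGroupLieAlgebra :
    FiniteDimensional ℝ (GroupLieAlgebra (𝓡 n) G) :=
  inferInstanceAs (FiniteDimensional ℝ (EuclideanSpace ℝ (Fin n)))

/-- A bilinear form on the Lie algebra as a continuous bilinear form. -/
def clmTwo (a : GroupLieAlgebra (𝓡 n) G →ₗ[ℝ] GroupLieAlgebra (𝓡 n) G →ₗ[ℝ] ℝ) :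
    EuclideanSpace ℝ (Fin n) →L[ℝ] EuclideanSpace ℝ (Fin n) →L[ℝ] ℝ :=
  LinearMap.toContinuousLinearMap
    (E := EuclideanSpace ℝ (Fin n)) (F' := EuclideanSpace ℝ (Fin n) →L[ℝ] ℝ)
    ((LinearMap.toContinuousLinearMap (𝕜 := ℝ) (E := EuclideanSpace ℝ (Fin n))
      (F' := ℝ)).toLinearMap ∘ₗ
      (show EuclideanSpace ℝ (Fin n) →ₗ[ℝ] EuclideanSpace ℝ (Fin n) →ₗ[ℝ] ℝ from a))

/-- A trilinear form on the Lie algebra as a continuous trilinear form. -/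
def clmThree (a : GroupLieAlgebra (𝓡 n) G →ₗ[ℝ] GroupLieAlgebra (𝓡 n) G →ₗ[ℝ]
      GroupLieAlgebra (𝓡 n) G →ₗ[ℝ] ℝ) :
    EuclideanSpace ℝ (Fin n) →L[ℝ] EuclideanSpace ℝ (Fin n) →L[ℝ]
      EuclideanSpace ℝ (Fin n) →L[ℝ] ℝ :=
  LinearMap.toContinuousLinearMap (E := EuclideanSpace ℝ (Fin n))
    (F' := EuclideanSpace ℝ (Fin n) →L[ℝ] EuclideanSpace ℝ (Fin n) →L[ℝ] ℝ)
    { toFun := fun x => clmTwo (G := G) (a x)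
      map_add' := fun x y => by
        ext u v
        exact LinearMap.congr_fun₂ (a.map_add x y) u v
      map_smul' := fun c x => by
        ext u v
        exact LinearMap.congr_fun₂ (a.map_smul c x) u v }

lemma contMDiff_AdL_apply (X : EuclideanSpace ℝ (Fin n)) :
    ContMDiff (𝓡 n) 𝓘(ℝ, EuclideanSpace ℝ (Fin n)) ∞ (fun g : G => AdL n g X) :=
  contMDiff_AdL.clm_apply contMDiff_const

lemma contMDiff_two (a : EuclideanSpace ℝ (Fin n) →L[ℝ] EuclideanSpace ℝ (Fin n) →L[ℝ] ℝ)
    (X Y : EuclideanSpace ℝ (Fin n)) :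
    ContMDiff (𝓡 n) 𝓘(ℝ, ℝ) ∞ (fun g : G => a (AdL n g X) (AdL n g Y)) :=
  (a.contMDiff.comp (contMDiff_AdL_apply X)).clm_apply (contMDiff_AdL_apply Y)

lemma rgrad_two (a : EuclideanSpace ℝ (Fin n) →L[ℝ] EuclideanSpace ℝ (Fin n) →L[ℝ] ℝ) (x : G)
    (X Y v : EuclideanSpace ℝ (Fin n)) :
    rgrad n (fun g : G => a (AdL n g X) (AdL n g Y)) x v =
      a (adL n G v (AdL n x X)) (AdL n x Y) + a (AdL n x X) (adL n G v (AdL n x Y)) := by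
  have h := ((a.hasFDerivAt.comp (crd n (1 : G)) (hasFDerivAt_AdL_par_mul x X)).clm_apply
    (hasFDerivAt_AdL_par_mul x Y)).fderiv
  refine (DFunLike.congr_fun h v).trans ?_
  simp [par_crd_one, add_comm]

lemma rgrad_three (a : EuclideanSpace ℝ (Fin n) →L[ℝ] EuclideanSpace ℝ (Fin n) →L[ℝ]
      EuclideanSpace ℝ (Fin n) →L[ℝ] ℝ) (x : G) (X Y Z v : EuclideanSpace ℝ (Fin n)) :
    rgrad n (fun g : G => a (AdL n g X) (AdL n g Y) (AdL n g Z)) x v =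
      a (adL n G v (AdL n x X)) (AdL n x Y) (AdL n x Z)
        + a (AdL n x X) (adL n G v (AdL n x Y)) (AdL n x Z)
        + a (AdL n x X) (AdL n x Y) (adL n G v (AdL n x Z)) := by
  have h := (hasFDerivAt_clm_three a (hasFDerivAt_AdL_par_mul (n := n) x X)
    (hasFDerivAt_AdL_par_mul x Y) (hasFDerivAt_AdL_par_mul x Z)).fderiv
  refine (DFunLike.congr_fun h v).trans ?_
  simp [par_crd_one]
  ring

lemma rgrad_one {V : Type*} [NormedAddCommGroup V] [NormedSpace ℝ V] (F : G → V) :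
    rgrad n F 1 = dOne n F := by simp [rgrad]

lemma Ad_lie (g : G) (X Y : GroupLieAlgebra (𝓡 n) G) :
    Ad n g ⁅X, Y⁆ = ⁅Ad n g X, Ad n g Y⁆ := by
  have h1 : Ad n g ⁅X, Y⁆ = AdL n g (adL n G X Y) :=
    (congrArg (Ad n g) (lie_eq_adL X Y)).trans (Ad_apply g _)
  have h2 : ⁅Ad n g X, Ad n g Y⁆ = adL n G (AdL n g X) (AdL n g Y) := by
    refine (lie_eq_adL _ _).trans ?_
    have e1 := Ad_apply (n := n) g X
    have e2 := Ad_apply (n := n) g Y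
    exact congrArg₂ (fun a b => adL n G a b) e1 e2
  exact h1.trans ((AdL_adL g X Y).trans h2.symm)

lemma dOne_clm_AdL (P : EuclideanSpace ℝ (Fin n) →L[ℝ] EuclideanSpace ℝ (Fin n))
    (X v : EuclideanSpace ℝ (Fin n)) :
    dOne n (fun g : G => P (AdL n g X)) v = P (adL n G v X) := by
  have := (P.hasFDerivAt.comp (crd n (1 : G)) ((hasFDerivAt_AdL_par (n := n) (G := G)).clm_apply
    (hasFDerivAt_const X (crd n (1 : G))))).fderiv
  refine (DFunLike.congr_fun this v).trans ?_
  rw [ContinuousLinearMap.comp_zero, zero_add]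
  rfl

/-! ### The Lie algebra of a subgroup -/

/-- `F` is constant along the curves in `K` whose velocities span the Lie algebra of `K`. -/
lemma dOne_eq_zero_of_mem {V : Type*} [NormedAddCommGroup V] [NormedSpace ℝ V] {K : Subgroup G}
    {F : G → V} (hF : ContMDiff (𝓡 n) 𝓘(ℝ, V) ∞ F) (hK : ∀ k ∈ K, F k = F 1)
    {Z : GroupLieAlgebra (𝓡 n) G} (hZ : Z ∈ subgroupLieAlgebra n K) : dOne n F Z = 0 := by
  refine Submodule.span_induction (p := fun Z _ => dOne n F Z = 0) ?_ ?_ ?_ ?_ hZ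
  · rintro _ ⟨γ, hγ, hγK, hγ0, rfl⟩
    have h1 := mfderiv_comp_apply (0 : ℝ) (g := F) (f := γ)
      (hF.contMDiffAt.mdifferentiableAt (by simp)) (hγ.contMDiffAt.mdifferentiableAt (by simp))
      (1 : ℝ)
    have h2 : F ∘ γ = fun _ => F 1 := funext fun t => hK _ (hγK t)
    rw [h2, mfderiv_const] at h1
    rw [hγ0] at h1
    exact ((mfderiv_one_eq_dOne hF.contMDiffAt _).symm.trans h1.symm)
  · exact map_zero _
  · intro x y _ _ hx hy
    exact (map_add (dOne n F) _ _).trans ((congrArg₂ (· + ·) hx hy).trans (add_zero _))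
  · intro c x _ hx
    exact (map_smul (dOne n F) c _).trans ((congrArg (c • ·) hx).trans (smul_zero _))

lemma Ad_mem_subgroupLieAlgebra {K : Subgroup G} {k : G} (hk : k ∈ K)
    {Z : GroupLieAlgebra (𝓡 n) G} (hZ : Z ∈ subgroupLieAlgebra n K) :
    Ad n k Z ∈ subgroupLieAlgebra n K := by
  refine Submodule.span_induction (p := fun Z _ => Ad n k Z ∈ subgroupLieAlgebra n K)
    ?_ ?_ ?_ ?_ hZ
  · rintro _ ⟨γ, hγ, hγK, hγ0, rfl⟩
    refine Submodule.subset_span ⟨fun t => k * γ t * k⁻¹, ?_, ?_, ?_, ?_⟩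
    · exact (contMDiff_mul_left_right k k⁻¹).comp hγ
    · exact fun t => K.mul_mem (K.mul_mem hk (hγK t)) (K.inv_mem hk)
    · simp [hγ0]
    · have h1 := mfderiv_comp_apply (0 : ℝ) (g := fun y : G => k * y * k⁻¹) (f := γ)
        ((contMDiff_mul_left_right k k⁻¹).contMDiffAt.mdifferentiableAt (by simp))
        (hγ.contMDiffAt.mdifferentiableAt (by simp)) (1 : ℝ)
      rw [hγ0] at h1
      exact h1.symm
  · rw [map_zero]; exact zero_mem _
  · intro x y _ _ hx hy
    rw [map_add]; exact add_mem hx hy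
  · intro c x _ hx
    rw [map_smul]; exact Submodule.smul_mem _ c hx

/-- The `S`-component of `Ad k X` is zero for all `k ∈ K`; differentiating it along `Z` gives the
`S`-component of `[Z, X]`. With the two choices of `T` this gives `[𝔨, 𝔨] ⊆ 𝔨` and `[𝔨, 𝔭] ⊆ 𝔭`. -/
lemma lie_mem_of_Ad_mem {K : Subgroup G} {S T : Submodule ℝ (GroupLieAlgebra (𝓡 n) G)}
    (hST : IsCompl S T) {X Z : GroupLieAlgebra (𝓡 n) G} (hX : ∀ k ∈ K, Ad n k X ∈ T)
    (hZ : Z ∈ subgroupLieAlgebra n K) : ⁅Z, X⁆ ∈ T := by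
  let P : EuclideanSpace ℝ (Fin n) →L[ℝ] EuclideanSpace ℝ (Fin n) :=
    LinearMap.toContinuousLinearMap
      (show EuclideanSpace ℝ (Fin n) →ₗ[ℝ] EuclideanSpace ℝ (Fin n) from kComp hST)
  have hP : ∀ x : GroupLieAlgebra (𝓡 n) G, P x = kComp hST x := fun _ => rfl
  have hF : ContMDiff (𝓡 n) 𝓘(ℝ, EuclideanSpace ℝ (Fin n)) ∞ (fun g : G => P (AdL n g X)) :=
    P.contMDiff.comp (contMDiff_AdL_apply X)
  have h0 : ∀ k ∈ K, P (AdL n k X) = 0 := fun k hk =>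
    (congrArg P (Ad_apply (n := n) k X).symm).trans (kComp_of_mem' hST (hX k hk))
  have h1 := dOne_eq_zero_of_mem hF (fun k hk => (h0 k hk).trans (h0 1 K.one_mem).symm) hZ
  have h2 : dOne n (fun g : G => P (AdL n g X)) Z = P (adL n G Z X) := dOne_clm_AdL P X Z
  have h3 : kComp hST ⁅Z, X⁆ = 0 :=
    (congrArg P (lie_eq_adL Z X)).trans (h2.symm.trans h1)
  have h4 := kComp_add_pComp hST ⁅Z, X⁆
  rw [h3, zero_add] at h4
  rw [← h4]
  exact pComp_mem hST _

section Connected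

variable [IsTopologicalGroup G] [CompactSpace G] [ConnectedSpace G]

lemma eq_of_rgrad_eq_zero {f : G → ℝ} (hf : ContMDiff (𝓡 n) 𝓘(ℝ, ℝ) ∞ f)
    (h : ∀ x v, rgrad n f x v = 0) (x : G) : f x = f 1 := by
  obtain ⟨C, -, hC⟩ := exists_bound (n := n) (G := G)
  have h1 := hC x ⟨f, hf.continuous⟩ hf
  have h2 : rgradC n ⟨f, hf.continuous⟩ hf = 0 := by
    ext y v
    exact h y v
  rw [h2, norm_zero (E := C(G, EuclideanSpace ℝ (Fin n) →L[ℝ] ℝ)), mul_zero] at h1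
  exact sub_eq_zero.1 (abs_nonpos_iff.1 h1)

/-- Bi-invariance says that `g ↦ Q(Ad g X, Ad g Y)` has zero gradient, so it is constant on the
connected group. -/
lemma clmTwo_AdL_of_biInvariant {Q : LinearMap.BilinForm ℝ (GroupLieAlgebra (𝓡 n) G)}
    (hQ : Q ∈ biInvariantForms (GroupLieAlgebra (𝓡 n) G)) (g : G)
    (X Y : EuclideanSpace ℝ (Fin n)) :
    clmTwo Q (AdL n g X) (AdL n g Y) = clmTwo Q X Y := by
  have h1 := eq_of_rgrad_eq_zero (contMDiff_two (G := G) (clmTwo Q) X Y) (fun x v => by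
    rw [rgrad_two]
    have := hQ.2 v (AdL n x X) (AdL n x Y)
    have e1 := lie_eq_adL (G := G) v (AdL n x X)
    have e2 := lie_eq_adL (G := G) v (AdL n x Y)
    change Q (adL n G v (AdL n x X)) (AdL n x Y) + Q (AdL n x X) (adL n G v (AdL n x Y)) = 0
    rw [← e1, ← e2]
    exact (congrArg (· + _) this).trans (neg_add_cancel _)) g
  refine h1.trans ?_
  rw [AdL_one]
  rfl

lemma biInvariant_Ad {Q : LinearMap.BilinForm ℝ (GroupLieAlgebra (𝓡 n) G)}
    (hQ : Q ∈ biInvariantForms (GroupLieAlgebra (𝓡 n) G)) (g : G)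
    (X Y : GroupLieAlgebra (𝓡 n) G) : Q (Ad n g X) (Ad n g Y) = Q X Y :=
  (congrArg₂ (fun a b => Q a b) (Ad_apply (n := n) g X) (Ad_apply (n := n) g Y)).trans
    (clmTwo_AdL_of_biInvariant hQ g X Y)

end Connected

end AdjointInvariance

/-! ### Invariant forms on `𝔭` as forms on `G/K` -/

section QuotientForms

variable {n : ℕ} {G : Type*} [TopologicalSpace G] [ChartedSpace (EuclideanSpace ℝ (Fin n)) G]
  [Group G] [LieGroup (𝓡 n) ∞ G]

lemma IsSmoothForm.contMDiff_apply {m : ℕ} {β : Form n G m} (hβ : IsSmoothForm β)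
    {v : Fin m → G → EuclideanSpace ℝ (Fin n)}
    (hv : ∀ i, ContMDiff (𝓡 n) 𝓘(ℝ, EuclideanSpace ℝ (Fin n)) ∞ (v i)) :
    ContMDiff (𝓡 n) 𝓘(ℝ, ℝ) ∞ (fun x => β x (fun i => v i x)) := by
  let b := EuclideanSpace.basisFun (Fin n) ℝ
  have e : ∀ x, β x (fun i => v i x) =
      ∑ r : Fin m → Fin n, (∏ i, v i x (r i)) * β x (fun i => b (r i)) := by
    intro x
    have h1 : (fun i => v i x) = fun i => ∑ j, v i x j • b j := by
      funext i
      exact (b.sum_repr (v i x)).symm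
    have h2 := (β x).toMultilinearMap.map_sum
      (g := fun i j => (v i x j • b j : EuclideanSpace ℝ (Fin n)))
    refine (congrArg (β x) h1).trans (h2.trans (Finset.sum_congr rfl fun r _ => ?_))
    exact (β x).toMultilinearMap.map_smul_univ (fun i => v i x (r i)) (fun i => b (r i))
  simp only [e]
  refine contMDiff_finsetSum fun r _ => ?_
  refine ContMDiff.mul (contMDiff_finsetProd fun i _ => ?_) (hβ _)
  exact (EuclideanSpace.proj (𝕜 := ℝ) (r i) : EuclideanSpace ℝ (Fin n) →L[ℝ] ℝ).contMDiff.comp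
    (hv i)

lemma isSmoothForm_leftInvariantForm {m : ℕ} (σ : GroupLieAlgebra (𝓡 n) G [⋀^Fin m]→ₗ[ℝ] ℝ) :
    IsSmoothForm (leftInvariantForm σ) := fun v => contMDiff_const (c := σ v)

lemma contMDiff_apply_Ad {m : ℕ} (σ : GroupLieAlgebra (𝓡 n) G [⋀^Fin m]→ₗ[ℝ] ℝ)
    (v : Fin m → GroupLieAlgebra (𝓡 n) G) :
    ContMDiff (𝓡 n) 𝓘(ℝ, ℝ) ∞ (fun g : G => σ fun i => Ad n g (v i)) := by
  have := (isSmoothForm_leftInvariantForm σ).contMDiff_apply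
    (v := fun i g => AdL n g (v i)) fun i => contMDiff_AdL_apply (v i)
  refine this.congr fun g => congrArg σ (funext fun i => Ad_apply g (v i))

variable {K : Subgroup G} {𝔭 : Submodule ℝ (GroupLieAlgebra (𝓡 n) G)}

lemma pComp_Ad (h : IsCompl (subgroupLieAlgebra n K) 𝔭) (h𝔭 : ∀ k ∈ K, ∀ X ∈ 𝔭, Ad n k X ∈ 𝔭)
    {k : G} (hk : k ∈ K) (X : GroupLieAlgebra (𝓡 n) G) :
    pComp h (Ad n k X) = Ad n k (pComp h X) := by
  conv_lhs => rw [← kComp_add_pComp h X]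
  rw [map_add, map_add, pComp_of_mem' h (Ad_mem_subgroupLieAlgebra hk (kComp_mem h X)),
    pComp_of_mem h (h𝔭 k hk _ (pComp_mem h X)), zero_add]

lemma lie_mem_subgroupLieAlgebra (h : IsCompl (subgroupLieAlgebra n K) 𝔭) :
    ∀ x ∈ subgroupLieAlgebra n K, ∀ y ∈ subgroupLieAlgebra n K, ⁅x, y⁆ ∈ subgroupLieAlgebra n K :=
  fun _ hx _ hy => lie_mem_of_Ad_mem h.symm (fun _ hk => Ad_mem_subgroupLieAlgebra hk hy) hx

lemma lie_mem_complement (h : IsCompl (subgroupLieAlgebra n K) 𝔭)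
    (h𝔭 : ∀ k ∈ K, ∀ X ∈ 𝔭, Ad n k X ∈ 𝔭) :
    ∀ x ∈ subgroupLieAlgebra n K, ∀ y ∈ 𝔭, ⁅x, y⁆ ∈ 𝔭 :=
  fun _ hx _ hy => lie_mem_of_Ad_mem h (fun _ hk => h𝔭 _ hk _ hy) hx

lemma isAdInvariant_threeForm [IsTopologicalGroup G] [CompactSpace G] [ConnectedSpace G]
    (h : IsCompl (subgroupLieAlgebra n K) 𝔭) (h𝔭 : ∀ k ∈ K, ∀ X ∈ 𝔭, Ad n k X ∈ 𝔭)
    (Q : biInvariantForms (GroupLieAlgebra (𝓡 n) G)) : IsAdInvariant K (threeForm h Q) := by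
  intro k hk v w hw
  rw [vec_three_eta v, vec_three_eta w, threeForm_apply, threeForm_apply]
  simp only [hw, ← Ad_lie, pComp_Ad h h𝔭 hk, biInvariant_Ad Q.2]

lemma isQuotientForm_hat (h : IsCompl (subgroupLieAlgebra n K) 𝔭)
    (h𝔭 : ∀ k ∈ K, ∀ X ∈ 𝔭, Ad n k X ∈ 𝔭) {m : ℕ} {α : 𝔭 [⋀^Fin m]→ₗ[ℝ] ℝ}
    (hα : IsAdInvariant K α) : IsQuotientForm K (leftInvariantForm (hat h α)) where
  smooth := isSmoothForm_leftInvariantForm _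
  horizontal x v := by
    rintro ⟨i, hi⟩
    exact α.map_coord_zero i (Subtype.ext (pComp_of_mem' h hi))
  equivariant k hk x v :=
    (hα k hk _ _ fun i => pComp_Ad h h𝔭 hk (v i)).symm

lemma isAdInvariant_of_Ad_eq {m : ℕ}
    {σ : GroupLieAlgebra (𝓡 n) G [⋀^Fin m]→ₗ[ℝ] ℝ}
    (hσ : ∀ k ∈ K, ∀ v, (σ fun i => Ad n k (v i)) = σ v) :
    IsAdInvariant K (σ.compLinearMap 𝔭.subtype) := by
  intro k hk v w hw
  refine (congrArg σ (funext hw)).trans (hσ k hk _)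

/-- Replace the arguments by their `𝔭`-components one at a time; each discarded `𝔨`-component
contributes zero by horizontality. -/
lemma hat_restrict_eq (h : IsCompl (subgroupLieAlgebra n K) 𝔭) {m : ℕ}
    {σ : GroupLieAlgebra (𝓡 n) G [⋀^Fin m]→ₗ[ℝ] ℝ}
    (hσ : ∀ v, (∃ i, v i ∈ subgroupLieAlgebra n K) → σ v = 0) :
    hat h (σ.compLinearMap 𝔭.subtype) = σ := by
  ext v
  change (σ fun i => pComp h (v i)) = σ v
  have key : ∀ s : Finset (Fin m), σ (s.piecewise (fun i => pComp h (v i)) v) = σ v := by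
    intro s
    induction s using Finset.induction_on with
    | empty => simp
    | insert a s ha ih =>
      rw [Finset.piecewise_insert, ← ih]
      conv_rhs => rw [← Function.update_eq_self a (s.piecewise (fun i => pComp h (v i)) v)]
      rw [Finset.piecewise_eq_of_notMem _ _ _ ha]
      conv_rhs => rw [← kComp_add_pComp h (v a)]
      have h0 : ∀ u : Fin m → GroupLieAlgebra (𝓡 n) G,
          σ (Function.update u a (kComp h (v a))) = 0 := fun u =>
        hσ _ ⟨a, by simpa using kComp_mem h (v a)⟩
      rw [σ.map_update_add, h0, zero_add]
  simpa using key Finset.univ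

lemma threeForm_mem_closedForms [IsTopologicalGroup G] [CompactSpace G] [ConnectedSpace G]
    (h : IsCompl (subgroupLieAlgebra n K) 𝔭) (h𝔭 : ∀ k ∈ K, ∀ X ∈ 𝔭, Ad n k X ∈ 𝔭)
    (Q : vanishingForms (subgroupLieAlgebra n K)) :
    leftInvariantForm (hat h (threeForm h Q.1)) ∈ closedForms (n := n) K 2 := by
  refine ⟨isQuotientForm_hat h h𝔭 (isAdInvariant_threeForm h h𝔭 Q.1), fun x v => ?_⟩
  rw [vec_four_eta v, extDer_leftInvariantForm_three]
  exact cartan_add_exact_closed Q.1.2 (mixedForm h Q.1.1)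
    (fun x y z => hat h (threeForm h Q.1) ![x, y, z])
    (hat_threeForm_apply h (lie_mem_subgroupLieAlgebra h) (lie_mem_complement h h𝔭) Q) _ _ _ _

end QuotientForms

/-- The alternating form `v ↦ M (F v)` for an `F` that is alternating in the sense of a separating
family of functionals. -/
def altOfSeparating {S ι L : Type*} [AddCommGroup S] [Module ℝ S] [AddCommGroup L] [Module ℝ L]
    {m : ℕ} (M : S →ₗ[ℝ] ℝ) (F : (Fin m → L) → S) (ev : ι → S →ₗ[ℝ] ℝ)
    (hev : ∀ s s', (∀ i, ev i s = ev i s') → s = s') (A : ι → L [⋀^Fin m]→ₗ[ℝ] ℝ)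
    (hA : ∀ v i, ev i (F v) = A i v) : L [⋀^Fin m]→ₗ[ℝ] ℝ where
  toFun v := M (F v)
  map_update_add' v i x y := by
    rw [← map_add]
    refine congrArg M (hev _ _ fun j => ?_)
    rw [map_add, hA, hA, hA, AlternatingMap.map_update_add]
  map_update_smul' v i c x := by
    rw [← map_smul]
    refine congrArg M (hev _ _ fun j => ?_)
    rw [map_smul, hA, hA, AlternatingMap.map_update_smul]
  map_eq_zero_of_eq' v i j hv hij := by
    rw [← map_zero M]
    refine congrArg M (hev _ _ fun k => ?_)
    rw [hA, map_zero, AlternatingMap.map_eq_zero_of_eq _ _ hv hij]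

/-! ### Averaging forms on `𝔤` over a compact group mapping to `G` -/

section Average

variable {n : ℕ} {G : Type*} [TopologicalSpace G] [ChartedSpace (EuclideanSpace ℝ (Fin n)) G]
  [Group G] [LieGroup (𝓡 n) ∞ G]

lemma Ad_mul (g h : G) (X : GroupLieAlgebra (𝓡 n) G) : Ad n (g * h) X = Ad n g (Ad n h X) := by
  refine (Ad_apply (g * h) X).trans ((AdL_mul_apply g h X).trans ?_)
  refine Eq.trans ?_ (congrArg (Ad n g) (Ad_apply h X)).symm
  exact (Ad_apply g _).symm

lemma Ad_one (X : GroupLieAlgebra (𝓡 n) G) : Ad n (1 : G) X = X := by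
  refine (Ad_apply 1 X).trans ?_
  rw [AdL_one]
  rfl

variable {H : Type*} [TopologicalSpace H] [Group H] [IsTopologicalGroup H] [CompactSpace H]

/-- The function `y ↦ σ (Ad y v)` on a compact group that maps to `G`. -/
def orbitFun (φ : H →* G) (hφ : Continuous φ) {m : ℕ}
    (σ : GroupLieAlgebra (𝓡 n) G [⋀^Fin m]→ₗ[ℝ] ℝ) (v : Fin m → GroupLieAlgebra (𝓡 n) G) :
    C(H, ℝ) :=
  ⟨fun y => σ fun i => Ad n (φ y) (v i), (contMDiff_apply_Ad σ v).continuous.comp hφ⟩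

/-- The average of a form on the Lie algebra over a compact group that maps to `G`. -/
def average (φ : H →* G) (hφ : Continuous φ) {m : ℕ}
    (σ : GroupLieAlgebra (𝓡 n) G [⋀^Fin m]→ₗ[ℝ] ℝ) : GroupLieAlgebra (𝓡 n) G [⋀^Fin m]→ₗ[ℝ] ℝ :=
  altOfSeparating (haarMean H).toLinearMap (orbitFun φ hφ σ)
    (fun y : H => (ContinuousMap.evalCLM ℝ y).toLinearMap) (fun _ _ h => ContinuousMap.ext h)
    (fun y => σ.compLinearMap (Ad n (φ y))) (fun _ _ => rfl)

lemma average_apply (φ : H →* G) (hφ : Continuous φ) {m : ℕ}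
    (σ : GroupLieAlgebra (𝓡 n) G [⋀^Fin m]→ₗ[ℝ] ℝ) (v : Fin m → GroupLieAlgebra (𝓡 n) G) :
    average φ hφ σ v = haarMean H (orbitFun φ hφ σ v) := rfl

/-- Acting by `Ad (φ y)` right-translates the orbit function by `y`, and the mean is
right-invariant. -/
lemma average_Ad (φ : H →* G) (hφ : Continuous φ) {m : ℕ}
    (σ : GroupLieAlgebra (𝓡 n) G [⋀^Fin m]→ₗ[ℝ] ℝ) (y : H)
    (v : Fin m → GroupLieAlgebra (𝓡 n) G) :
    (average φ hφ σ fun i => Ad n (φ y) (v i)) = average φ hφ σ v := by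
  rw [average_apply, average_apply, ← haarMean_mul_right (orbitFun φ hφ σ v) y]
  refine congrArg (haarMean H) (ContinuousMap.ext fun z => ?_)
  change (σ fun i => Ad n (φ z) (Ad n (φ y) (v i))) = σ fun i => Ad n (φ (z * y)) (v i)
  simp only [map_mul, Ad_mul]

lemma average_of_invariant (φ : H →* G) (hφ : Continuous φ) {m : ℕ}
    {σ : GroupLieAlgebra (𝓡 n) G [⋀^Fin m]→ₗ[ℝ] ℝ} {v : Fin m → GroupLieAlgebra (𝓡 n) G}
    (hσ : ∀ y : H, (σ fun i => Ad n (φ y) (v i)) = σ v) : average φ hφ σ v = σ v := by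
  rw [average_apply, ← haarMean_const (H := H) (σ v)]
  exact congrArg (haarMean H) (ContinuousMap.ext hσ)

/-- Averaging an exact `3`-form. -/
lemma average_exact (φ : H →* G) (hφ : Continuous φ)
    {c : GroupLieAlgebra (𝓡 n) G [⋀^Fin 3]→ₗ[ℝ] ℝ}
    {α : GroupLieAlgebra (𝓡 n) G [⋀^Fin 2]→ₗ[ℝ] ℝ}
    (hc : ∀ x y z, c ![x, y, z] = - α ![⁅x, y⁆, z] + α ![⁅x, z⁆, y] - α ![⁅y, z⁆, x])
    (x y z : GroupLieAlgebra (𝓡 n) G) :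
    average φ hφ c ![x, y, z] = - average φ hφ α ![⁅x, y⁆, z] + average φ hφ α ![⁅x, z⁆, y]
      - average φ hφ α ![⁅y, z⁆, x] := by
  simp only [average_apply]
  rw [← map_neg, ← map_add, ← map_sub]
  refine congrArg (haarMean H) (ContinuousMap.ext fun g => ?_)
  have e2 : ∀ a b, orbitFun φ hφ α ![a, b] g = α ![Ad n (φ g) a, Ad n (φ g) b] := fun a b => by
    refine congrArg α (funext fun i => ?_)
    fin_cases i <;> rfl
  have e3 : orbitFun φ hφ c ![x, y, z] g = c ![Ad n (φ g) x, Ad n (φ g) y, Ad n (φ g) z] := by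
    refine congrArg c (funext fun i => ?_)
    fin_cases i <;> rfl
  simp only [ContinuousMap.sub_apply, ContinuousMap.add_apply, ContinuousMap.neg_apply, e2, e3, hc,
    Ad_lie]

end Average

/-! ### Invariance under `Ad` differentiated at the identity -/

section LieAlgebraCohomology

variable {n : ℕ} {G : Type*} [TopologicalSpace G] [ChartedSpace (EuclideanSpace ℝ (Fin n)) G]
  [Group G] [LieGroup (𝓡 n) ∞ G]

lemma lie_invariant_two_of_subgroup {K : Subgroup G}
    {α : GroupLieAlgebra (𝓡 n) G [⋀^Fin 2]→ₗ[ℝ] ℝ}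
    (hα : ∀ k ∈ K, ∀ v, (α fun i => Ad n k (v i)) = α v) {Z : GroupLieAlgebra (𝓡 n) G}
    (hZ : Z ∈ subgroupLieAlgebra n K) (X Y : GroupLieAlgebra (𝓡 n) G) :
    α ![⁅Z, X⁆, Y] + α ![X, ⁅Z, Y⁆] = 0 := by
  have h1 : ∀ k ∈ K, (fun g : G => clmTwo (altTwo α) (AdL n g X) (AdL n g Y)) k =
      (fun g : G => clmTwo (altTwo α) (AdL n g X) (AdL n g Y)) 1 := by
    have : ∀ k ∈ K, clmTwo (altTwo α) (AdL n k X) (AdL n k Y) = α ![X, Y] := fun k hk => by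
      refine Eq.trans ?_ (hα k hk ![X, Y])
      refine congrArg α (funext fun i => ?_)
      fin_cases i
      · exact (Ad_apply (n := n) k X).symm
      · exact (Ad_apply (n := n) k Y).symm
    exact fun k hk => (this k hk).trans (this 1 K.one_mem).symm
  have h2 := dOne_eq_zero_of_mem (contMDiff_two (clmTwo (altTwo α)) X Y) h1 hZ
  rw [← rgrad_one] at h2
  have h3 := (rgrad_two (G := G) (clmTwo (altTwo α)) 1 X Y Z).symm.trans h2
  rw [AdL_one] at h3
  have e1 := lie_eq_adL Z X
  have e2 := lie_eq_adL Z Y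
  change altTwo α ⁅Z, X⁆ Y + altTwo α X ⁅Z, Y⁆ = 0
  rw [e1, e2]
  exact h3

lemma lie_invariant_two {α : GroupLieAlgebra (𝓡 n) G [⋀^Fin 2]→ₗ[ℝ] ℝ}
    (hα : ∀ (g : G) v, (α fun i => Ad n g (v i)) = α v) (Z X Y : GroupLieAlgebra (𝓡 n) G) :
    α ![⁅Z, X⁆, Y] + α ![X, ⁅Z, Y⁆] = 0 := by
  have h1 : (fun g : G => clmTwo (altTwo α) (AdL n g X) (AdL n g Y)) = fun _ => α ![X, Y] := by
    funext k
    refine Eq.trans ?_ (hα k ![X, Y])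
    refine congrArg α (funext fun i => ?_)
    fin_cases i
    · exact (Ad_apply (n := n) k X).symm
    · exact (Ad_apply (n := n) k Y).symm
  have h3 := (rgrad_two (G := G) (clmTwo (altTwo α)) 1 X Y Z).symm.trans (by
    rw [rgrad_one, h1, dOne_const])
  rw [AdL_one] at h3
  have e1 := lie_eq_adL Z X
  have e2 := lie_eq_adL Z Y
  change altTwo α ⁅Z, X⁆ Y + altTwo α X ⁅Z, Y⁆ = 0
  rw [e1, e2]
  exact h3

lemma lie_invariant_three {c : GroupLieAlgebra (𝓡 n) G [⋀^Fin 3]→ₗ[ℝ] ℝ}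
    (hc : ∀ (g : G) v, (c fun i => Ad n g (v i)) = c v) (W X Y Z : GroupLieAlgebra (𝓡 n) G) :
    c ![⁅W, X⁆, Y, Z] + c ![X, ⁅W, Y⁆, Z] + c ![X, Y, ⁅W, Z⁆] = 0 := by
  have h1 : (fun g : G => clmThree (altThree c) (AdL n g X) (AdL n g Y) (AdL n g Z)) =
      fun _ => c ![X, Y, Z] := by
    funext k
    refine Eq.trans ?_ (hc k ![X, Y, Z])
    refine congrArg c (funext fun i => ?_)
    fin_cases i
    · exact (Ad_apply (n := n) k X).symm
    · exact (Ad_apply (n := n) k Y).symm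
    · exact (Ad_apply (n := n) k Z).symm
  have h3 := (rgrad_three (G := G) (clmThree (altThree c)) 1 X Y Z W).symm.trans (by
    rw [rgrad_one, h1, dOne_const])
  rw [AdL_one] at h3
  have e1 := lie_eq_adL W X
  have e2 := lie_eq_adL W Y
  have e3 := lie_eq_adL W Z
  change altThree c ⁅W, X⁆ Y Z + altThree c X ⁅W, Y⁆ Z + altThree c X Y ⁅W, Z⁆ = 0
  rw [e1, e2, e3]
  exact h3

/-- Such an `α` vanishes on brackets by `invariant_two_form_apply_lie`, and brackets span a
semisimple algebra. -/
lemma eq_zero_of_invariant_two [LieAlgebra.IsSemisimple ℝ (GroupLieAlgebra (𝓡 n) G)]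
    {α : GroupLieAlgebra (𝓡 n) G [⋀^Fin 2]→ₗ[ℝ] ℝ}
    (hα : ∀ (g : G) v, (α fun i => Ad n g (v i)) = α v) : α = 0 := by
  ext v
  rw [vec_two_eta v]
  have h1 : (altTwo α).flip (v 1) = 0 := eq_zero_of_forall_lie _ fun x y =>
    invariant_two_form_apply_lie (altTwo_swap α) (lie_invariant_two hα) x y (v 1)
  exact LinearMap.congr_fun h1 (v 0)

end LieAlgebraCohomology

/-! ### Closed forms on `𝔤` modulo exact ones, by averaging over `G` -/

section CompactGroup

variable {n : ℕ} {G : Type*} [TopologicalSpace G] [ChartedSpace (EuclideanSpace ℝ (Fin n)) G]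
  [Group G] [LieGroup (𝓡 n) ∞ G] [IsTopologicalGroup G] [CompactSpace G] [ConnectedSpace G]

variable (n G) in
/-- The average over the group itself. -/
abbrev average₁ {m : ℕ} (σ : GroupLieAlgebra (𝓡 n) G [⋀^Fin m]→ₗ[ℝ] ℝ) :
    GroupLieAlgebra (𝓡 n) G [⋀^Fin m]→ₗ[ℝ] ℝ := average (MonoidHom.id G) continuous_id σ

lemma contMDiff_clm_of_apply {F : G → EuclideanSpace ℝ (Fin n) →L[ℝ] ℝ}
    (hF : ∀ e, ContMDiff (𝓡 n) 𝓘(ℝ, ℝ) ∞ fun g => F g e) :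
    ContMDiff (𝓡 n) 𝓘(ℝ, EuclideanSpace ℝ (Fin n) →L[ℝ] ℝ) ∞ F := by
  let b := EuclideanSpace.basisFun (Fin n) ℝ
  have e : F = fun g => ∑ j, F g (b j) •
      (EuclideanSpace.proj (𝕜 := ℝ) j : EuclideanSpace ℝ (Fin n) →L[ℝ] ℝ) := by
    funext g
    ext v
    conv_lhs => rw [← b.sum_repr v, map_sum]
    simp [b, mul_comm]
  rw [e]
  exact contMDiff_finsetSum fun j _ => (hF (b j)).smul contMDiff_const

/-- Evaluation of alternating forms. -/
def evalAlt {L : Type*} [AddCommGroup L] [Module ℝ L] {m : ℕ} (v : Fin m → L) :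
    (L [⋀^Fin m]→ₗ[ℝ] ℝ) →ₗ[ℝ] ℝ where
  toFun f := f v
  map_add' _ _ := rfl
  map_smul' _ _ := rfl

/-- Evaluation of a continuous family of linear forms. -/
def evalCC (i : G × EuclideanSpace ℝ (Fin n)) : C(G, EuclideanSpace ℝ (Fin n) →L[ℝ] ℝ) →ₗ[ℝ] ℝ where
  toFun f := f i.1 i.2
  map_add' _ _ := rfl
  map_smul' _ _ := rfl

lemma evalCC_separating (f f' : C(G, EuclideanSpace ℝ (Fin n) →L[ℝ] ℝ))
    (h : ∀ i, evalCC i f = evalCC i f') : f = f' := by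
  ext g v
  exact h (g, v)

lemma rgrad_three_orbit (c : GroupLieAlgebra (𝓡 n) G [⋀^Fin 3]→ₗ[ℝ] ℝ) (g : G)
    (X Y Z v : GroupLieAlgebra (𝓡 n) G) :
    rgrad n (fun g : G => c fun i => Ad n g (![X, Y, Z] i)) g v =
      c ![⁅v, Ad n g X⁆, Ad n g Y, Ad n g Z] + c ![Ad n g X, ⁅v, Ad n g Y⁆, Ad n g Z]
        + c ![Ad n g X, Ad n g Y, ⁅v, Ad n g Z⁆] := by
  have e : (fun g : G => c fun i => Ad n g (![X, Y, Z] i)) =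
      fun g : G => clmThree (altThree c) (AdL n g X) (AdL n g Y) (AdL n g Z) := by
    funext g
    refine congrArg c (funext fun i => ?_)
    fin_cases i
    · exact Ad_apply (n := n) g X
    · exact Ad_apply (n := n) g Y
    · exact Ad_apply (n := n) g Z
  rw [e]
  refine (rgrad_three (G := G) (clmThree (altThree c)) g X Y Z v).trans ?_
  have e1 : ⁅v, Ad n g X⁆ = adL n G v (AdL n g X) :=
    (lie_eq_adL _ _).trans (congrArg (adL n G v) (Ad_apply (n := n) g X))
  have e2 : ⁅v, Ad n g Y⁆ = adL n G v (AdL n g Y) :=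
    (lie_eq_adL _ _).trans (congrArg (adL n G v) (Ad_apply (n := n) g Y))
  have e3 : ⁅v, Ad n g Z⁆ = adL n G v (AdL n g Z) :=
    (lie_eq_adL _ _).trans (congrArg (adL n G v) (Ad_apply (n := n) g Z))
  rw [e1, e2, e3]
  have f1 := Ad_apply (n := n) g X
  have f2 := Ad_apply (n := n) g Y
  have f3 := Ad_apply (n := n) g Z
  rw [f1, f2, f3]
  rfl

variable [LieAlgebra.IsSemisimple ℝ (GroupLieAlgebra (𝓡 n) G)]

lemma average₁_two (α : GroupLieAlgebra (𝓡 n) G [⋀^Fin 2]→ₗ[ℝ] ℝ) : average₁ n G α = 0 :=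
  eq_zero_of_invariant_two fun g v => average_Ad (MonoidHom.id G) continuous_id α g v

/-- The first derivative of an orbit function of a closed `2`-form. -/
lemma rgrad_two_of_closed
    {s : GroupLieAlgebra (𝓡 n) G →ₗ[ℝ] GroupLieAlgebra (𝓡 n) G →ₗ[ℝ] ℝ} (hs : ∀ x, s x x = 0)
    (hd : ∀ x y z : GroupLieAlgebra (𝓡 n) G, s ⁅x, y⁆ z + s ⁅y, z⁆ x + s ⁅z, x⁆ y = 0) (g : G)
    (x y v : EuclideanSpace ℝ (Fin n)) :
    rgrad n (fun g : G => clmTwo s (AdL n g x) (AdL n g y)) g v =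
      clmTwo s v (AdL n g (adL n G x y)) := by
  rw [rgrad_two, AdL_adL]
  set X := AdL n g x
  set Y := AdL n g y
  have skew : ∀ a b : GroupLieAlgebra (𝓡 n) G, s a b = - s b a := fun a b => by
    have := hs (a + b)
    simp only [map_add, LinearMap.add_apply, hs] at this
    linarith
  have e1 := lie_eq_adL (G := G) v X
  have e2 := lie_eq_adL (G := G) v Y
  have e3 := lie_eq_adL (G := G) X Y
  change s (adL n G v X) Y + s X (adL n G v Y) = s v (adL n G X Y)
  rw [← e1, ← e2, ← e3]
  have key : ∀ X Y v : GroupLieAlgebra (𝓡 n) G, s ⁅v, X⁆ Y + s X ⁅v, Y⁆ = s v ⁅X, Y⁆ := by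
    intro X Y v
    have h1 := hd v X Y
    rw [← lie_skew Y v, map_neg, LinearMap.neg_apply] at h1 
    linarith [skew X ⁅v, Y⁆, skew v ⁅X, Y⁆]
  exact key X Y v

/-- Apply `transfer` to `f(g) = s(Ad g x, Ad g y)`. Its mean vanishes since averaged 2-forms do, and
its gradient depends linearly on `[x, y]` by closedness. So `-s(x, y) = -f 1 = T(∇f)` is a linear
function of `[x, y]`. -/
lemma exists_primitive_two
    (s : GroupLieAlgebra (𝓡 n) G →ₗ[ℝ] GroupLieAlgebra (𝓡 n) G →ₗ[ℝ] ℝ) (hs : ∀ x, s x x = 0)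
    (hd : ∀ x y z : GroupLieAlgebra (𝓡 n) G, s ⁅x, y⁆ z + s ⁅y, z⁆ x + s ⁅z, x⁆ y = 0) :
    ∃ θ : GroupLieAlgebra (𝓡 n) G →ₗ[ℝ] ℝ, ∀ x y : GroupLieAlgebra (𝓡 n) G, s x y = θ ⁅x, y⁆ := by
  let Ψ : EuclideanSpace ℝ (Fin n) → C(G, EuclideanSpace ℝ (Fin n) →L[ℝ] ℝ) := fun w =>
    ⟨fun g => (clmTwo s).flip (AdL n g w), (clmTwo s).flip.continuous.comp
      (contMDiff_AdL_apply w).continuous⟩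
  let θ : EuclideanSpace ℝ (Fin n) →ₗ[ℝ] ℝ :=
    { toFun := fun w => - transfer n G (Ψ w)
      map_add' := fun w w' => by
        rw [← neg_add, ← map_add]
        congr 2
        ext g
        simp [Ψ]
      map_smul' := fun c w => by
        rw [RingHom.id_apply, smul_neg, ← map_smul]
        congr 2
        ext g
        simp [Ψ] }
  have key : ∀ x y : EuclideanSpace ℝ (Fin n), s x y = θ (adL n G x y) := by
    intro x y
    have hf := contMDiff_two (G := G) (clmTwo s) x y
    have h1 := transfer_rgradC (n := n) ⟨_, hf.continuous⟩ hf
    have h2 : rgradC n ⟨_, hf.continuous⟩ hf = Ψ (adL n G x y) := by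
      ext g v
      exact rgrad_two_of_closed hs hd g x y v
    have h3 : haarMean G ⟨_, hf.continuous⟩ = 0 := by
      have h4 : average₁ n G (mkAltTwo s hs) ![x, y] = 0 := by rw [average₁_two]; rfl
      rw [← h4, average_apply]
      refine congrArg (haarMean G) (ContinuousMap.ext fun g => ?_)
      have e1 := Ad_apply (n := n) g x
      have e2 := Ad_apply (n := n) g y
      exact (congrArg₂ (fun a b => s a b) e1 e2).symm
    rw [h2, h3] at h1
    have h5 : s x y = clmTwo s (AdL n (1 : G) x) (AdL n (1 : G) y) := by rw [AdL_one]; rfl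
    change s x y = - transfer n G (Ψ (adL n G x y))
    rw [h1, h5]
    simp
  exact ⟨θ, fun x y => (key x y).trans (congrArg θ (lie_eq_adL x y).symm)⟩

/-- A form on the Lie algebra contracted with an orbit in all but the first argument. -/
def contractC {m : ℕ} (c : GroupLieAlgebra (𝓡 n) G [⋀^Fin (m + 1)]→ₗ[ℝ] ℝ)
    (v : Fin m → GroupLieAlgebra (𝓡 n) G) : C(G, EuclideanSpace ℝ (Fin n) →L[ℝ] ℝ) :=
  ⟨fun g => LinearMap.toContinuousLinearMap (E := EuclideanSpace ℝ (Fin n))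
      (evalAlt (fun i => Ad n g (v i)) ∘ₗ c.curryLeft),
    (contMDiff_clm_of_apply fun e => contMDiff_apply_Ad (c.curryLeft e) v).continuous⟩

/-- The homotopy operator on forms on the Lie algebra. -/
def liePrimitive {m : ℕ} (c : GroupLieAlgebra (𝓡 n) G [⋀^Fin (m + 1)]→ₗ[ℝ] ℝ) :
    GroupLieAlgebra (𝓡 n) G [⋀^Fin m]→ₗ[ℝ] ℝ :=
  altOfSeparating (transfer n G).toLinearMap (contractC c) evalCC evalCC_separating
    (fun i : G × EuclideanSpace ℝ (Fin n) => (c.curryLeft i.2).compLinearMap (Ad n i.1))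
    fun _ _ => rfl

lemma liePrimitive_apply {m : ℕ} (c : GroupLieAlgebra (𝓡 n) G [⋀^Fin (m + 1)]→ₗ[ℝ] ℝ)
    (v : Fin m → GroupLieAlgebra (𝓡 n) G) :
    liePrimitive c v = transfer n G (contractC c v) := rfl

/-- The gradient of the orbit function is the Lie derivative of `c` along `v`. For closed `c` this
is `d(ι_v c)`, up to the sign convention of the bracket terms. -/
lemma rgrad_orbit_of_closed (c : GroupLieAlgebra (𝓡 n) G [⋀^Fin 3]→ₗ[ℝ] ℝ)
    (hc : ∀ W X Y Z : GroupLieAlgebra (𝓡 n) G, - c ![⁅W, X⁆, Y, Z] + c ![⁅W, Y⁆, X, Z]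
      - c ![⁅W, Z⁆, X, Y] - c ![⁅X, Y⁆, W, Z] + c ![⁅X, Z⁆, W, Y] - c ![⁅Y, Z⁆, W, X] = 0)
    (X Y Z : GroupLieAlgebra (𝓡 n) G) (g : G) (v : GroupLieAlgebra (𝓡 n) G) :
    rgrad n (fun g : G => c fun i => Ad n g (![X, Y, Z] i)) g v =
      (contractC c ![⁅X, Y⁆, Z] - contractC c ![⁅X, Z⁆, Y] + contractC c ![⁅Y, Z⁆, X]) g v := by
  have e : ∀ A B : GroupLieAlgebra (𝓡 n) G,
      contractC c ![A, B] g v = c ![v, Ad n g A, Ad n g B] := fun A B => by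
    refine congrArg c (funext fun i => ?_)
    fin_cases i <;> rfl
  have h5 : (contractC c ![⁅X, Y⁆, Z] - contractC c ![⁅X, Z⁆, Y] + contractC c ![⁅Y, Z⁆, X]) g v
      = c ![v, ⁅Ad n g X, Ad n g Y⁆, Ad n g Z] - c ![v, ⁅Ad n g X, Ad n g Z⁆, Ad n g Y]
        + c ![v, ⁅Ad n g Y, Ad n g Z⁆, Ad n g X] := by
    rw [← Ad_lie, ← Ad_lie, ← Ad_lie, ← e, ← e, ← e]
    rfl
  refine (rgrad_three_orbit c g X Y Z v).trans (Eq.trans ?_ h5.symm)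
  have h4 := hc v (Ad n g X) (Ad n g Y) (Ad n g Z)
  have s1 := altThree_swap_left c
  have s2 := altThree_swap_right c
  simp only [← altThree_apply] at h4 ⊢
  generalize Ad n g X = X at *
  generalize Ad n g Y = Y at *
  generalize Ad n g Z = Z at *
  linarith [s1 X ⁅v, Y⁆ Z, s2 X Y ⁅v, Z⁆, s1 X ⁅v, Z⁆ Y, s1 v ⁅X, Y⁆ Z, s1 v ⁅X, Z⁆ Y,
    s1 v ⁅Y, Z⁆ X]

/-- Applying `transfer` to `rgrad_orbit_of_closed` exhibits the average minus `c` as the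
differential of `-liePrimitive c`. -/
lemma average₁_sub_of_closed (c : GroupLieAlgebra (𝓡 n) G [⋀^Fin 3]→ₗ[ℝ] ℝ)
    (hc : ∀ W X Y Z : GroupLieAlgebra (𝓡 n) G, - c ![⁅W, X⁆, Y, Z] + c ![⁅W, Y⁆, X, Z]
      - c ![⁅W, Z⁆, X, Y] - c ![⁅X, Y⁆, W, Z] + c ![⁅X, Z⁆, W, Y] - c ![⁅Y, Z⁆, W, X] = 0)
    (X Y Z : GroupLieAlgebra (𝓡 n) G) :
    average₁ n G c ![X, Y, Z] - c ![X, Y, Z] = liePrimitive c ![⁅X, Y⁆, Z]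
      - liePrimitive c ![⁅X, Z⁆, Y] + liePrimitive c ![⁅Y, Z⁆, X] := by
  have hf := contMDiff_apply_Ad c ![X, Y, Z]
  have h1 := transfer_rgradC (n := n) ⟨_, hf.continuous⟩ hf
  have h2 : rgradC n ⟨_, hf.continuous⟩ hf = contractC c ![⁅X, Y⁆, Z] - contractC c ![⁅X, Z⁆, Y]
      + contractC c ![⁅Y, Z⁆, X] := by
    ext g v
    exact rgrad_orbit_of_closed c hc X Y Z g v
  rw [h2, map_add, map_sub] at h1
  rw [liePrimitive_apply, liePrimitive_apply, liePrimitive_apply, h1]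
  refine congrArg₂ _ rfl ?_
  change c ![X, Y, Z] = c fun i => Ad n (1 : G) (![X, Y, Z] i)
  simp only [Ad_one]

lemma exists_biInvariant_add_exact (c : GroupLieAlgebra (𝓡 n) G [⋀^Fin 3]→ₗ[ℝ] ℝ)
    (hc : ∀ W X Y Z : GroupLieAlgebra (𝓡 n) G, - c ![⁅W, X⁆, Y, Z] + c ![⁅W, Y⁆, X, Z]
      - c ![⁅W, Z⁆, X, Y] - c ![⁅X, Y⁆, W, Z] + c ![⁅X, Z⁆, W, Y] - c ![⁅Y, Z⁆, W, X] = 0) :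
    ∃ q ∈ biInvariantForms (GroupLieAlgebra (𝓡 n) G),
      ∃ α : GroupLieAlgebra (𝓡 n) G [⋀^Fin 2]→ₗ[ℝ] ℝ, ∀ X Y Z : GroupLieAlgebra (𝓡 n) G,
        c ![X, Y, Z] = q ⁅X, Y⁆ Z - α ![⁅X, Y⁆, Z] + α ![⁅X, Z⁆, Y] - α ![⁅Y, Z⁆, X] := by
  have hA : ∀ (g : G) v, ((average₁ n G c) fun i => Ad n g (v i)) = average₁ n G c v :=
    fun g v => average_Ad (MonoidHom.id G) continuous_id c g v
  obtain ⟨q, hq, h⟩ := exists_biInvariant_of_invariant_three_form (t := altThree (average₁ n G c))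
    eq_zero_of_forall_lie exists_primitive_two (altThree_swap_left _) (altThree_swap_right _)
    (lie_invariant_three hA)
  refine ⟨q, hq, liePrimitive c, fun X Y Z => ?_⟩
  have h1 := average₁_sub_of_closed c hc X Y Z
  have h2 := h X Y Z
  rw [altThree_apply] at h2
  linarith

/-- Averaging over `G` fixes the invariant form `q([·,·],·)` and kills its primitive, so `q`
vanishes on all brackets. -/
lemma biInvariant_eq_zero_of_exact {q : LinearMap.BilinForm ℝ (GroupLieAlgebra (𝓡 n) G)}
    (hq : q ∈ biInvariantForms (GroupLieAlgebra (𝓡 n) G))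
    (α : GroupLieAlgebra (𝓡 n) G [⋀^Fin 2]→ₗ[ℝ] ℝ)
    {c : GroupLieAlgebra (𝓡 n) G [⋀^Fin 3]→ₗ[ℝ] ℝ} (hcq : ∀ X Y Z, c ![X, Y, Z] = q ⁅X, Y⁆ Z)
    (h : ∀ X Y Z : GroupLieAlgebra (𝓡 n) G,
      q ⁅X, Y⁆ Z = - α ![⁅X, Y⁆, Z] + α ![⁅X, Z⁆, Y] - α ![⁅Y, Z⁆, X]) : q = 0 := by
  have h1 : ∀ X Y Z : GroupLieAlgebra (𝓡 n) G, q ⁅X, Y⁆ Z = 0 := by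
    intro X Y Z
    have h2 : average₁ n G c ![X, Y, Z] = - average₁ n G α ![⁅X, Y⁆, Z]
        + average₁ n G α ![⁅X, Z⁆, Y] - average₁ n G α ![⁅Y, Z⁆, X] :=
      average_exact (MonoidHom.id G) continuous_id (c := c) (α := α)
      (fun X Y Z => (hcq X Y Z).trans (h X Y Z)) X Y Z
    have h3 : average₁ n G α = 0 := average₁_two α
    have h4 : average₁ n G c ![X, Y, Z] = c ![X, Y, Z] := by
      refine average_of_invariant (MonoidHom.id G) continuous_id fun g => ?_
      rw [hcq, ← biInvariant_Ad hq g, Ad_lie, ← hcq]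
      refine congrArg c (funext fun i => ?_)
      fin_cases i <;> rfl
    rw [h3] at h2
    rw [← hcq, ← h4, h2]
    simp
  ext X Z
  exact LinearMap.congr_fun (eq_zero_of_forall_lie (q.flip Z) fun x y => h1 x y Z) X

end CompactGroup

/-! ### Closed invariant 3-forms on `G/K` modulo invariant exact ones -/

section InvariantRepresentatives

/-- The alternating `3`-form `Q([x, y], z)`. -/
def cartanForm {L : Type*} [LieRing L] [LieAlgebra ℝ L] (Q : biInvariantForms L) :
    L [⋀^Fin 3]→ₗ[ℝ] ℝ :=
  -- For `𝔨 = 0`, `𝔭 = 𝔤` the projections to `𝔭` are identities and `H_Q` is `4 - 3 = 1` times the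
  -- desired form, so alternation is inherited.
  hat isCompl_bot_top (threeForm isCompl_bot_top Q)

lemma cartanForm_apply {L : Type*} [LieRing L] [LieAlgebra ℝ L] (Q : biInvariantForms L)
    (x y z : L) : cartanForm Q ![x, y, z] = Q.1 ⁅x, y⁆ z := by
  have e : ∀ x : L, pComp (isCompl_bot_top (α := Submodule ℝ L)) x = x := fun x =>
    pComp_of_mem _ Submodule.mem_top
  rw [cartanForm, hat_apply]
  change 4 * Q.1 ⁅pComp _ x, pComp _ y⁆ (pComp _ z)
    - Q.1 (pComp _ ⁅pComp _ x, pComp _ y⁆) (pComp _ z)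
      + Q.1 (pComp _ ⁅pComp _ x, pComp _ z⁆) (pComp _ y)
      - Q.1 (pComp _ ⁅pComp _ y, pComp _ z⁆) (pComp _ x) = _
  simp only [e]
  have h1 := biInv_lie Q.2 x y z
  have h2 := biInv_symm Q.2 x ⁅y, z⁆
  have h3 := biInv_lie Q.2 x z y
  have h4 := biInv_symm Q.2 x ⁅z, y⁆
  rw [← lie_skew z y, map_neg] at h3
  linarith

section Linearity

variable {L : Type*} [LieRing L] [LieAlgebra ℝ L] {𝔨 𝔭 : Submodule ℝ L}

lemma threeForm_add (h : IsCompl 𝔨 𝔭) (P Q : biInvariantForms L) :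
    threeForm h (P + Q) = threeForm h P + threeForm h Q := by
  have e : ∀ x y, (P + Q).1 x y = P.1 x y + Q.1 x y := fun _ _ => rfl
  ext v
  rw [AlternatingMap.add_apply, vec_three_eta v, threeForm_apply, threeForm_apply,
    threeForm_apply]
  simp only [e]
  ring

lemma threeForm_smul (h : IsCompl 𝔨 𝔭) (c : ℝ) (Q : biInvariantForms L) :
    threeForm h (c • Q) = c • threeForm h Q := by
  have e : ∀ x y, (c • Q).1 x y = c * Q.1 x y := fun _ _ => rfl
  ext v
  rw [AlternatingMap.smul_apply, vec_three_eta v, threeForm_apply, threeForm_apply]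
  simp only [e, smul_eq_mul]
  ring

end Linearity

variable {n : ℕ} {G : Type*} [TopologicalSpace G] [ChartedSpace (EuclideanSpace ℝ (Fin n)) G]
  [Group G] [LieGroup (𝓡 n) ∞ G] [IsTopologicalGroup G] [CompactSpace G] [ConnectedSpace G]
  {K : Subgroup G} {𝔭 : Submodule ℝ (GroupLieAlgebra (𝓡 n) G)}

lemma closed_iff_leftInvariantForm {c : GroupLieAlgebra (𝓡 n) G [⋀^Fin 3]→ₗ[ℝ] ℝ}
    (hc : ∀ x v, extDer (leftInvariantForm c) x v = 0) (W X Y Z : GroupLieAlgebra (𝓡 n) G) :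
    - c ![⁅W, X⁆, Y, Z] + c ![⁅W, Y⁆, X, Z] - c ![⁅W, Z⁆, X, Y] - c ![⁅X, Y⁆, W, Z]
      + c ![⁅X, Z⁆, W, Y] - c ![⁅Y, Z⁆, W, X] = 0 :=
  (extDer_leftInvariantForm_three c 1 W X Y Z).symm.trans (hc 1 _)

variable [LieAlgebra.IsSemisimple ℝ (GroupLieAlgebra (𝓡 n) G)]

/-- The primitive `α` produced on `𝔤` need not be `K`-invariant. Averaging over `K` makes it so, and
then its values on `𝔨` are forced by `primitive_apply_of_mem`. -/
lemma exists_threeForm_add_exact (hK : IsClosed (K : Set G))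
    (h : IsCompl (subgroupLieAlgebra n K) 𝔭) (h𝔭 : ∀ k ∈ K, ∀ X ∈ 𝔭, Ad n k X ∈ 𝔭)
    {H : 𝔭 [⋀^Fin 3]→ₗ[ℝ] ℝ} (hH : IsAdInvariant K H)
    (hcl : ∀ x v, extDer (leftInvariantForm (hat h H)) x v = 0) :
    ∃ Q : vanishingForms (subgroupLieAlgebra n K), ∃ β : 𝔭 [⋀^Fin 2]→ₗ[ℝ] ℝ,
      IsAdInvariant K β ∧ ∀ (x : G) v,
        hat h H v = hat h (threeForm h Q.1) v + extDer (leftInvariantForm (hat h β)) x v := by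
  obtain ⟨q, hq, α, hα⟩ := exists_biInvariant_add_exact (hat h H) (closed_iff_leftInvariantForm hcl)
  have : CompactSpace K := isCompact_iff_compactSpace.1 hK.isCompact
  have hφ : Continuous K.subtype := continuous_subtype_val
  -- This difference is `K`-invariant and equals `dα`, so it is unchanged when `α` is replaced by
  -- its `K`-average.
  let c : GroupLieAlgebra (𝓡 n) G [⋀^Fin 3]→ₗ[ℝ] ℝ := hat h H - cartanForm ⟨q, hq⟩
  have hc : ∀ X Y Z : GroupLieAlgebra (𝓡 n) G,
      c ![X, Y, Z] = - α ![⁅X, Y⁆, Z] + α ![⁅X, Z⁆, Y] - α ![⁅Y, Z⁆, X] := by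
    intro X Y Z
    have : c ![X, Y, Z] = hat h H ![X, Y, Z] - q ⁅X, Y⁆ Z :=
      congrArg (hat h H ![X, Y, Z] - ·) (cartanForm_apply ⟨q, hq⟩ X Y Z)
    rw [this, hα]
    ring
  have hcinv : ∀ (k : K) v, (c fun i => Ad n (K.subtype k) (v i)) = c v := by
    intro k v
    have h1 : (hat h H fun i => Ad n (k : G) (v i)) = hat h H v :=
      hH k k.2 _ _ fun i => pComp_Ad h h𝔭 k.2 (v i)
    have h2 : (cartanForm ⟨q, hq⟩ fun i => Ad n (k : G) (v i)) = cartanForm ⟨q, hq⟩ v := by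
      rw [vec_three_eta v, cartanForm_apply, ← biInvariant_Ad hq (k : G), Ad_lie,
        ← cartanForm_apply ⟨q, hq⟩]
      refine congrArg _ (funext fun i => ?_)
      fin_cases i <;> rfl
    exact congrArg₂ (· - ·) h1 h2
  set α' := average K.subtype hφ α with hα'
  have hα'inv : ∀ k ∈ K, ∀ v, (α' fun i => Ad n k (v i)) = α' v := fun k hk v =>
    average_Ad K.subtype hφ α ⟨k, hk⟩ v
  have hdec : ∀ X Y Z : GroupLieAlgebra (𝓡 n) G, hat h H ![X, Y, Z] =
      q ⁅X, Y⁆ Z - α' ![⁅X, Y⁆, Z] + α' ![⁅X, Z⁆, Y] - α' ![⁅Y, Z⁆, X] := by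
    intro X Y Z
    have h1 := average_exact K.subtype hφ hc X Y Z
    rw [average_of_invariant K.subtype hφ fun k => hcinv k _] at h1
    have : c ![X, Y, Z] = hat h H ![X, Y, Z] - q ⁅X, Y⁆ Z :=
      congrArg (hat h H ![X, Y, Z] - ·) (cartanForm_apply ⟨q, hq⟩ X Y Z)
    rw [this] at h1
    linarith
  have hZ : ∀ Z ∈ subgroupLieAlgebra n K, ∀ W, α' ![Z, W] = - q Z W := fun Z hZ W =>
    primitive_apply_of_mem h eq_zero_of_forall_lie hq hdec
      (fun Z hZ X Y => lie_invariant_two_of_subgroup hα'inv hZ X Y) hZ W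
  have hQ : (⟨q, hq⟩ : biInvariantForms _) ∈ vanishingForms (subgroupLieAlgebra n K) :=
    mem_vanishingForms_iff.2 (vanishing_of_primitive hq hZ)
  refine ⟨⟨⟨q, hq⟩, hQ⟩, α'.compLinearMap 𝔭.subtype, isAdInvariant_of_Ad_eq hα'inv, fun x v => ?_⟩
  rw [vec_three_eta v, extDer_leftInvariantForm_two, hdec,
    hat_threeForm_apply h (lie_mem_subgroupLieAlgebra h) (lie_mem_complement h h𝔭)
      ⟨⟨q, hq⟩, hQ⟩]
  simp only [primitive_eq_mixedForm_add_hat h hq hZ]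
  ring

/-- Since the pullback of `H_Q` is `Q([·,·],·) + dα_Q`, exactness of `H_Q` makes `Q([·,·],·)` equal
to `d(α - α_Q)`. The primitive need not come from `G/K`. -/
lemma eq_zero_of_threeForm_exact (h : IsCompl (subgroupLieAlgebra n K) 𝔭)
    (h𝔭 : ∀ k ∈ K, ∀ X ∈ 𝔭, Ad n k X ∈ 𝔭) (Q : vanishingForms (subgroupLieAlgebra n K))
    (α : GroupLieAlgebra (𝓡 n) G [⋀^Fin 2]→ₗ[ℝ] ℝ)
    (hQ : ∀ (x : G) v, hat h (threeForm h Q.1) v = extDer (leftInvariantForm α) x v) : Q = 0 := by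
  refine Subtype.ext (Subtype.ext ?_)
  refine biInvariant_eq_zero_of_exact Q.1.2 (α - mixedForm h Q.1.1) (cartanForm_apply Q.1)
    fun X Y Z => ?_
  have h1 := hQ 1 ![X, Y, Z]
  rw [extDer_leftInvariantForm_two, hat_threeForm_apply h (lie_mem_subgroupLieAlgebra h)
    (lie_mem_complement h h𝔭) Q] at h1
  have e : ∀ v, (α - mixedForm h Q.1.1) v = α v - mixedForm h Q.1.1 v := fun _ => rfl
  simp only [e]
  linarith

/-- The linear map `Q ↦ H_Q` to closed forms. -/
def threeFormLin (h : IsCompl (subgroupLieAlgebra n K) 𝔭)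
    (h𝔭 : ∀ k ∈ K, ∀ X ∈ 𝔭, Ad n k X ∈ 𝔭) :
    vanishingForms (subgroupLieAlgebra n K) →ₗ[ℝ] closedForms (n := n) K 2 where
  toFun Q := ⟨leftInvariantForm (hat h (threeForm h Q.1)), threeForm_mem_closedForms h h𝔭 Q⟩
  map_add' P Q := Subtype.ext (congrArg (fun f => leftInvariantForm (hat h f))
    (threeForm_add h P.1 Q.1))
  map_smul' c Q := Subtype.ext (congrArg (fun f => leftInvariantForm (hat h f))
    (threeForm_smul h c Q.1))

lemma threeForm_sub_apply (h : IsCompl (subgroupLieAlgebra n K) 𝔭)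
    (h𝔭 : ∀ k ∈ K, ∀ X ∈ 𝔭, Ad n k X ∈ 𝔭) (P Q : vanishingForms (subgroupLieAlgebra n K))
    (v : Fin 3 → GroupLieAlgebra (𝓡 n) G) :
    hat h (threeForm h (P - Q).1) v = hat h (threeForm h P.1) v - hat h (threeForm h Q.1) v :=
  congrArg (fun β : closedForms (n := n) K 2 => β.1 1 v) (map_sub (threeFormLin h h𝔭) P Q)

lemma existsUnique_threeForm_add_exact (hK : IsClosed (K : Set G))
    (h : IsCompl (subgroupLieAlgebra n K) 𝔭) (h𝔭 : ∀ k ∈ K, ∀ X ∈ 𝔭, Ad n k X ∈ 𝔭)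
    {H : 𝔭 [⋀^Fin 3]→ₗ[ℝ] ℝ} (hH : IsAdInvariant K H)
    (hcl : ∀ x v, extDer (leftInvariantForm (hat h H)) x v = 0) :
    ∃! Q : vanishingForms (subgroupLieAlgebra n K), ∃ β : 𝔭 [⋀^Fin 2]→ₗ[ℝ] ℝ,
      IsAdInvariant K β ∧ ∀ (x : G) v,
        hat h H v = hat h (threeForm h Q.1) v + extDer (leftInvariantForm (hat h β)) x v := by
  obtain ⟨Q, β, hβ, hQ⟩ := exists_threeForm_add_exact hK h h𝔭 hH hcl
  refine ⟨Q, ⟨β, hβ, hQ⟩, ?_⟩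
  rintro P ⟨γ, -, hP⟩
  rw [← sub_eq_zero]
  refine eq_zero_of_threeForm_exact h h𝔭 _ (hat h β - hat h γ) fun x v => ?_
  have h1 : (leftInvariantForm (hat h β - hat h γ) : Form n G 2) =
      leftInvariantForm (hat h β) + (-1 : ℝ) • leftInvariantForm (hat h γ) := by
    funext x
    ext v
    change hat h β v - hat h γ v = hat h β v + -1 * hat h γ v
    ring
  rw [threeForm_sub_apply h h𝔭, h1, extDer_add (isSmoothForm_leftInvariantForm _)
    (fun v => contMDiff_const (c := -1 * hat h γ v)),
    extDer_smul _ (isSmoothForm_leftInvariantForm _)]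
  linarith [hQ x v, hP x v]

end InvariantRepresentatives

/-! ### The homotopy between a smooth form and its average -/

section Averaging

variable {n : ℕ} {G : Type*} [TopologicalSpace G] [ChartedSpace (EuclideanSpace ℝ (Fin n)) G]
  [Group G] [LieGroup (𝓡 n) ∞ G] [IsTopologicalGroup G] [CompactSpace G] [ConnectedSpace G]

/-- A smooth form contracted in all but the first argument. -/
def contractFst {m : ℕ} (β : Form n G (m + 1)) (w : Fin m → GroupLieAlgebra (𝓡 n) G) (y : G) :
    EuclideanSpace ℝ (Fin n) →L[ℝ] ℝ :=
  LinearMap.toContinuousLinearMap (E := EuclideanSpace ℝ (Fin n)) (evalAlt w ∘ₗ (β y).curryLeft)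

lemma lgrad_clm_apply {Φ : G → EuclideanSpace ℝ (Fin n) →L[ℝ] ℝ}
    (hΦ : ContMDiff (𝓡 n) 𝓘(ℝ, EuclideanSpace ℝ (Fin n) →L[ℝ] ℝ) ∞ Φ) (y : G)
    (X Z : EuclideanSpace ℝ (Fin n)) :
    lgrad n Φ y X Z = lgrad n (fun y => Φ y Z) y X := by
  have h := ((hasFDerivAt_lgrad hΦ y).clm_apply (hasFDerivAt_const Z (crd n (1 : G)))).fderiv
  refine Eq.symm ((DFunLike.congr_fun h X).trans ?_)
  rw [ContinuousLinearMap.comp_zero, zero_add]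
  rfl

lemma contMDiff_contractFst {m : ℕ} {β : Form n G (m + 1)} (hβ : IsSmoothForm β)
    (w : Fin m → GroupLieAlgebra (𝓡 n) G) :
    ContMDiff (𝓡 n) 𝓘(ℝ, EuclideanSpace ℝ (Fin n) →L[ℝ] ℝ) ∞ (contractFst β w) :=
  contMDiff_clm_of_apply fun e => hβ (Matrix.vecCons e w)

lemma contMDiff_contractFst_Ad {m : ℕ} {β : Form n G (m + 1)} (hβ : IsSmoothForm β)
    (w : Fin m → GroupLieAlgebra (𝓡 n) G) :
    ContMDiff (𝓡 n) 𝓘(ℝ, EuclideanSpace ℝ (Fin n) →L[ℝ] ℝ) ∞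
      (fun y : G => contractFst β w y ∘L AdL n y⁻¹) :=
  (contMDiff_contractFst hβ w).clm_comp (contMDiff_AdL.comp (contMDiff_inv (𝓡 n) ∞))

/-- The vector `Ad y⁻¹ Z` is the right-invariant field of `Z` in the left-invariant frame.
Differentiating `Ad y⁻¹` along `X` produces the bracket term with its minus sign. -/
lemma lgrad_contractFst_Ad {m : ℕ} {β : Form n G (m + 1)} (hβ : IsSmoothForm β)
    (w : Fin m → GroupLieAlgebra (𝓡 n) G) (y : G)
    (X Z : EuclideanSpace ℝ (Fin n)) :
    lgrad n (fun y : G => contractFst β w y ∘L AdL n y⁻¹) y X Z =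
      derivAlong X (fun x => β x (Matrix.vecCons (AdL n y⁻¹ Z : EuclideanSpace ℝ (Fin n)) w)) y
        - contractFst β w y (adL n G X (AdL n y⁻¹ Z)) := by
  rw [lgrad_clm_apply (contMDiff_contractFst_Ad hβ w)]
  have h := ((hasFDerivAt_lgrad (contMDiff_contractFst hβ w) y).clm_apply
    (hasFDerivAt_AdL_mul_par_inv y Z)).fderiv
  refine (DFunLike.congr_fun h X).trans ?_
  have h2 := lgrad_clm_apply (contMDiff_contractFst hβ w) y X (AdL n y⁻¹ Z)
  have h3 := derivAlong_eq_lgrad X (hβ (Matrix.vecCons (AdL n y⁻¹ Z) w)) y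
  rw [par_crd_one, mul_one]
  refine Eq.trans ?_ (congrArg (· - _) (h2.trans h3.symm))
  simp [sub_eq_neg_add]

/-- The coefficient functions of a smooth form. -/
def coeffC {m : ℕ} {β : Form n G m} (hβ : IsSmoothForm β) (v : Fin m → GroupLieAlgebra (𝓡 n) G) :
    C(G, ℝ) := ⟨fun y => β y v, (hβ v).continuous⟩

/-- The average of a smooth form over left translations. -/
def averageForm {m : ℕ} {β : Form n G m} (hβ : IsSmoothForm β) :
    GroupLieAlgebra (𝓡 n) G [⋀^Fin m]→ₗ[ℝ] ℝ :=
  altOfSeparating (haarMean G).toLinearMap (coeffC hβ)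
    (fun y : G => (ContinuousMap.evalCLM ℝ y).toLinearMap) (fun _ _ h => ContinuousMap.ext h)
    β (fun _ _ => rfl)

lemma averageForm_apply {m : ℕ} {β : Form n G m} (hβ : IsSmoothForm β)
    (v : Fin m → GroupLieAlgebra (𝓡 n) G) : averageForm hβ v = haarMean G (coeffC hβ v) := rfl

/-- Left-invariant fields generate right translations, under which the mean is constant. -/
lemma haarMean_lgrad {f : C(G, ℝ)} (hf : ContMDiff (𝓡 n) 𝓘(ℝ, ℝ) ∞ f)
    (X : EuclideanSpace ℝ (Fin n)) : haarMean G (evalCLM n G ℝ (lgradC n f hf) X) = 0 := by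
  have h1 := lgrad_clm_rt (haarMean G) f hf 1 X
  have h2 : (fun x => haarMean G (rt f x)) = fun _ => haarMean G f :=
    funext fun x => haarMean_mul_right f x
  have h3 : lgrad n (fun _ : G => haarMean G f) 1 = 0 := dOne_const _
  rw [h2, h3] at h1
  have h4 : rt (lgradC n f hf) 1 = lgradC n f hf := by
    ext1 y
    simp
  rw [h4] at h1
  exact h1.symm

/-- Averaging commutes with `d`: the derivative terms have mean zero by `haarMean_lgrad`, and the
bracket terms are averaged termwise. -/
lemma extDer_averageForm {m : ℕ} {β : Form n G (m + 1)} (hβ : IsSmoothForm β) (x : G)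
    (v : Fin (m + 2) → GroupLieAlgebra (𝓡 n) G) (F : C(G, ℝ)) (hF : ∀ y, F y = extDer β y v) :
    extDer (leftInvariantForm (averageForm hβ)) x v = haarMean G F := by
  have e : F = (∑ i : Fin (m + 2), (-1 : ℝ) ^ (i : ℕ) •
        evalCLM n G ℝ (lgradC n (coeffC hβ (i.removeNth v)) (hβ _)) (v i))
      + ∑ i : Fin (m + 1), ∑ j ∈ Finset.univ.filter (fun j : Fin (m + 1) => i ≤ j),
        (-1 : ℝ) ^ ((i.castSucc : ℕ) + (j.succ : ℕ)) •
          coeffC hβ (Matrix.vecCons ⁅v i.castSucc, v j.succ⁆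
            (j.removeNth (i.castSucc.removeNth v))) := by
    ext y
    rw [hF, extDer]
    simp only [ContinuousMap.add_apply, ContinuousMap.coe_sum, Finset.sum_apply,
      ContinuousMap.coe_smul, Pi.smul_apply, smul_eq_mul]
    refine congrArg₂ (· + ·) (Finset.sum_congr rfl fun i _ => congrArg _ ?_) rfl
    exact derivAlong_eq_lgrad (v i) (hβ (i.removeNth v)) y
  rw [e, map_add, map_sum, map_sum, extDer]
  refine congrArg₂ (· + ·) ?_ (Finset.sum_congr rfl fun i _ => ?_)
  · refine (Finset.sum_eq_zero fun i _ => ?_).trans (Finset.sum_eq_zero fun i _ => ?_).symm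
    · simp only [leftInvariantForm, derivAlong_const, mul_zero]
    · refine (map_smul (haarMean G) _ _).trans ?_
      exact (congrArg (_ • ·) (haarMean_lgrad (f := coeffC hβ _) (hβ _) (v i))).trans (smul_zero _)
  · rw [map_sum]
    refine Finset.sum_congr rfl fun j _ => ?_
    rw [map_smul]
    rfl

/-- The contraction used in the homotopy operator. -/
def contractAdC {m : ℕ} {β : Form n G (m + 1)} (hβ : IsSmoothForm β)
    (w : Fin m → GroupLieAlgebra (𝓡 n) G) : C(G, EuclideanSpace ℝ (Fin n) →L[ℝ] ℝ) :=
  ⟨fun y : G => contractFst β w y ∘L AdL n y⁻¹, (contMDiff_contractFst_Ad hβ w).continuous⟩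

/-- The homotopy operator on smooth forms. -/
def primitiveForm {m : ℕ} {β : Form n G (m + 1)} (hβ : IsSmoothForm β) : Form n G m := fun x =>
  altOfSeparating (transfer n G).toLinearMap (fun w => rt (contractAdC hβ w) x) evalCC
    evalCC_separating (fun i : G × EuclideanSpace ℝ (Fin n) =>
      (β (i.1 * x)).curryLeft (AdL n (i.1 * x)⁻¹ i.2)) fun _ _ => rfl

lemma primitiveForm_apply {m : ℕ} {β : Form n G (m + 1)} (hβ : IsSmoothForm β) (x : G)
    (w : Fin m → GroupLieAlgebra (𝓡 n) G) :
    primitiveForm hβ x w = transfer n G (rt (contractAdC hβ w) x) := rfl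

lemma isSmoothForm_primitiveForm {m : ℕ} {β : Form n G (m + 1)} (hβ : IsSmoothForm β) :
    IsSmoothForm (primitiveForm hβ) := fun w =>
  (transfer n G).contMDiff.comp (contMDiff_rt (contractAdC hβ w) (contMDiff_contractFst_Ad hβ w))

/-- Contraction occurs in the first slot and leaves the remaining horizontal arguments in place.
Right-invariant fields are preserved by right translations, hence equivariance survives. -/
lemma isQuotientForm_primitiveForm {K : Subgroup G} {m : ℕ} {β : Form n G (m + 1)}
    (hβ : IsQuotientForm K β) : IsQuotientForm K (primitiveForm hβ.smooth) where
  smooth := isSmoothForm_primitiveForm _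
  horizontal x w := by
    rintro ⟨i, hi⟩
    have : rt (contractAdC hβ.smooth w) x = 0 := by
      ext y Z
      exact hβ.horizontal _ _ ⟨i.succ, hi⟩
    rw [primitiveForm_apply, this, map_zero]
  equivariant k hk x w := by
    rw [primitiveForm_apply, primitiveForm_apply]
    congr 1
    ext y Z
    change β (y * (x * k)) (Matrix.vecCons (AdL n (y * (x * k))⁻¹ Z : EuclideanSpace ℝ (Fin n)) w) =
      β (y * x) (Matrix.vecCons (AdL n (y * x)⁻¹ Z : EuclideanSpace ℝ (Fin n))
        fun i => Ad n k (w i))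
    rw [← mul_assoc, hβ.equivariant k hk]
    refine congrArg (β (y * x)) (funext fun i => ?_)
    refine Fin.cases ?_ (fun j => rfl) i
    have : AdL n k (AdL n (y * x * k)⁻¹ Z) = AdL n (y * x)⁻¹ Z := by
      rw [mul_inv_rev (y * x) k, AdL_mul_apply, AdL_apply_inv_self]
    exact (Ad_apply (n := n) k _).trans this

lemma derivAlong_primitiveForm {m : ℕ} {β : Form n G (m + 1)} (hβ : IsSmoothForm β) (x : G)
    (w : Fin m → GroupLieAlgebra (𝓡 n) G) (X : EuclideanSpace ℝ (Fin n)) :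
    derivAlong X (fun y => primitiveForm hβ y w) x = transfer n G
      (evalCLM n G _ (rt (lgradC n (contractAdC hβ w) (contMDiff_contractFst_Ad hβ w)) x) X) :=
  (derivAlong_eq_lgrad X (isSmoothForm_primitiveForm hβ w) x).trans
    (lgrad_clm_rt (transfer n G) (contractAdC hβ w) (contMDiff_contractFst_Ad hβ w) x X)

/-- Cartan's formula for the form contracted with right-invariant vector fields. -/
lemma cartan_formula {β : Form n G 3} (hcl : ∀ x v, extDer β x v = 0)
    (X Y Z W : GroupLieAlgebra (𝓡 n) G) (y : G) :
    (derivAlong X (fun x => β x ![W, Y, Z]) y - β y ![⁅X, W⁆, Y, Z])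
      - (derivAlong Y (fun x => β x ![W, X, Z]) y - β y ![⁅Y, W⁆, X, Z])
      + (derivAlong Z (fun x => β x ![W, X, Y]) y - β y ![⁅Z, W⁆, X, Y])
      - β y ![W, ⁅X, Y⁆, Z] + β y ![W, ⁅X, Z⁆, Y] - β y ![W, ⁅Y, Z⁆, X] =
      derivAlong W (fun x => β x ![X, Y, Z]) y := by
  have h := hcl y ![W, X, Y, Z]
  rw [extDer_three_form] at h
  have n1 : ∀ A B C D, β y ![⁅A, B⁆, C, D] = - β y ![⁅B, A⁆, C, D] := fun A B C D => by
    rw [← altThree_apply, ← lie_skew, map_neg]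
    rfl
  have s := altThree_swap_left (β y)
  simp only [altThree_apply] at s
  linarith [n1 X W Y Z, n1 Y W X Z, n1 Z W X Y, s W ⁅X, Y⁆ Z, s W ⁅X, Z⁆ Y, s W ⁅Y, Z⁆ X]

/-- By Cartan's formula for closed `β`, the differential is `transfer` of the gradient of `y ↦ β (y
* x) v`. That function has mean `averageForm` and value `β x v` at `1`. -/
lemma extDer_primitiveForm {β : Form n G 3} (hβ : IsSmoothForm β)
    (hcl : ∀ x v, extDer β x v = 0) (x : G) (v : Fin 3 → GroupLieAlgebra (𝓡 n) G) :
    extDer (primitiveForm hβ) x v = averageForm hβ v - β x v := by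
  obtain ⟨X, Y, Z, rfl⟩ : ∃ X Y Z, v = ![X, Y, Z] := ⟨_, _, _, vec_three_eta v⟩
  have hf := contMDiff_rt_fun (f := coeffC hβ ![X, Y, Z]) (hβ _) x
  have h1 := transfer_rgradC (n := n) (rt (coeffC hβ ![X, Y, Z]) x) hf
  have h2 : haarMean G (rt (coeffC hβ ![X, Y, Z]) x) = averageForm hβ ![X, Y, Z] :=
    haarMean_mul_right _ x
  have h3 : rt (coeffC hβ ![X, Y, Z]) x 1 = β x ![X, Y, Z] :=
    congrArg (fun y => β y ![X, Y, Z]) (one_mul x)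
  rw [h2, h3, rgradC_rt _ (hβ _)] at h1
  let D : (Fin 2 → GroupLieAlgebra (𝓡 n) G) → GroupLieAlgebra (𝓡 n) G →
      C(G, EuclideanSpace ℝ (Fin n) →L[ℝ] ℝ) := fun w A =>
    evalCLM n G _ (rt (lgradC n (contractAdC hβ w) (contMDiff_contractFst_Ad hβ w)) x) A
  let P : (Fin 2 → GroupLieAlgebra (𝓡 n) G) → C(G, EuclideanSpace ℝ (Fin n) →L[ℝ] ℝ) := fun w =>
    rt (contractAdC hβ w) x
  suffices key : transfer n G (D ![Y, Z] X) - transfer n G (D ![X, Z] Y)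
      + transfer n G (D ![X, Y] Z)
      - transfer n G (P ![⁅X, Y⁆, Z]) + transfer n G (P ![⁅X, Z⁆, Y])
      - transfer n G (P ![⁅Y, Z⁆, X]) =
      transfer n G (rt (rgradC n (coeffC hβ ![X, Y, Z]) (hβ _)) x) by
    refine (extDer_two_form _ x X Y Z).trans (Eq.trans ?_ (key.trans h1))
    have d := derivAlong_primitiveForm hβ x
    exact congrArg₂ (· - ·) (congrArg₂ (· + ·) (congrArg₂ (· - ·) (congrArg₂ (· + ·)
      (congrArg₂ (· - ·) (d _ X) (d _ Y)) (d _ Z)) rfl) rfl) rfl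
  rw [← map_sub, ← map_add, ← map_sub, ← map_add, ← map_sub]
  congr 1
  ext y W
  have hc := cartan_formula hcl X Y Z (AdL n (y * x)⁻¹ W) (y * x)
  have e : ∀ (A : GroupLieAlgebra (𝓡 n) G) (w : Fin 2 → GroupLieAlgebra (𝓡 n) G),
      evalCLM n G _ (rt (lgradC n (contractAdC hβ w) (contMDiff_contractFst_Ad hβ w)) x) A y W =
      derivAlong A (fun z => β z (Matrix.vecCons
        (AdL n (y * x)⁻¹ W : EuclideanSpace ℝ (Fin n)) w)) (y * x)
        - β (y * x) (Matrix.vecCons ⁅A, (AdL n (y * x)⁻¹ W : EuclideanSpace ℝ (Fin n))⁆ w) := by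
    intro A w
    refine (lgrad_contractFst_Ad hβ w (y * x) A W).trans ?_
    refine congrArg (_ - ·) ?_
    exact congrArg (fun u => β (y * x) (Matrix.vecCons u w)) (lie_eq_adL A _).symm
  have e2 : rt (rgradC n (coeffC hβ ![X, Y, Z]) (hβ _)) x y W =
      derivAlong (AdL n (y * x)⁻¹ W) (fun z => β z ![X, Y, Z]) (y * x) := by
    refine Eq.trans ?_ (derivAlong_eq_lgrad _ (hβ _) _).symm
    exact DFunLike.congr_fun (rgrad_eq_lgrad (hβ ![X, Y, Z]) (y * x)) W
  refine Eq.trans ?_ (hc.trans e2.symm)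
  rw [← e X ![Y, Z], ← e Y ![X, Z], ← e Z ![X, Y]]
  rfl

end Averaging

/-! ### The isomorphism with de Rham cohomology -/

section DeRham

variable {n : ℕ} {G : Type*} [TopologicalSpace G] [ChartedSpace (EuclideanSpace ℝ (Fin n)) G]
  [Group G] [LieGroup (𝓡 n) ∞ G] [IsTopologicalGroup G] [CompactSpace G] [ConnectedSpace G]
  {K : Subgroup G} {𝔭 : Submodule ℝ (GroupLieAlgebra (𝓡 n) G)}

lemma averageForm_horizontal {m : ℕ} {β : Form n G m} (hβ : IsQuotientForm K β)
    (v : Fin m → GroupLieAlgebra (𝓡 n) G) (hv : ∃ i, v i ∈ subgroupLieAlgebra n K) :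
    averageForm hβ.smooth v = 0 := by
  have : coeffC hβ.smooth v = 0 := ContinuousMap.ext fun y => hβ.horizontal y v hv
  rw [averageForm_apply, this, map_zero]

lemma averageForm_Ad {m : ℕ} {β : Form n G m} (hβ : IsQuotientForm K β) {k : G} (hk : k ∈ K)
    (v : Fin m → GroupLieAlgebra (𝓡 n) G) :
    (averageForm hβ.smooth fun i => Ad n k (v i)) = averageForm hβ.smooth v := by
  rw [averageForm_apply, averageForm_apply, ← haarMean_mul_right (coeffC hβ.smooth v) k]
  exact congrArg (haarMean G) (ContinuousMap.ext fun y => (hβ.equivariant k hk y v).symm)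

/-- Every closed form on the homogeneous space is cohomologous to an invariant one. -/
lemma exists_invariant_representative (h : IsCompl (subgroupLieAlgebra n K) 𝔭)
    {β : Form n G 3} (hβ : β ∈ closedForms (n := n) K 2) :
    ∃ H : 𝔭 [⋀^Fin 3]→ₗ[ℝ] ℝ, IsAdInvariant K H ∧
      (∀ x v, extDer (leftInvariantForm (hat h H)) x v = 0) ∧
      ∃ η : Form n G 2, IsQuotientForm K η ∧ ∀ x v, β x v = hat h H v + extDer η x v := by
  have hq := hβ.1
  have e := hat_restrict_eq h (averageForm_horizontal hq)
  refine ⟨(averageForm hq.smooth).compLinearMap 𝔭.subtype,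
    isAdInvariant_of_Ad_eq fun k hk v => averageForm_Ad hq hk v, fun x v => ?_,
    (-1 : ℝ) • primitiveForm hq.smooth, (isQuotientForm_primitiveForm hq).smul _, fun x v => ?_⟩
  · rw [e, extDer_averageForm hq.smooth x v 0 fun y => (hβ.2 y v).symm, map_zero]
  · rw [e, extDer_smul _ (isSmoothForm_primitiveForm _), extDer_primitiveForm hq.smooth hβ.2]
    ring

variable [LieAlgebra.IsSemisimple ℝ (GroupLieAlgebra (𝓡 n) G)]

/-- A primitive on `G/K` is averaged to a left-invariant one; the left-invariant `H_Q` does not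
change. -/
lemma mk_threeFormLin_injective (h : IsCompl (subgroupLieAlgebra n K) 𝔭)
    (h𝔭 : ∀ k ∈ K, ∀ X ∈ 𝔭, Ad n k X ∈ 𝔭) (Q : vanishingForms (subgroupLieAlgebra n K))
    (hQ : threeFormLin h h𝔭 Q ∈ (exactForms (n := n) K 1).submoduleOf (closedForms (n := n) K 2)) :
    Q = 0 := by
  obtain ⟨η, hη, e⟩ := hQ
  refine eq_zero_of_threeForm_exact h h𝔭 Q (averageForm hη.smooth) fun x v => ?_
  rw [extDer_averageForm hη.smooth x v (ContinuousMap.const G (hat h (threeForm h Q.1) v))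
    fun y => e y v, haarMean_const]

lemma mk_threeFormLin_surjective (hK : IsClosed (K : Set G))
    (h : IsCompl (subgroupLieAlgebra n K) 𝔭)
    (h𝔭 : ∀ k ∈ K, ∀ X ∈ 𝔭, Ad n k X ∈ 𝔭) (β : closedForms (n := n) K 2) :
    ∃ Q : vanishingForms (subgroupLieAlgebra n K), threeFormLin h h𝔭 Q - β ∈
      (exactForms (n := n) K 1).submoduleOf (closedForms (n := n) K 2) := by
  obtain ⟨H, hH, hcl, η, hη, hβ⟩ := exists_invariant_representative h β.2
  obtain ⟨Q, γ, hγ, hQ⟩ := exists_threeForm_add_exact hK h h𝔭 hH hcl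
  refine ⟨Q,
    ⟨(-1 : ℝ) • (leftInvariantForm (hat h γ) + η), ((isQuotientForm_hat h h𝔭 hγ).add hη).smul _,
      fun x v => ?_⟩⟩
  rw [extDer_smul _ ((isQuotientForm_hat h h𝔭 hγ).add hη).smooth,
    extDer_add (isSmoothForm_leftInvariantForm _) hη.smooth]
  have e : (threeFormLin h h𝔭 Q - β).1 x v = hat h (threeForm h Q.1) v - β.1 x v := rfl
  refine e.trans ?_
  rw [hβ, hQ x v]
  ring

/-- The linear isomorphism `Q ↦ [H_Q]`. -/
def deRhamEquiv (hK : IsClosed (K : Set G)) (h : IsCompl (subgroupLieAlgebra n K) 𝔭)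
    (h𝔭 : ∀ k ∈ K, ∀ X ∈ 𝔭, Ad n k X ∈ 𝔭) :
    vanishingForms (subgroupLieAlgebra n K) ≃ₗ[ℝ] deRhamH3 n K :=
  LinearEquiv.ofBijective
    (((exactForms (n := n) K 1).submoduleOf (closedForms (n := n) K 2)).mkQ ∘ₗ threeFormLin h h𝔭)
    ⟨(injective_iff_map_eq_zero _).2 fun Q hQ => mk_threeFormLin_injective h h𝔭 Q
        ((Submodule.Quotient.mk_eq_zero _).1 hQ), fun c => by
      obtain ⟨β, rfl⟩ := Submodule.Quotient.mk_surjective _ c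
      obtain ⟨Q, hQ⟩ := mk_threeFormLin_surjective hK h h𝔭 β
      exact ⟨Q, (Submodule.Quotient.eq _).2 hQ⟩⟩

end DeRham

/-- The operator representing `Q` with respect to the inner product `B` is self-adjoint, so it has a
real eigenvector. -/
lemma exists_common_eigenvector {V : Type*} [AddCommGroup V] [Module ℝ V] [FiniteDimensional ℝ V]
    [Nontrivial V] (B Q : LinearMap.BilinForm ℝ V) (hB : ∀ x y, B x y = B y x)
    (hpos : ∀ x, x ≠ 0 → 0 < B x x) (hQ : ∀ x y, Q x y = Q y x) :
    ∃ (c : ℝ) (x : V), x ≠ 0 ∧ ∀ y, Q x y = c * B x y := by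
  let core : InnerProductSpace.Core ℝ V :=
    { inner := fun x y => B x y
      conj_inner_symm := fun x y => hB y x
      re_inner_nonneg := fun x => by
        by_cases hx : x = 0
        · simp [hx]
        · exact (hpos x hx).le
      add_left := fun x y z => by simp
      smul_left := fun x y r => by simp
      definite := fun x hx => by
        by_contra h
        exact (hpos x h).ne' hx }
  let : NormedAddCommGroup V := core.toNormedAddCommGroup
  let : InnerProductSpace ℝ V := InnerProductSpace.ofCore core.toCore
  have hnd : B.Nondegenerate := by
    have h1 : ∀ x, (∀ y, B x y = 0) → x = 0 := fun x hx => by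
      by_contra h
      exact (hpos x h).ne' (hx x)
    exact ⟨h1, fun x hx => h1 x fun y => (hB x y).trans (hx y)⟩
  let T := LinearMap.BilinForm.symmCompOfNondegenerate Q B hnd
  have hT : ∀ x y, B (T x) y = Q x y := fun x y =>
    LinearMap.BilinForm.symmCompOfNondegenerate_left_apply Q hnd y x
  have hsymm : T.IsSymmetric := fun x y => by
    change B (T x) y = B x (T y)
    rw [hB x, hT, hT, hQ]
  obtain ⟨c, hc⟩ : ∃ c : ℝ, Module.End.HasEigenvalue T c :=
    ⟨_, hsymm.hasEigenvalue_iSup_of_finiteDimensional⟩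
  obtain ⟨x, hx⟩ := hc.exists_hasEigenvector
  refine ⟨c, x, hx.2, fun y => ?_⟩
  rw [← hT, hx.apply_eq_smul, map_smul]
  rfl

/-! ### Bi-invariant forms and simple ideals -/

section SimpleIdeals

open LieAlgebra

variable {L : Type*} [LieRing L] [LieAlgebra ℝ L]

lemma isAtom_of_isSimple {I : LieIdeal ℝ L} (hI : IsSimple ℝ I) : IsAtom I := by
  refine ⟨?_, fun J hJ => ?_⟩
  · rintro rfl
    exact hI.non_abelian inferInstance
  · rcases hI.eq_bot_or_eq_top (LieIdeal.comap I.incl J) with h | h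
    · rw [eq_bot_iff]
      intro x hx
      have h1 : (⟨x, hJ.le hx⟩ : I) ∈ LieIdeal.comap I.incl J := LieIdeal.mem_comap.2 hx
      rw [h, LieSubmodule.mem_bot] at h1
      exact (LieSubmodule.mem_bot x).2 (congrArg Subtype.val h1)
    · refine absurd (fun x hx => ?_) (not_le_of_gt hJ)
      have h1 : (⟨x, hx⟩ : I) ∈ LieIdeal.comap I.incl J := h ▸ LieSubmodule.mem_top _
      exact LieIdeal.mem_comap.1 h1

variable [IsSemisimple ℝ L]

lemma numSimpleIdeals_eq : numSimpleIdeals L = {I : LieIdeal ℝ L | IsAtom I}.ncard :=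
  congrArg Set.ncard (Set.ext fun I =>
    ⟨fun hI => isAtom_of_isSimple hI, fun hI => IsSemisimple.isSimple_of_isAtom I hI⟩)

lemma apply_eq_zero_of_isAtom {I : LieIdeal ℝ L} (hI : IsAtom I) (θ : L →ₗ[ℝ] ℝ)
    (hθ : ∀ x ∈ I, ∀ y ∈ I, θ ⁅x, y⁆ = 0) {x : L} (hx : x ∈ I) : θ x = 0 := by
  rw [← lie_self_of_isAtom hI, ← LieSubmodule.mem_toSubmodule,
    LieSubmodule.lieIdeal_oper_eq_linear_span'] at hx
  have : Submodule.span ℝ {x | ∃ y ∈ I, ∃ z ∈ I, ⁅y, z⁆ = x} ≤ LinearMap.ker θ := by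
    rw [Submodule.span_le]
    rintro _ ⟨y, hy, z, hz, rfl⟩
    exact hθ y hy z hz
  exact this hx

/-- `Q([a, b], y) = Q(a, [b, y])` with `[b, y] ∈ I ⊓ J = 0`, and `I` is spanned by its brackets. -/
lemma biInvariant_apply_of_ne {Q : LinearMap.BilinForm ℝ L} (hQ : Q ∈ biInvariantForms L)
    {I J : LieIdeal ℝ L} (hI : IsAtom I) (hJ : IsAtom J) (hIJ : I ≠ J) {x y : L} (hx : x ∈ I)
    (hy : y ∈ J) : Q x y = 0 := by
  refine apply_eq_zero_of_isAtom hI (Q.flip y) (fun a ha b hb => ?_) hx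
  have h1 : ⁅b, y⁆ ∈ I ⊓ J :=
    ⟨lie_mem_left ℝ L I b y hb, lie_mem_right ℝ L J b y hy⟩
  rw [(hI.disjoint_of_ne hJ hIJ).eq_bot, LieSubmodule.mem_bot] at h1
  change Q ⁅a, b⁆ y = 0
  rw [biInv_lie hQ, h1, map_zero]

variable [FiniteDimensional ℝ L]

lemma biInvariant_proportional {B Q : LinearMap.BilinForm ℝ L} (hB : B ∈ biInvariantForms L)
    (hpos : ∀ x, x ≠ 0 → 0 < B x x) (hQ : Q ∈ biInvariantForms L) {I : LieIdeal ℝ L}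
    (hI : IsAtom I) : ∃ c : ℝ, ∀ x ∈ I, ∀ y ∈ I, Q x y = c * B x y := by
  have : Nontrivial I.toSubmodule := by
    rw [Submodule.nontrivial_iff_ne_bot]
    exact fun h => hI.1 ((LieSubmodule.toSubmodule_eq_bot I).1 h)
  obtain ⟨c, x, hx0, hx⟩ := exists_common_eigenvector (B.restrict I.toSubmodule)
    (Q.restrict I.toSubmodule) (fun x y => biInv_symm hB _ _)
    (fun x hx => hpos x fun h => hx (Subtype.ext h)) (fun x y => biInv_symm hQ _ _)
  -- The eigenspace for `c` inside `I` is an ideal because `Q` and `B` are both invariant. It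
  -- contains `x ≠ 0`, so by minimality it is `I`.
  let J : LieIdeal ℝ L :=
    { carrier := {x | x ∈ I ∧ ∀ y ∈ I, Q x y = c * B x y}
      add_mem' := fun {a b} ha hb => ⟨add_mem ha.1 hb.1, fun y hy => by
        rw [map_add, map_add, LinearMap.add_apply, LinearMap.add_apply, ha.2 y hy, hb.2 y hy,
          mul_add]⟩
      zero_mem' := ⟨zero_mem _, fun y _ => by simp⟩
      smul_mem' := fun r a ha => ⟨I.smul_mem r ha.1, fun y hy => by
        rw [map_smul, map_smul, LinearMap.smul_apply, LinearMap.smul_apply, ha.2 y hy,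
          smul_eq_mul, smul_eq_mul, mul_left_comm]⟩
      lie_mem := fun {z a} ha => ⟨lie_mem_right ℝ L I z a ha.1, fun y hy => by
        rw [hQ.2, hB.2, ha.2 _ (lie_mem_right ℝ L I z y hy), mul_neg]⟩ }
  have hJI : J ≤ I := fun a ha => ha.1
  have hJ : J = I := by
    refine (hI.le_iff.1 hJI).resolve_left fun h => hx0 (Subtype.ext ?_)
    have : (x : L) ∈ J := ⟨x.2, fun y hy => hx ⟨y, hy⟩⟩
    rw [h] at this
    exact (LieSubmodule.mem_bot _).1 this
  refine ⟨c, fun a ha y hy => ?_⟩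
  rw [← hJ] at ha
  exact ha.2 y hy

/-- Distinct minimal ideals are `Q`-orthogonal and all of them together generate `L`. Annihilators
and kernels of invariant forms are ideals, so it suffices to test on each minimal ideal. -/
lemma eq_zero_of_apply_atoms {Q : LinearMap.BilinForm ℝ L} (hQ : Q ∈ biInvariantForms L)
    (h : ∀ I : LieIdeal ℝ L, IsAtom I → ∀ x ∈ I, ∀ y ∈ I, Q x y = 0) : Q = 0 := by
  have key : ∀ I : LieIdeal ℝ L, IsAtom I → ∀ x ∈ I, ∀ y, Q x y = 0 := by
    intro I hI x hx y
    let N : LieIdeal ℝ L :=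
      { carrier := {y | ∀ x ∈ I, Q x y = 0}
        add_mem' := fun {a b} ha hb x hx => by rw [map_add, ha x hx, hb x hx, add_zero]
        zero_mem' := fun x _ => map_zero _
        smul_mem' := fun r a ha x hx => by rw [map_smul, ha x hx, smul_zero]
        lie_mem := fun {z a} ha x hx => by
          have := hQ.2 z x a
          rw [ha _ (lie_mem_right ℝ L I z x hx)] at this
          linarith }
    have hN : (⊤ : LieIdeal ℝ L) ≤ N := by
      rw [← IsSemisimple.sSup_atoms_eq_top]
      refine sSup_le fun J hJ a ha x hx => ?_
      by_cases hIJ : I = J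
      · subst hIJ
        exact h I hI x hx a ha
      · exact biInvariant_apply_of_ne hQ hI hJ hIJ hx ha
    exact hN (LieSubmodule.mem_top y) x hx
  let N : LieIdeal ℝ L :=
    { LinearMap.ker Q with
      lie_mem := fun {z a} ha => by
        refine LinearMap.ext fun y => ?_
        have h1 := hQ.2 z a y
        have h2 : Q a = 0 := ha
        rw [h2] at h1
        simpa using h1 }
  have hN : (⊤ : LieIdeal ℝ L) ≤ N := by
    rw [← IsSemisimple.sSup_atoms_eq_top]
    exact sSup_le fun J hJ a ha => LinearMap.ext fun y => key J hJ a ha y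
  exact LinearMap.ext fun x => hN (LieSubmodule.mem_top x)

/-- The summand of an invariant inner product that belongs to an ideal. -/
lemma exists_biInvariant_of_ideal {B : LinearMap.BilinForm ℝ L} (hB : B ∈ biInvariantForms L)
    (hpos : ∀ x, x ≠ 0 → 0 < B x x) (I : LieIdeal ℝ L) :
    ∃ P ∈ biInvariantForms L, (∀ x ∈ I, P x x = B x x) ∧
      ∀ x, (∀ y ∈ I, B x y = 0) → P x x = 0 := by
  let N : LieIdeal ℝ L :=
    { carrier := {x | ∀ y ∈ I, B x y = 0}
      add_mem' := fun {a b} ha hb y hy => by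
        rw [map_add, LinearMap.add_apply, ha y hy, hb y hy, add_zero]
      zero_mem' := fun y _ => by simp
      smul_mem' := fun r a ha y hy => by rw [map_smul, LinearMap.smul_apply, ha y hy, smul_zero]
      lie_mem := fun {z a} ha y hy => by
        have := hB.2 z a y
        rw [ha _ (lie_mem_right ℝ L I z y hy)] at this
        linarith }
  have hN : ∀ x ∈ N.toSubmodule, ∀ y ∈ I, B x y = 0 := fun x hx => hx
  have hrefl : B.IsRefl := fun x y hxy => (biInv_symm hB y x).trans hxy
  have hc : IsCompl I.toSubmodule N.toSubmodule := by
    have e : N.toSubmodule = B.orthogonal I.toSubmodule := by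
      ext x
      rw [LinearMap.BilinForm.mem_orthogonal_iff]
      exact ⟨fun hx y hy => (biInv_symm hB y x).trans (hx y hy),
        fun hx y hy => (biInv_symm hB x y).trans (hx y hy)⟩
    rw [e]
    refine LinearMap.BilinForm.isCompl_orthogonal_of_restrict_nondegenerate hrefl ?_
    have h1 : ∀ x : I.toSubmodule, (∀ y : I.toSubmodule, B x y = 0) → x = 0 := fun x hx => by
      by_contra h
      exact (hpos x fun h0 => h (Subtype.ext h0)).ne' (hx x)
    exact ⟨h1, fun x hx => h1 x fun y => (biInv_symm hB x y).trans (hx y)⟩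
  have hk : ∀ z x : L, kComp hc ⁅z, x⁆ = ⁅z, kComp hc x⁆ := by
    intro z x
    conv_lhs => rw [← kComp_add_pComp hc x, lie_add, map_add]
    rw [kComp_of_mem hc (lie_mem_right ℝ L I z _ (kComp_mem hc x)),
      kComp_of_mem' hc (lie_mem_right ℝ L N z _ (pComp_mem hc x)), add_zero]
  have hBk : ∀ x y, B (kComp hc x) y = B (kComp hc x) (kComp hc y) := by
    intro x y
    conv_lhs => rw [← kComp_add_pComp hc y, map_add]
    rw [biInv_symm hB _ (pComp hc y), hN _ (pComp_mem hc y) _ (kComp_mem hc x), add_zero]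
  -- Here `kComp hc` is the `B`-orthogonal projection onto `I`. It commutes with `ad` because the
  -- complement is an ideal too.
  refine ⟨B.comp (kComp hc) LinearMap.id, ⟨⟨fun x y => ?_⟩, fun x y z => ?_⟩,
    fun x hx => ?_, fun x hx => ?_⟩
  · change B (kComp hc x) y = B (kComp hc y) x
    rw [hBk x y, hBk y x, biInv_symm hB]
  · change B (kComp hc ⁅x, y⁆) z = - B (kComp hc y) ⁅x, z⁆
    rw [hk, hB.2]
  · change B (kComp hc x) x = B x x
    rw [kComp_of_mem hc hx]
  · change B (kComp hc x) x = 0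
    rw [kComp_of_mem' hc (show x ∈ N.toSubmodule from hx), map_zero, LinearMap.zero_apply]

lemma finrank_biInvariantForms {B : LinearMap.BilinForm ℝ L} (hB : B ∈ biInvariantForms L)
    (hpos : ∀ x, x ≠ 0 → 0 < B x x) :
    Module.finrank ℝ (biInvariantForms L) = numSimpleIdeals L := by
  classical
  let S := {I : LieIdeal ℝ L | IsAtom I}
  have hfin : S.Finite := WellFoundedGT.finite_of_sSupIndep IsSemisimple.sSupIndep_isAtom
  have : Fintype S := hfin.fintype
  have hne : ∀ I : S, ∃ x : L, x ∈ I.1 ∧ x ≠ 0 := fun I =>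
    Submodule.exists_mem_ne_zero_of_ne_bot
      fun h => I.2.1 ((LieSubmodule.toSubmodule_eq_bot I.1).1 h)
  choose u hu hu0 using hne
  -- One nonzero vector in each simple ideal suffices to read off the ratio of `Q` to `B` there.
  let ev : biInvariantForms L →ₗ[ℝ] S → ℝ :=
    { toFun := fun Q I => Q.1 (u I) (u I)
      map_add' := fun _ _ => rfl
      map_smul' := fun _ _ => rfl }
  have hinj : Function.Injective ev := by
    refine (injective_iff_map_eq_zero ev).2 fun Q hQ => Subtype.ext ?_
    refine eq_zero_of_apply_atoms Q.2 fun I hI x hx y hy => ?_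
    obtain ⟨c, hc⟩ := biInvariant_proportional hB hpos Q.2 hI
    have h1 : Q.1 (u ⟨I, hI⟩) (u ⟨I, hI⟩) = 0 := congrFun hQ ⟨I, hI⟩
    rw [hc _ (hu ⟨I, hI⟩) _ (hu ⟨I, hI⟩)] at h1
    have h2 : c = 0 := (mul_eq_zero.1 h1).resolve_right (hpos _ (hu0 _)).ne'
    rw [hc x hx y hy, h2, zero_mul]
  have hsurj : Function.Surjective ev := by
    rw [← LinearMap.range_eq_top, eq_top_iff, ← (Pi.basisFun ℝ S).span_eq, Submodule.span_le]
    rintro _ ⟨I, rfl⟩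
    obtain ⟨P, hP, h1, h2⟩ := exists_biInvariant_of_ideal hB hpos I.1
    have e : ev ((B (u I) (u I))⁻¹ • ⟨P, hP⟩) = Pi.single I 1 := by
      funext J
      change (B (u I) (u I))⁻¹ * P (u J) (u J) = _
      by_cases hJ : J = I
      · subst hJ
        rw [h1 _ (hu J), inv_mul_cancel₀ (hpos _ (hu0 J)).ne', Pi.single_eq_same]
      · rw [h2 (u J) fun y hy => biInvariant_apply_of_ne hB J.2 I.2
          (fun h => hJ (Subtype.ext h)) (hu J) hy, mul_zero, Pi.single_eq_of_ne hJ]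
    rw [Pi.basisFun_apply]
    exact ⟨_, e⟩
  rw [(LinearEquiv.ofBijective ev ⟨hinj, hsurj⟩).finrank_eq, Module.finrank_fintype_fun_eq_card,
    numSimpleIdeals_eq, ← Nat.card_coe_set_eq, Nat.card_eq_fintype_card]

/-- Rank-nullity for the restriction of bi-invariant forms to `𝔨`. -/
lemma finrank_vanishingForms {B : LinearMap.BilinForm ℝ L} (hB : B ∈ biInvariantForms L)
    (hpos : ∀ x, x ≠ 0 → 0 < B x x) (𝔨 : Submodule ℝ L) :
    Module.finrank ℝ (vanishingForms 𝔨) + restrictionDim 𝔨 = numSimpleIdeals L := by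
  have h := LinearMap.finrank_range_add_finrank_ker
    ((restrictForm 𝔨).comp (biInvariantForms L).subtype)
  rw [LinearMap.range_comp, Submodule.range_subtype, finrank_biInvariantForms hB hpos] at h
  rw [← h, add_comm]
  rfl

end SimpleIdeals

/-! ### A positive definite bi-invariant form -/

section InvariantInnerProduct

variable {n : ℕ} {G : Type*} [TopologicalSpace G] [ChartedSpace (EuclideanSpace ℝ (Fin n)) G]
  [Group G] [LieGroup (𝓡 n) ∞ G] [IsTopologicalGroup G] [CompactSpace G]

/-- The inner product of two orbits of the adjoint representation. -/
def innerOrbit (x y : EuclideanSpace ℝ (Fin n)) : C(G, ℝ) :=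
  ⟨fun g => innerSL ℝ (AdL n g x) (AdL n g y), (contMDiff_two (innerSL ℝ) x y).continuous⟩

variable (n G) in
/-- The average of the Euclidean inner product over the adjoint representation. -/
def averageInner : EuclideanSpace ℝ (Fin n) →ₗ[ℝ] EuclideanSpace ℝ (Fin n) →ₗ[ℝ] ℝ :=
  LinearMap.mk₂ ℝ (fun x y => haarMean G (innerOrbit x y))
    (fun x x' y => by
      rw [← map_add]
      exact congrArg (haarMean G) (ContinuousMap.ext fun g => by simp [innerOrbit]))
    (fun c x y => by
      rw [← map_smul]
      exact congrArg (haarMean G) (ContinuousMap.ext fun g => by simp [innerOrbit]))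
    (fun x y y' => by
      rw [← map_add]
      exact congrArg (haarMean G)
        (ContinuousMap.ext fun g => by simp [innerOrbit, inner_add_right]))
    (fun c x y => by
      rw [← map_smul]
      exact congrArg (haarMean G) (ContinuousMap.ext fun g => by simp [innerOrbit]))

lemma averageInner_apply (x y : EuclideanSpace ℝ (Fin n)) :
    averageInner n G x y = haarMean G (innerOrbit x y) := rfl

lemma averageInner_comm (x y : EuclideanSpace ℝ (Fin n)) :
    averageInner n G x y = averageInner n G y x :=
  congrArg (haarMean G) (ContinuousMap.ext fun g => real_inner_comm (AdL n g y) (AdL n g x))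

/-- The integrand is positive and attains its minimum on the compact group; this minimum bounds the
mean from below. -/
lemma averageInner_pos {x : EuclideanSpace ℝ (Fin n)} (hx : x ≠ 0) : 0 < averageInner n G x x := by
  have hpos : ∀ g : G, 0 < innerOrbit x x g := fun g => by
    refine (real_inner_self_pos (x := AdL n g x)).2 fun h0 => hx ?_
    rw [← AdL_inv_apply_self g x, h0, map_zero]
  obtain ⟨g₀, -, h₀⟩ := isCompact_univ.exists_isMinOn (s := (Set.univ : Set G)) ⟨1, trivial⟩
    (innerOrbit x x).continuous.continuousOn
  exact (hpos g₀).trans_le (haarMean_le_of_le fun g => h₀ (Set.mem_univ g))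

lemma averageInner_AdL (g : G) (x y : EuclideanSpace ℝ (Fin n)) :
    averageInner n G (AdL n g x) (AdL n g y) = averageInner n G x y := by
  rw [averageInner_apply, averageInner_apply, ← haarMean_mul_right (innerOrbit x y) g]
  refine congrArg (haarMean G) (ContinuousMap.ext fun h => ?_)
  change innerSL ℝ (AdL n h (AdL n g x)) (AdL n h (AdL n g y)) =
    innerSL ℝ (AdL n (h * g) x) (AdL n (h * g) y)
  rw [AdL_mul_apply, AdL_mul_apply]

lemma averageInner_adL (v x y : EuclideanSpace ℝ (Fin n)) :
    averageInner n G (adL n G v x) y = - averageInner n G x (adL n G v y) := by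
  have h1 : (fun g : G => clmTwo (G := G) (averageInner n G) (AdL n g x) (AdL n g y)) =
      fun _ => averageInner n G x y := funext fun g => averageInner_AdL g x y
  have h2 := rgrad_two (G := G) (clmTwo (G := G) (averageInner n G)) 1 x y v
  rw [h1, rgrad_one, dOne_const, AdL_one] at h2
  exact eq_neg_of_add_eq_zero_left h2.symm

variable (n G) in
lemma exists_invariant_inner : ∃ B ∈ biInvariantForms (GroupLieAlgebra (𝓡 n) G),
    ∀ x, x ≠ 0 → 0 < B x x := by
  let B : LinearMap.BilinForm ℝ (GroupLieAlgebra (𝓡 n) G) := averageInner n G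
  have hB : ∀ v x y : GroupLieAlgebra (𝓡 n) G, B ⁅v, x⁆ y = - B x ⁅v, y⁆ := fun v x y => by
    have e1 := lie_eq_adL v x
    have e2 := lie_eq_adL v y
    rw [e1, e2]
    exact averageInner_adL v x y
  exact ⟨B, ⟨⟨fun x y => averageInner_comm x y⟩, hB⟩, fun x hx => averageInner_pos hx⟩

end InvariantInnerProduct

/-! ### The explicit primitive on `G` and the third Betti number -/

section DeRhamDimension

variable {n : ℕ} {G : Type*} [TopologicalSpace G] [ChartedSpace (EuclideanSpace ℝ (Fin n)) G]
  [Group G] [LieGroup (𝓡 n) ∞ G] [IsTopologicalGroup G] [CompactSpace G] [ConnectedSpace G]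
  {K : Subgroup G} {𝔭 : Submodule ℝ (GroupLieAlgebra (𝓡 n) G)}

/-- The pullback of `H_Q` to the group differs from `Q([·,·],·)` by an exact form. -/
lemma exists_primitive_pullback (h : IsCompl (subgroupLieAlgebra n K) 𝔭)
    (h𝔭 : ∀ k ∈ K, ∀ X ∈ 𝔭, Ad n k X ∈ 𝔭) (Q : vanishingForms (subgroupLieAlgebra n K)) :
    ∃ α : GroupLieAlgebra (𝓡 n) G [⋀^Fin 2]→ₗ[ℝ] ℝ,
      (∀ Z ∈ subgroupLieAlgebra n K, ∀ W ∈ subgroupLieAlgebra n K, α ![Z, W] = 0) ∧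
      (∀ X ∈ 𝔭, ∀ Y ∈ 𝔭, α ![X, Y] = 0) ∧
      (∀ X ∈ 𝔭, ∀ Z ∈ subgroupLieAlgebra n K, α ![X, Z] = Q.1.1 X Z) ∧
      ∀ (x : G) (X Y Z : GroupLieAlgebra (𝓡 n) G), hat h (threeForm h Q.1) ![X, Y, Z] =
        Q.1.1 ⁅X, Y⁆ Z + extDer (leftInvariantForm α) x ![X, Y, Z] := by
  refine ⟨mixedForm h Q.1.1, fun Z hZ W hW => ?_, fun X hX Y hY => ?_, fun X hX Z hZ => ?_,
    fun x X Y Z => ?_⟩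
  · rw [mixedForm_apply, pComp_of_mem' h hZ, pComp_of_mem' h hW]
    simp
  · rw [mixedForm_apply, kComp_of_mem' h hX, kComp_of_mem' h hY]
    simp
  · rw [mixedForm_apply, pComp_of_mem h hX, kComp_of_mem h hZ, pComp_of_mem' h hZ]
    simp
  · rw [extDer_leftInvariantForm_two, hat_threeForm_apply h (lie_mem_subgroupLieAlgebra h)
      (lie_mem_complement h h𝔭) Q]
    ring

variable [LieAlgebra.IsSemisimple ℝ (GroupLieAlgebra (𝓡 n) G)]

lemma finite_deRhamH3 (hK : IsClosed (K : Set G)) (h : IsCompl (subgroupLieAlgebra n K) 𝔭)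
    (h𝔭 : ∀ k ∈ K, ∀ X ∈ 𝔭, Ad n k X ∈ 𝔭) : Module.Finite ℝ (deRhamH3 n K) :=
  Module.Finite.equiv (deRhamEquiv hK h h𝔭)

lemma finrank_deRhamH3 (hK : IsClosed (K : Set G)) (h : IsCompl (subgroupLieAlgebra n K) 𝔭)
    (h𝔭 : ∀ k ∈ K, ∀ X ∈ 𝔭, Ad n k X ∈ 𝔭) :
    Module.finrank ℝ (deRhamH3 n K) + restrictionDim (subgroupLieAlgebra n K) =
      numSimpleIdeals (GroupLieAlgebra (𝓡 n) G) := by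
  have e := (deRhamEquiv hK h h𝔭).finrank_eq
  obtain ⟨B, hB, hpos⟩ := exists_invariant_inner n G
  rw [← e]
  exact finrank_vanishingForms hB hpos (subgroupLieAlgebra n K)

end DeRhamDimension

end HomogeneousSpace

end

/-! ### The theorem -/

open HomogeneousSpace in
theorem proposition4p1 {n : ℕ} {G : Type*} [TopologicalSpace G]
    [ChartedSpace (EuclideanSpace ℝ (Fin n)) G] [Group G] [LieGroup (𝓡 n) ∞ G]
    [T2Space G] [CompactSpace G] [ConnectedSpace G]
    [LieAlgebra.IsSemisimple ℝ (GroupLieAlgebra (𝓡 n) G)]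
    (K : Subgroup G) (hK : IsClosed (K : Set G)) (hK' : IsConnected (K : Set G))
    (𝔭 : Submodule ℝ (GroupLieAlgebra (𝓡 n) G))
    (h : IsCompl (subgroupLieAlgebra n K) 𝔭) (h𝔭 : ∀ k ∈ K, ∀ X ∈ 𝔭, Ad n k X ∈ 𝔭) :
    (∀ Q ∈ vanishingForms (subgroupLieAlgebra n K),
      (∀ X Y Z : 𝔭, threeForm h Q ![X, Y, Z] =
        Q.1 ⁅(X : GroupLieAlgebra (𝓡 n) G), (Y : GroupLieAlgebra (𝓡 n) G)⁆ Z
          + Q.1 (kComp h ⁅(X : GroupLieAlgebra (𝓡 n) G), (Y : GroupLieAlgebra (𝓡 n) G)⁆) Z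
          - Q.1 (kComp h ⁅(X : GroupLieAlgebra (𝓡 n) G), (Z : GroupLieAlgebra (𝓡 n) G)⁆) Y
          + Q.1 (kComp h ⁅(Y : GroupLieAlgebra (𝓡 n) G), (Z : GroupLieAlgebra (𝓡 n) G)⁆) X) ∧
      IsAdInvariant K (threeForm h Q) ∧
      leftInvariantForm (hat h (threeForm h Q)) ∈ closedForms (n := n) K 2 ∧
      ∃ α : GroupLieAlgebra (𝓡 n) G [⋀^Fin 2]→ₗ[ℝ] ℝ,
        (∀ Z ∈ subgroupLieAlgebra n K, ∀ W ∈ subgroupLieAlgebra n K, α ![Z, W] = 0) ∧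
        (∀ X ∈ 𝔭, ∀ Y ∈ 𝔭, α ![X, Y] = 0) ∧
        (∀ X ∈ 𝔭, ∀ Z ∈ subgroupLieAlgebra n K, α ![X, Z] = Q.1 X Z) ∧
        ∀ (x : G) (X Y Z : GroupLieAlgebra (𝓡 n) G), hat h (threeForm h Q) ![X, Y, Z] =
          Q.1 ⁅X, Y⁆ Z + extDer (leftInvariantForm α) x ![X, Y, Z]) ∧
    (∀ H : 𝔭 [⋀^Fin 3]→ₗ[ℝ] ℝ, IsAdInvariant K H →
      leftInvariantForm (hat h H) ∈ closedForms (n := n) K 2 →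
      ∃! Q : vanishingForms (subgroupLieAlgebra n K),
        ∃ β : 𝔭 [⋀^Fin 2]→ₗ[ℝ] ℝ, IsAdInvariant K β ∧
          ∀ x v, hat h H v = hat h (threeForm h Q) v + extDer (leftInvariantForm (hat h β)) x v) ∧
    (∃ Φ : vanishingForms (subgroupLieAlgebra n K) ≃ₗ[ℝ] deRhamH3 n K,
      ∀ Q : vanishingForms (subgroupLieAlgebra n K),
        ∃ hQ : leftInvariantForm (hat h (threeForm h Q)) ∈ closedForms (n := n) K 2,
          Φ Q = Submodule.Quotient.mk ⟨leftInvariantForm (hat h (threeForm h Q)), hQ⟩) ∧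
    Module.Finite ℝ (deRhamH3 n K) ∧
    (Module.finrank ℝ (deRhamH3 n K) : ℤ) =
      numSimpleIdeals (GroupLieAlgebra (𝓡 n) G) - restrictionDim (subgroupLieAlgebra n K) := by
  have : IsTopologicalGroup G := topologicalGroup_of_lieGroup (𝓡 n) ∞
  refine ⟨fun Q hQ => ⟨threeForm_eq_kComp h Q, isAdInvariant_threeForm h h𝔭 Q,
      threeForm_mem_closedForms h h𝔭 ⟨Q, hQ⟩, exists_primitive_pullback h h𝔭 ⟨Q, hQ⟩⟩,
    fun H hH hcl => existsUnique_threeForm_add_exact hK h h𝔭 hH hcl.2,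
    ⟨deRhamEquiv hK h h𝔭, fun Q => ⟨threeForm_mem_closedForms h h𝔭 Q, rfl⟩⟩,
    finite_deRhamH3 hK h h𝔭, ?_⟩
  exact eq_sub_of_add_eq (mod_cast finrank_deRhamH3 hK h h𝔭)
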